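/- Let $k$ be a field with $\operatorname{char}(k)\neq 2$. A variety over $k$ is a separated scheme of finite type over $k$, and $K_0(\mathrm{Var}_k)$ is the Grothendieck ring of varieties: the abelian group generated by isomorphism classes $[X]$ of varieties over $k$ modulo $[X]=[X\setminus Z]+[Z]$ for every closed subvariety $Z\subset X$, with product induced by $X\times_k Y$. Put $\mathbb L=[\mathbb A^1_k]$. Let $\mathrm{Quad}_n\simeq\mathbb A_k^{\binom{n+1}{2}}$ be the affine space of quadratic forms on $k^n$. The radical of a quadratic form $Q$ is $\operatorname{rad}_Q=\{v : Q(v+w)=Q(v)+Q(w)\ \text{for all } w\}$, and its rank is the codimension of $\operatorname{rad}_Q$. For $0\le r\le n$ let $\mathrm{Quad}_{n,r}\subset \mathrm{Quad}_n$ be the locally closed subvariety (with its reduced structure) of forms of rank $r$, and let $\mathrm{Gr}(m,n)$ be the Grassmannian of $m$-planes in $k^n$, i.e. the $k$-scheme representing the functor $A\mapsto\{\text{submodules of } A^n \text{ with locally free quotient of rank } n-m\}$ on $k$-algebras. Let ${n \brack m}_{\mathbb L}$ be the Gaussian binomial coefficient $[n]_q!/([m]_q!\,[n-m]_q!)\in\mathbb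 Z[q]$ evaluated at $q=\mathbb L$, where $[n]_q!=\prod_{i=1}^n(1+q+\dots+q^{i-1})$. (1) For all integers $0\le r\le n$, the Grassmannian $\mathrm{Gr}(n-r,n)$ exists, and there is a morphism of $k$-schemes $$\pi:\mathrm{Quad}_{n,r}\to \mathrm{Gr}(n-r,n),\qquad Q\mapsto \operatorname{rad}_Q$$ (given by this formula on points with values in every $k$-algebra), which is a Zariski-locally trivial fibration with fibre $\mathrm{Quad}_{r,r}$: every point of $\mathrm{Gr}(n-r,n)$ has an open neighbourhood $U$ such that $\pi^{-1}(U)\cong U\times_k \mathrm{Quad}_{r,r}$ over $U$. (2) For every integer $n\ge 0$, $$\mathbb L^{\binom{n+1}{2}}=\sum_{r=0}^{n}{n \brack n-r}_{\mathbb L}\,[\mathrm{Quad}_{r,r}]\quad\text{in } K_0(\mathrm{Var}_k).$$ -/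

import Mathlib

open CategoryTheory AlgebraicGeometry MonoidalCategory Limits
open scoped TensorProduct Polynomial

universe u

noncomputable section

namespace QuadMotive

/-! ### Gaussian polynomials -/

/-- The Gaussian polynomial `[n]_q = 1 + q + ⋯ + q ^ (n - 1)`. -/
def gaussInt (n : ℕ) : ℤ[X] := ∑ i ∈ Finset.range n, Polynomial.X ^ i

/-- The Gaussian factorial `[n]_q! = [1]_q [2]_q ⋯ [n]_q`. -/
def gaussFactorial (n : ℕ) : ℤ[X] := ∏ i ∈ Finset.range n, gaussInt (i + 1)

/-- The Gaussian binomial coefficient `[n]_q! / ([m]_q! [n - m]_q!)` (for `m ≤ n`). The denominator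
is a monic polynomial, and the quotient is taken in `ℤ[q]`. -/
def gaussBinom (n m : ℕ) : ℤ[X] :=
  gaussFactorial n /ₘ (gaussFactorial m * gaussFactorial (n - m))

/-! ### Varieties and the Grothendieck ring of varieties -/

section Varieties

variable (k : Type u) [Field k]

/-- A scheme over `k` is a variety if it is separated and of finite type over `k`. -/
def IsVariety : ObjectProperty (Over (Spec (.of k))) := fun X =>
  IsSeparated X.hom ∧ LocallyOfFiniteType X.hom ∧ QuasiCompact X.hom

instance : (IsVariety k).IsMonoidal where
  prop_unit := by
    exact ⟨inferInstanceAs (IsSeparated (𝟙 (Spec (.of k)))),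
      inferInstanceAs (LocallyOfFiniteType (𝟙 (Spec (.of k)))),
      inferInstanceAs (QuasiCompact (𝟙 (Spec (.of k))))⟩
  prop_tensor X Y hX hY := by
    obtain ⟨_, _, _⟩ := hX
    obtain ⟨_, _, _⟩ := hY
    refine ⟨?_, ?_, ?_⟩ <;> rw [Over.tensorObj_hom] <;> infer_instance

/-- The category of varieties over `k` and morphisms over `k`; its tensor product is the product
of varieties over `k` and its unit object is `Spec k`. -/
abbrev Var : Type (u + 1) := (IsVariety k).FullSubcategory

/-- The relations `[X] = [U] + [Z]`, where `Z ⟶ X` is a closed immersion of varieties and `U ⟶ X`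
is an open immersion onto the complement of `Z`. Isomorphic varieties have the same image in
`Skeleton (Var k)`. -/
def scissorRelations : Set (FreeAbelianGroup (Skeleton (Var k))) :=
  {a | ∃ (X Z U : Var k) (i : Z ⟶ X) (j : U ⟶ X),
    IsClosedImmersion i.hom.left ∧ IsOpenImmersion j.hom.left ∧
    Set.range j.hom.left = (Set.range i.hom.left)ᶜ ∧
    a = FreeAbelianGroup.of (toSkeleton X) -
      (FreeAbelianGroup.of (toSkeleton U) + FreeAbelianGroup.of (toSkeleton Z))}

/-- The Grothendieck ring of varieties: the free abelian group on isomorphism classes of varieties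
modulo the relations `[X] = [X \ Z] + [Z]`. The free abelian group carries the multiplication
induced by the product of varieties. (The subgroup spanned by the relations is already an ideal,
since a relation multiplied by `[Y]` is again a relation.) -/
def K0Var : Type (u + 1) :=
  FreeAbelianGroup (Skeleton (Var k)) ⧸ Ideal.span (scissorRelations k)

instance : CommRing (K0Var k) :=
  inferInstanceAs (CommRing (FreeAbelianGroup (Skeleton (Var k)) ⧸ Ideal.span (scissorRelations k)))

variable {k}

/-- The class `[X]` of a variety. -/
def K0Var.mk (X : Var k) : K0Var k :=
  Ideal.Quotient.mk (Ideal.span (scissorRelations k)) (FreeAbelianGroup.of (toSkeleton X))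

/-- `Spec A` as a scheme over `k`, for a `k`-algebra `A`. -/
abbrev specOver (k : Type u) [Field k] (A : Type u) [CommRing A] [Algebra k A] :
    Over (Spec (.of k)) :=
  Over.mk (Spec.map (CommRingCat.ofHom (algebraMap k A)))

/-- The morphism `Spec B ⟶ Spec A` over `k` induced by `f : A →ₐ[k] B`. -/
def specOverMap {A B : Type u} [CommRing A] [Algebra k A] [CommRing B] [Algebra k B]
    (f : A →ₐ[k] B) : specOver k B ⟶ specOver k A :=
  Over.homMk (Spec.map (CommRingCat.ofHom f.toRingHom)) (by
    simp only [Over.mk_hom, Over.mk_left, ← Spec.map_comp, ← CommRingCat.ofHom_comp]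
    congr 2
    exact f.comp_algebraMap)

lemma isVariety_specOver (A : Type u) [CommRing A] [Algebra k A] [Algebra.FiniteType k A] :
    IsVariety k (specOver k A) := by
  refine ⟨inferInstanceAs (IsSeparated (Spec.map _)), ?_,
    inferInstanceAs (QuasiCompact (Spec.map _))⟩
  change LocallyOfFiniteType (Spec.map _)
  rw [HasRingHomProperty.Spec_iff (P := @LocallyOfFiniteType)]
  exact (RingHom.finiteType_algebraMap (A := k) (B := A)).mpr inferInstance

variable (k)

/-- The affine line over `k`. -/
def affineLine : Var k := ⟨specOver k k[X], isVariety_specOver _⟩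

/-- The Lefschetz motive `𝕃`, the class of the affine line. -/
def lefschetz : K0Var k := K0Var.mk (affineLine k)

end Varieties

/-! ### Quadratic forms -/

section QuadraticForms

/-- The quadratic form `∑_{i ≤ j} c_{ij} x_i x_j` on `A ^ n`; the unordered pairs `{i, j}`
index the monomials of degree two. -/
def formOfCoeffs {A : Type*} [CommRing A] {n : ℕ} (c : Sym2 (Fin n) → A) :
    QuadraticForm A (Fin n → A) :=
  ∑ s : Sym2 (Fin n), c s • Sym2.lift
    ⟨fun i j => QuadraticMap.linMulLin (LinearMap.proj (R := A) (φ := fun _ : Fin n => A) i)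
        (LinearMap.proj (R := A) (φ := fun _ : Fin n => A) j),
      fun i j => by ext v; simp [mul_comm]⟩ s

/-- The radical `{v | Q (v + w) = Q v + Q w for all w}` of a quadratic form. -/
def rad {A V : Type*} [CommRing A] [AddCommGroup V] [Module A V] (Q : QuadraticForm A V) :
    Submodule A V where
  carrier := {v | ∀ w, Q (v + w) = Q v + Q w}
  zero_mem' w := by simp
  add_mem' {v v'} hv hv' w := by
    rw [add_assoc, hv, hv', hv, add_assoc]
  smul_mem' a v hv w := by
    have h : ∀ w, QuadraticMap.polar Q v w = 0 := fun w => by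
      rw [QuadraticMap.polar, hv w]; ring
    have h' := QuadraticMap.polar_smul_left Q a v w
    rw [h w, smul_zero, QuadraticMap.polar] at h'
    linear_combination h'

/-- The rank of a quadratic form on a vector space is the codimension of its radical. -/
def formRank {K V : Type*} [Field K] [AddCommGroup V] [Module K V] (Q : QuadraticForm K V) : ℕ :=
  Module.finrank K V - Module.finrank K (rad Q)

variable (k : Type u) [Field k]

/-- The coordinate ring of the affine space of quadratic forms on `k ^ n`. -/
abbrev QuadRing (n : ℕ) : Type u := MvPolynomial (Sym2 (Fin n)) k

variable {k} in
/-- The quadratic form over the residue field `κ(x)` given by a point `x` of the affine space of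
quadratic forms. -/
def formAt {n : ℕ} (x : PrimeSpectrum (QuadRing k n)) :
    QuadraticForm x.asIdeal.ResidueField (Fin n → x.asIdeal.ResidueField) :=
  formOfCoeffs fun s => algebraMap (QuadRing k n) x.asIdeal.ResidueField (MvPolynomial.X s)

/-- The locus of quadratic forms of rank at most `r` in the affine space of quadratic forms. -/
def rankLE (n r : ℕ) : Set (PrimeSpectrum (QuadRing k n)) := {x | formRank (formAt x) ≤ r}

/-- The locus of quadratic forms of rank less than `r` in the affine space of quadratic forms. -/
def rankLT (n r : ℕ) : Set (PrimeSpectrum (QuadRing k n)) := {x | formRank (formAt x) < r}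

/-- The affine space `Quad_n` of quadratic forms on `k ^ n`. -/
def quadAll (n : ℕ) : Over (Spec (.of k)) := specOver k (QuadRing k n)

/-- The closed subvariety `Quad_{n, ≤ r}` of `Quad_n`: the reduced closed subscheme
whose points are the quadratic forms of rank at most `r`. -/
def quadLE (n r : ℕ) : Over (Spec (.of k)) :=
  specOver k (QuadRing k n ⧸ PrimeSpectrum.vanishingIdeal (rankLE k n r))

/-- The inclusion of `Quad_{n, ≤ r}` in `Quad_n`. -/
def quadLEι (n r : ℕ) : quadLE k n r ⟶ quadAll k n :=
  specOverMap (Ideal.Quotient.mkₐ k _)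

/-- The open subset of `Quad_{n, ≤ r}` of the forms of rank exactly `r`, that is, the complement of
the (closed) locus of forms of rank less than `r`. -/
def quadOpen (n r : ℕ) : (quadLE k n r).left.Opens :=
  (quadLEι k n r).left ⁻¹ᵁ (TopologicalSpace.Closeds.closure (rankLT k n r)).compl

/-- The variety `Quad_{n, r}` of quadratic forms of rank `r` on `k ^ n`. -/
def quad (n r : ℕ) : Over (Spec (.of k)) :=
  Over.mk ((quadOpen k n r).ι ≫ (quadLE k n r).hom)

/-- The inclusion of `Quad_{n, r}` in the affine space `Quad_n`. -/
def quadι (n r : ℕ) : quad k n r ⟶ quadAll k n :=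
  Over.homMk (quadOpen k n r).ι rfl ≫ quadLEι k n r

lemma isVariety_quad (n r : ℕ) : IsVariety k (quad k n r) := by
  obtain ⟨_, _, _⟩ : IsVariety k (quadLE k n r) := isVariety_specOver _
  have : IsLocallyNoetherian (quadLE k n r).left :=
    inferInstanceAs (IsLocallyNoetherian (Spec (.of
      (QuadRing k n ⧸ PrimeSpectrum.vanishingIdeal (rankLE k n r)))))
  exact ⟨inferInstanceAs (IsSeparated ((quadOpen k n r).ι ≫ (quadLE k n r).hom)),
    inferInstanceAs (LocallyOfFiniteType ((quadOpen k n r).ι ≫ (quadLE k n r).hom)),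
    inferInstanceAs (QuasiCompact ((quadOpen k n r).ι ≫ (quadLE k n r).hom))⟩

/-- `Quad_{n, r}` as an object of the category of varieties. -/
def quadVar (n r : ℕ) : Var k := ⟨quad k n r, isVariety_quad k n r⟩

variable {k} in
/-- The quadratic form over `A` given by an `A`-valued point of `Quad_{n, r}`. -/
def formOfPoint {n r : ℕ} {A : Type u} [CommRing A] [Algebra k A]
    (x : specOver k A ⟶ quad k n r) : QuadraticForm A (Fin n → A) :=
  formOfCoeffs fun s =>
    (Spec.preimage (R := .of (QuadRing k n)) (S := .of A) (x ≫ quadι k n r).left).hom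
      (MvPolynomial.X s)

end QuadraticForms

/-! ### Grassmannians, and fibrations -/

section Grassmannian

variable {k : Type u} [Field k]

/-- The structure, on a scheme `G` over `k`, of the Grassmannian `Gr(m, n)` of `m`-planes in `k ^ n`
(for `m ≤ n`): `G` represents the functor that sends a `k`-algebra `A` to the set of submodules of
`A ⊗ k ^ n` whose quotient is locally free of rank `n - m`, equivalently, of direct summands of
rank `m`. -/
structure GrassmannianData (m n : ℕ) (G : Over (Spec (.of k))) where
  /-- The submodule of `A ⊗ k ^ n` corresponding to an `A`-valued point. -/
  pointEquiv (A : Type u) [CommRing A] [Algebra k A] :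
    (specOver k A ⟶ G) ≃ Module.Grassmannian A (A ⊗[k] (Fin n → k)) (n - m)
  pointEquiv_comp {A B : Type u} [CommRing A] [Algebra k A] [CommRing B] [Algebra k B]
    (f : A →ₐ[k] B) (x : specOver k A ⟶ G) :
    pointEquiv B (specOverMap f ≫ x) = (pointEquiv A x).map f

/-- The submodule of `A ^ n` corresponding to an `A`-valued point of a Grassmannian. -/
def GrassmannianData.plane {m n : ℕ} {G : Over (Spec (.of k))} (e : GrassmannianData m n G)
    {A : Type u} [CommRing A] [Algebra k A] (x : specOver k A ⟶ G) : Submodule A (Fin n → A) :=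
  (e.pointEquiv A x).toSubmodule.map
    (TensorProduct.piScalarRight k A A (Fin n)).toLinearMap

/-- `π` is the morphism `Q ↦ rad Q`, on points with values in arbitrary `k`-algebras. -/
def IsRadicalMap {m n r : ℕ} {G : Over (Spec (.of k))} (e : GrassmannianData m n G)
    (π : quad k n r ⟶ G) : Prop :=
  ∀ (A : Type u) [CommRing A] [Algebra k A] (x : specOver k A ⟶ quad k n r),
    e.plane (x ≫ π) = rad (formOfPoint x)

/-- A morphism `π : E ⟶ B` over `k` is a Zariski-locally trivial fibration with fibre `F` if every
point of `B` has an open neighbourhood `U` with an isomorphism `π⁻¹(U) ≅ U × F` over `U`. -/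
def IsZariskiLocallyTrivial {E B : Over (Spec (.of k))} (π : E ⟶ B) (F : Over (Spec (.of k))) :
    Prop :=
  ∀ b : B.left, ∃ (U : B.left.Opens) (_ : b ∈ U)
    (φ : (π.left ⁻¹ᵁ U).toScheme ≅ pullback (U.ι ≫ B.hom) F.hom),
    φ.hom ≫ pullback.fst (U.ι ≫ B.hom) F.hom = π.left ∣_ U

end Grassmannian

end QuadMotive

end

/-! Part (1). A morphism of `k`-schemes is a natural map on points with values in `k`-algebras, so
the work takes place with matrices over an arbitrary `k`-algebra `A`. Since 2 is invertible, a form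
amounts to its symmetric polar matrix `M`, and its radical is `ker M`. An `A`-point of `Quad_{n,r}`
is an `M` that satisfies all equations of the reduced locus of rank at most `r` and has rank `r` at
every prime of `A` (`isQuadPoint_coeffs`, `exists_point`).

Generators of the ideal of these equations are never needed. It contains the relation that recovers
`M` from its rows through an invertible principal block of size `r`. Such blocks exist locally, and
this yields an `X` with `M X M = M` (`IsQuadPoint.exists_regular`). Hence `ker M` has a locally free
quotient of rank `r` and commutes with base change, which gives `π`. Conversely `Φᵀ D Φ`, with `D`
of size `r`, satisfies the equations because it does so when all entries are indeterminates
(`aeval_eq_zero_of_conj`). Where the universal submodule is `ker Φ` with `Φ X = 1`, the maps `M ↦ Xᵀ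
M X` and `D ↦ Φᵀ D Φ` are mutually inverse and trivialize `π` (`exists_trivialization`). The
Grassmannian itself is glued from the charts on which `r` chosen columns of `Φ` form the identity
matrix.

Part (2) is proved independently of the fibration. Let `d_n = [Quad_{n,n}]`, the class of the
invertible symmetric matrices of size `n`. Matrices of size `n + 1` are cut up according to their
first row. If the corner is a unit, splitting it off leaves a Schur complement of size `n`. If the
corner is zero, some other entry `u` of the row is used, and the block with rows `(0, u)` and `(u,
v)` is split off, leaving size `n - 1`. This gives `d_{n+1} = (𝕃 - 1) 𝕃^n d_n + 𝕃^n (𝕃^n - 1)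
d_{n-1}` (`class_symMat_recursion`). By the `q`-Pascal rule, this recursion multiplies the weighted
sum by `𝕃^(n+1)` when `n` increases by one (`sum_qBinom_mul`). -/

noncomputable section

namespace QuadMotive

/-! ### Morphisms of `k`-schemes from natural maps on points with values in `k`-algebras -/

section AffinePoints

variable {k : Type u} [Field k]

/-- The structure of a `k`-algebra on the ring of global functions of a scheme over `k`. -/
@[reducible]
def globalAlgebra (T : Over (Spec (.of k))) : Algebra k Γ(T.left, ⊤) :=
  ((Scheme.ΓSpecIso (.of k)).inv ≫ T.hom.appTop).hom.toAlgebra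

/-- An affine scheme over `k` is the spectrum of its ring of global functions. -/
def affineIso (T : Over (Spec (.of k))) [IsAffine T.left] :
    letI := globalAlgebra T
    T ≅ specOver k Γ(T.left, ⊤) :=
  letI := globalAlgebra T
  Over.isoMk T.left.isoSpec (by
    change T.left.isoSpec.hom ≫ Spec.map ((Scheme.ΓSpecIso (.of k)).inv ≫ T.hom.appTop) = T.hom
    rw [Spec.map_comp, ← Category.assoc, Scheme.isoSpec_hom_naturality, Category.assoc,
      ← Scheme.isoSpec_Spec_inv]
    simp)

lemma exists_specOverMap {A B : Type u} [CommRing A] [Algebra k A] [CommRing B] [Algebra k B]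
    (g : specOver k B ⟶ specOver k A) : ∃ f : A →ₐ[k] B, g = specOverMap f := by
  obtain ⟨φ, hφ⟩ := Spec.map_surjective g.left
  have hw := Over.w g
  rw [← hφ] at hw
  simp only [Over.mk_hom] at hw
  erw [← Spec.map_comp] at hw
  have h2 := Spec.map_injective hw
  refine ⟨⟨φ.hom, fun r => ?_⟩, ?_⟩
  · exact congr($(h2) r)
  · ext1
    exact hφ.symm

@[simp] lemma specOverMap_comp {A B C : Type u} [CommRing A] [Algebra k A] [CommRing B]
    [Algebra k B] [CommRing C] [Algebra k C] (f : A →ₐ[k] B) (g : B →ₐ[k] C) :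
    specOverMap (g.comp f) = specOverMap g ≫ specOverMap f := by
  ext1
  change Spec.map _ = Spec.map _ ≫ Spec.map _
  rw [← Spec.map_comp]
  rfl

@[simp] lemma specOverMap_id {A : Type u} [CommRing A] [Algebra k A] :
    specOverMap (AlgHom.id k A) = 𝟙 _ := by
  ext1
  exact Spec.map_id _

lemma specOverMap_injective {A B : Type u} [CommRing A] [Algebra k A] [CommRing B] [Algebra k B] :
    Function.Injective (specOverMap (k := k) (A := A) (B := B)) := by
  intro f g h
  have := Spec.map_injective congr(($h).left)
  ext a
  exact congr($(this) a)

/-- A family of maps `X(A) → Y(A)`, natural in the `k`-algebra `A`. -/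
structure PointsMap (X Y : Over (Spec (.of k))) where
  app (A : Type u) [CommRing A] [Algebra k A] : (specOver k A ⟶ X) → (specOver k A ⟶ Y)
  naturality {A B : Type u} [CommRing A] [Algebra k A] [CommRing B] [Algebra k B] (f : A →ₐ[k] B)
    (x : specOver k A ⟶ X) : app B (specOverMap f ≫ x) = specOverMap f ≫ app A x

namespace PointsMap

variable {X Y : Over (Spec (.of k))} (η : PointsMap X Y)

/-- The extension of a natural family of maps to points with values in affine schemes over `k`. -/
def ext (T : Over (Spec (.of k))) [IsAffine T.left] (x : T ⟶ X) : T ⟶ Y :=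
  letI := globalAlgebra T
  (affineIso T).hom ≫ η.app Γ(T.left, ⊤) ((affineIso T).inv ≫ x)

lemma ext_comp {T T' : Over (Spec (.of k))} [IsAffine T.left] [IsAffine T'.left] (h : T ⟶ T')
    (x : T' ⟶ X) : η.ext T (h ≫ x) = h ≫ η.ext T' x := by
  let := globalAlgebra T
  let := globalAlgebra T'
  obtain ⟨f, hf⟩ := exists_specOverMap ((affineIso T).inv ≫ h ≫ (affineIso T').hom)
  have : (affineIso T).inv ≫ h ≫ x = specOverMap f ≫ (affineIso T').inv ≫ x := by
    rw [← hf]; simp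
  rw [ext, this, η.naturality, ← hf]
  simp [ext]

/-- The ring of global functions of `Spec A` is only isomorphic to `A`, so `ext` and `app` are
compared by naturality along that isomorphism. -/
lemma ext_specOver {A : Type u} [CommRing A] [Algebra k A] (x : specOver k A ⟶ X) :
    haveI : IsAffine (specOver k A).left := inferInstanceAs (IsAffine (Spec (.of A)))
    η.ext (specOver k A) x = η.app A x := by
  have : IsAffine (specOver k A).left := inferInstanceAs (IsAffine (Spec (.of A)))
  let := globalAlgebra (specOver k A)
  obtain ⟨f, hf⟩ := exists_specOverMap (affineIso (specOver k A)).inv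
  rw [ext, hf, η.naturality, ← hf]
  simp

/-- An open subscheme of a scheme over `k`, as a scheme over `k`. -/
abbrev openOver (X : Over (Spec (.of k))) (U : X.left.Opens) : Over (Spec (.of k)) :=
  Over.mk (U.ι ≫ X.hom)

/-- The inclusion of an open subscheme, as a morphism over `k`. -/
abbrev openι (X : Over (Spec (.of k))) (U : X.left.Opens) : openOver X U ⟶ X :=
  Over.homMk U.ι

/-- The morphism given by a natural family of maps, on an affine open subset. -/
def homOn (U : X.left.affineOpens) : openOver X U.1 ⟶ Y :=
  haveI : IsAffine (openOver X U.1).left := U.2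
  η.ext (openOver X U.1) (openι X U.1)

lemma homOfLE_homOn {U V : X.left.affineOpens} (hUV : U ≤ V) :
    X.left.homOfLE hUV ≫ (η.homOn V).left = (η.homOn U).left := by
  have : IsAffine (openOver X U.1).left := U.2
  have : IsAffine (openOver X V.1).left := V.2
  let h : openOver X U.1 ⟶ openOver X V.1 := Over.homMk (X.left.homOfLE hUV) (by simp)
  have := η.ext_comp h (openι X V.1)
  have h2 : h ≫ openι X V.1 = openι X U.1 := by ext1; simp [h]
  rw [h2] at this
  exact congr(($this).left).symm

/-- The morphism of schemes given by a natural family of maps on points with values in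
algebras. -/
def hom : X ⟶ Y :=
  -- The cover by all affine opens is directed under inclusion, so compatibility with restriction to
  -- smaller affine opens is the only gluing condition.
  Scheme.OpenCover.glueMorphismsOverOfLocallyDirected X.left.directedAffineCover
    (fun U => (η.homOn U).left) (fun hUV => η.homOfLE_homOn (leOfHom hUV))
    (fun U => Over.w (η.homOn U))

lemma openι_hom (U : X.left.affineOpens) : openι X U.1 ≫ η.hom = η.homOn U := by
  ext1
  exact Scheme.OpenCover.map_glueMorphismsOverOfLocallyDirected_left X.left.directedAffineCover
    (fun U => (η.homOn U).left) (fun hUV => η.homOfLE_homOn (leOfHom hUV))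
    (fun U => Over.w (η.homOn U)) U

/-- The point `x` need not factor through one affine open of `X`. Equality is checked near each `t`,
on an affine `V` that `x` maps into an affine `U`, where `ext_comp` for `V ⟶ U` applies. -/
lemma comp_hom {A : Type u} [CommRing A] [Algebra k A] (x : specOver k A ⟶ X) :
    x ≫ η.hom = η.app A x := by
  have : IsAffine (specOver k A).left := inferInstanceAs (IsAffine (Spec (.of A)))
  rw [← ext_specOver]
  ext1
  refine Scheme.hom_ext_of_forall _ _ fun t => ?_
  obtain ⟨_, ⟨U, hU, rfl⟩, hxU, -⟩ :=
    X.left.isBasis_affineOpens.exists_subset_of_mem_open (Set.mem_univ (x.left t)) isOpen_univ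
  obtain ⟨_, ⟨V, hV, rfl⟩, htV, hVU⟩ :=
    (specOver k A).left.isBasis_affineOpens.exists_subset_of_mem_open
      (show t ∈ ((x.left ⁻¹ᵁ U : (specOver k A).left.Opens) : Set _) from hxU)
      (x.left ⁻¹ᵁ U).isOpen
  refine ⟨V, htV, ?_⟩
  replace hVU : V ≤ x.left ⁻¹ᵁ U := hVU
  have : IsAffine (openOver X U).left := hU
  have : IsAffine (openOver (specOver k A) V).left := hV
  let g : openOver (specOver k A) V ⟶ openOver X U :=
    Over.homMk (x.left.resLE U V hVU) (by
      change x.left.resLE U V _ ≫ Scheme.Opens.ι U ≫ X.hom =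
        Scheme.Opens.ι V ≫ (specOver k A).hom
      rw [Scheme.Hom.resLE_comp_ι_assoc, Over.w x])
  have hg : g ≫ openι X U = openι (specOver k A) V ≫ x := by
    ext1
    exact Scheme.Hom.resLE_comp_ι ..
  have h1 := η.ext_comp g (openι X U)
  change _ = g ≫ η.homOn ⟨U, hU⟩ at h1
  rw [hg, ext_comp, ← η.openι_hom ⟨U, hU⟩, ← Category.assoc, hg] at h1
  have := congr(($h1).left)
  simpa using this.symm

end PointsMap

/-- Two morphisms over `k` that agree on points with values in algebras are equal. -/
lemma hom_ext_of_points {X Y : Over (Spec (.of k))} {f g : X ⟶ Y}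
    (h : ∀ (A : Type u) [CommRing A] [Algebra k A] (x : specOver k A ⟶ X), x ≫ f = x ≫ g) :
    f = g := by
  ext1
  refine X.left.directedAffineCover.hom_ext _ _ fun U => ?_
  have : IsAffine (PointsMap.openOver X U.1).left := U.2
  let := globalAlgebra (PointsMap.openOver X U.1)
  have := h _ ((affineIso (PointsMap.openOver X U.1)).inv ≫ PointsMap.openι X U.1)
  simp only [Category.assoc, Iso.cancel_iso_inv_left] at this
  exact congr(($this).left)

/-- A natural family of bijections on points with values in algebras gives an isomorphism. -/
def isoOfPoints {X Y : Over (Spec (.of k))} (η : PointsMap X Y) (ξ : PointsMap Y X)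
    (h : ∀ (A : Type u) [CommRing A] [Algebra k A] (x : specOver k A ⟶ X), ξ.app A (η.app A x) = x)
    (h' : ∀ (A : Type u) [CommRing A] [Algebra k A] (y : specOver k A ⟶ Y),
      η.app A (ξ.app A y) = y) : X ≅ Y where
  hom := η.hom
  inv := ξ.hom
  hom_inv_id := hom_ext_of_points fun A _ _ x => by
    rw [← Category.assoc, η.comp_hom, ξ.comp_hom, h, Category.comp_id]
  inv_hom_id := hom_ext_of_points fun A _ _ x => by
    rw [← Category.assoc, ξ.comp_hom, η.comp_hom, h', Category.comp_id]

end AffinePoints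

/-! ### Rank and minors of matrices over a field -/

section SymmetricMatrices

open Matrix

lemma le_rank_of_minor {K ι κ : Type*} [Field K] [Fintype ι] [Fintype κ] {r : ℕ}
    (M : Matrix ι κ K) (I : Fin r → ι) (J : Fin r → κ) (h : (M.submatrix I J).det ≠ 0) :
    r ≤ M.rank := by
  have h1 := rank_of_det_ne_zero h
  have h2 := rank_submatrix_le M I J
  simp only [Fintype.card_fin] at h1
  omega

/-- The rows in `I` are independent and as many as the rank allows, so they span the row space and
`M = C * M.submatrix I id` for some `C`. Restriction to the columns `J` determines `C`. -/
lemma eq_of_rank_le_of_minor {K ι κ : Type*} [Field K] [Fintype ι] [Fintype κ] {r : ℕ}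
    (M : Matrix ι κ K) (I : Fin r → ι) (J : Fin r → κ) (h : (M.submatrix I J).det ≠ 0)
    (hr : M.rank ≤ r) :
    M = M.submatrix id J * (M.submatrix I J)⁻¹ * M.submatrix I id := by
  have hu : IsUnit (M.submatrix I J).det := isUnit_iff_ne_zero.mpr h
  have hli : LinearIndependent K (M.submatrix I id).row := by
    have h0 : LinearIndependent K (M.submatrix I J).row :=
      linearIndependent_rows_iff_isUnit.mpr ((isUnit_iff_isUnit_det _).mpr hu)
    let F : (κ → K) →ₗ[K] (Fin r → K) := LinearMap.funLeft K K J
    have : (M.submatrix I J).row = F ∘ (M.submatrix I id).row := rfl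
    rw [this] at h0
    exact h0.of_comp
  have hspan : Submodule.span K (Set.range (M.submatrix I id).row) =
      Submodule.span K (Set.range M.row) := by
    apply Submodule.eq_of_le_of_finrank_le
    · apply Submodule.span_mono
      rintro _ ⟨i, rfl⟩
      exact ⟨I i, rfl⟩
    · rw [← rank_eq_finrank_span_row, finrank_span_eq_card hli, Fintype.card_fin]
      exact hr
  have hC : ∀ i, ∃ c : Fin r → K, c ᵥ* (M.submatrix I id) = M.row i := by
    intro i
    have : M.row i ∈ Submodule.span K (Set.range (M.submatrix I id).row) :=
      hspan ▸ Submodule.subset_span ⟨i, rfl⟩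
    obtain ⟨c, hc⟩ := (Submodule.mem_span_range_iff_exists_fun K).mp this
    refine ⟨c, ?_⟩
    rw [← hc, vecMul_eq_sum]
    rfl
  choose C hC using hC
  have hM : M = Matrix.of C * M.submatrix I id := by
    ext i j
    exact (congrFun (hC i) j).symm
  have hJ : M.submatrix id J = Matrix.of C * M.submatrix I J := by
    conv_lhs => rw [hM]
    rfl
  rw [hJ, Matrix.mul_assoc (Matrix.of C), mul_nonsing_inv _ hu, Matrix.mul_one]
  exact hM

lemma exists_rows_of_rank {K ι κ : Type*} [Field K] [Fintype ι] [Fintype κ]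
    (M : Matrix ι κ K) {r : ℕ} (hr : M.rank = r) :
    ∃ I : Fin r → ι, (M.submatrix I id).rank = r := by
  obtain ⟨f, hf, hspan⟩ : ∃ f : Fin r → κ → K, (∀ i, f i ∈ Set.range M.row) ∧
      Submodule.span K (Set.range f) = Submodule.span K (Set.range M.row) := by
    rw [← hr, rank_eq_finrank_span_row]
    obtain ⟨f, hf, hspan, -⟩ := Submodule.exists_fun_fin_finrank_span_eq K (Set.range M.row)
    exact ⟨f, hf, hspan⟩
  choose I hI using hf
  have : (M.submatrix I id).row = f := funext hI
  exact ⟨I, by rw [rank_eq_finrank_span_row, this, hspan, ← rank_eq_finrank_span_row, hr]⟩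

lemma exists_minor {K ι κ : Type*} [Field K] [Fintype ι] [Fintype κ]
    (M : Matrix ι κ K) {r : ℕ} (hr : M.rank = r) :
    ∃ (I : Fin r → ι) (J : Fin r → κ), (M.submatrix I J).det ≠ 0 := by
  obtain ⟨I, hI⟩ := exists_rows_of_rank M hr
  obtain ⟨J, hJ⟩ := exists_rows_of_rank (M.submatrix I id)ᵀ (by rw [rank_transpose, hI])
  refine ⟨I, J, ?_⟩
  rw [← rank_transpose] at hJ
  rw [← isUnit_iff_ne_zero, ← isUnit_iff_isUnit_det, ← linearIndependent_rows_iff_isUnit,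
    linearIndependent_iff_card_eq_finrank_span, Set.finrank,
    ← rank_eq_finrank_span_row, Fintype.card_fin]
  exact hJ.symm

/-- Let the rows in `J` span the row space, so that `M = C * M_J`. By symmetry `M = M^J * Cᵀ`, hence
`M_J = M_{JJ} * Cᵀ`, and the principal block `M_{JJ}` has rank at least that of `M`. No assumption
on the characteristic is needed. -/
lemma exists_principal_minor {K ι : Type*} [Field K] [Fintype ι]
    (M : Matrix ι ι K) (hM : M.IsSymm) {r : ℕ} (hr : M.rank = r) :
    ∃ J : Fin r → ι, (M.submatrix J J).det ≠ 0 := by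
  obtain ⟨f, hf, hspan⟩ : ∃ f : Fin r → ι → K, (∀ i, f i ∈ Set.range M.row) ∧
      Submodule.span K (Set.range f) = Submodule.span K (Set.range M.row) := by
    rw [← hr, rank_eq_finrank_span_row]
    obtain ⟨f, hf, hspan, -⟩ := Submodule.exists_fun_fin_finrank_span_eq K (Set.range M.row)
    exact ⟨f, hf, hspan⟩
  choose J hJ using hf
  have hJf : (M.submatrix J id).row = f := funext hJ
  have hC : ∀ i, ∃ c : Fin r → K, c ᵥ* (M.submatrix J id) = M.row i := by
    intro i
    have : M.row i ∈ Submodule.span K (Set.range (M.submatrix J id).row) := by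
      rw [hJf, hspan]
      exact Submodule.subset_span ⟨i, rfl⟩
    obtain ⟨c, hc⟩ := (Submodule.mem_span_range_iff_exists_fun K).mp this
    refine ⟨c, ?_⟩
    rw [← hc, vecMul_eq_sum]
    rfl
  choose C hC using hC
  have h1 : M = Matrix.of C * M.submatrix J id := by
    ext i j
    exact (congrFun (hC i) j).symm
  have h2 : M.submatrix J id = M.submatrix J J * (Matrix.of C)ᵀ := by
    have h3 : M = M.submatrix id J * (Matrix.of C)ᵀ := by
      conv_lhs => rw [← hM, h1, transpose_mul, transpose_submatrix, hM]
    conv_lhs => rw [h3]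
    rfl
  refine ⟨J, ?_⟩
  rw [← isUnit_iff_ne_zero, ← isUnit_iff_isUnit_det, ← linearIndependent_rows_iff_isUnit,
    linearIndependent_iff_card_eq_finrank_span, Set.finrank,
    ← rank_eq_finrank_span_row, Fintype.card_fin]
  refine le_antisymm ?_ ((rank_le_card_height _).trans (by simp))
  calc r = M.rank := hr.symm
    _ ≤ (M.submatrix J id).rank := by
      conv_lhs => rw [h1]
      exact rank_mul_le_right _ _
    _ ≤ _ := by
      rw [h2]
      exact rank_mul_le_left _ _

/-- The rank of a matrix does not change under field extensions. -/
lemma rank_map {K L ι κ : Type*} [Field K] [Field L] [Fintype ι] [Fintype κ] (f : K →+* L)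
    (M : Matrix ι κ K) : (M.map f).rank = M.rank := by
  obtain ⟨I, J, hJ⟩ := exists_minor M rfl
  apply le_antisymm
  · have := eq_of_rank_le_of_minor M I J hJ le_rfl
    conv_lhs => rw [this, Matrix.map_mul]
    refine (rank_mul_le_right _ _).trans ((rank_le_card_height _).trans (by simp))
  · apply le_rank_of_minor _ I J
    change (f.mapMatrix (M.submatrix I J)).det ≠ 0
    rw [← RingHom.map_det]
    simpa using hJ

end SymmetricMatrices

/-! ### The polar matrix of a quadratic form -/

section PolarMatrix

open Matrix

variable {A : Type*} [CommRing A] {n : ℕ}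

/-- The matrix of the polar form of the quadratic form with coefficients `c`. -/
def polarMat (c : Sym2 (Fin n) → A) : Matrix (Fin n) (Fin n) A :=
  Matrix.of fun i j => if i = j then 2 * c s(i, j) else c s(i, j)

lemma polarMat_isSymm (c : Sym2 (Fin n) → A) : (polarMat c).IsSymm := by
  ext i j
  simp only [polarMat, transpose_apply, of_apply, eq_comm (a := j), Sym2.eq_swap (a := j)]

lemma polarMat_map {B F : Type*} [CommRing B] [FunLike F A B] [RingHomClass F A B] (f : F)
    (c : Sym2 (Fin n) → A) : polarMat (fun s => f (c s)) = (polarMat c).map f := by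
  ext i j
  simp only [polarMat, map_apply, of_apply]
  split_ifs <;> simp [map_ofNat]

/-- The diagonal of the polar matrix is twice the diagonal of the coefficients. Invertibility of 2
is used here and in `exists_polarMat_eq`, and the hypothesis on the characteristic enters the proof
only through these two lemmas. -/
lemma polarMat_injective (h2 : IsUnit (2 : A)) : Function.Injective (polarMat (A := A) (n := n)) := by
  intro c d h
  ext s
  induction s with | _ i j
  have := congr($h i j)
  simp only [polarMat, of_apply] at this
  split_ifs at this
  · exact h2.mul_left_cancel this
  · exact this

lemma exists_polarMat_eq (h2 : IsUnit (2 : A)) {M : Matrix (Fin n) (Fin n) A} (hM : M.IsSymm) :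
    ∃ c, polarMat c = M := by
  obtain ⟨u, hu⟩ := h2
  refine ⟨Sym2.lift ⟨fun i j => if i = j then (↑u⁻¹ : A) * M i j else M i j, fun i j => ?_⟩, ?_⟩
  · simp only [eq_comm (a := j), hM.apply i j]
  · ext i j
    simp only [polarMat, of_apply, Sym2.lift_mk, ← hu]
    split_ifs <;> simp

lemma polar_formOfCoeffs (c : Sym2 (Fin n) → A) (v w : Fin n → A) :
    QuadraticMap.polar (formOfCoeffs c) v w = v ⬝ᵥ (polarMat c *ᵥ w) := by
  have : QuadraticMap.polarBilin (formOfCoeffs c) = (polarMat c).toLinearMap₂' A := by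
    apply LinearMap.ext_basis (Pi.basisFun A (Fin n)) (Pi.basisFun A (Fin n))
    intro i j
    rw [QuadraticMap.polarBilin_apply_apply]
    rw [Pi.basisFun_apply, Pi.basisFun_apply, toLinearMap₂'_apply', mulVec_single_one,
      single_one_dotProduct]
    simp only [QuadraticMap.polar, formOfCoeffs, _root_.sum_apply, _root_.smul_apply,
      ← Finset.sum_sub_distrib, ← smul_sub]
    -- The polar form of the monomial `x_a x_b` vanishes at a pair of basis vectors `(e_i, e_j)`
    -- unless `{a, b} = {i, j}`.
    rw [Finset.sum_eq_single s(i, j)]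
    · by_cases h : i = j
      · subst h
        simp [polarMat]
        ring
      · simp [polarMat, h, Ne.symm h]
    · intro s _ hs
      induction s with | _ a b
      have h1 : ¬ (a = i ∧ b = j) := fun h => hs (by rw [h.1, h.2])
      have h2 : ¬ (a = j ∧ b = i) := fun h => hs (by rw [h.1, h.2, Sym2.eq_swap])
      simp only [Sym2.lift_mk, QuadraticMap.linMulLin_apply, LinearMap.proj_apply, Pi.add_apply,
        Pi.single_apply, smul_eq_mul]
      by_cases hai : a = i <;> by_cases haj : a = j <;> by_cases hbi : b = i <;>
        by_cases hbj : b = j <;> simp_all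
    · simp
  have h := congr($this v w)
  rw [QuadraticMap.polarBilin_apply_apply, toLinearMap₂'_apply'] at h
  exact h

lemma mem_rad_iff {V : Type*} [AddCommGroup V] [Module A V] (Q : QuadraticForm A V) (v : V) :
    v ∈ rad Q ↔ ∀ w, QuadraticMap.polar Q v w = 0 := by
  refine forall_congr' fun w => ?_
  rw [QuadraticMap.polar, sub_sub, sub_eq_zero]

lemma rad_formOfCoeffs (c : Sym2 (Fin n) → A) :
    rad (formOfCoeffs c) = LinearMap.ker (polarMat c).mulVecLin := by
  ext v
  rw [mem_rad_iff, LinearMap.mem_ker, mulVecLin_apply]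
  constructor
  · intro h
    apply dotProduct_eq_zero
    intro w
    rw [dotProduct_comm, dotProduct_mulVec, ← mulVec_transpose, polarMat_isSymm,dotProduct_comm, ← polar_formOfCoeffs]
    exact h w
  · intro h w
    rw [QuadraticMap.polar_comm, polar_formOfCoeffs, h, dotProduct_zero]

lemma formRank_formOfCoeffs {K : Type*} [Field K] (c : Sym2 (Fin n) → K) :
    formRank (formOfCoeffs c) = (polarMat c).rank := by
  rw [formRank, rad_formOfCoeffs, Matrix.rank, 
    ← LinearMap.finrank_range_add_finrank_ker (polarMat c).mulVecLin, Nat.add_sub_cancel]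

end PolarMatrix

/-! ### The rank of a matrix at a point of the spectrum -/

section RankAt

open Matrix

/-- The rank of a matrix over a ring at a point of the spectrum. -/
def rankAt {A ι : Type*} [CommRing A] [Fintype ι] (M : Matrix ι ι A) (q : PrimeSpectrum A) : ℕ :=
  (M.map (algebraMap A q.asIdeal.ResidueField)).rank

variable {A ι : Type*} [CommRing A] [Fintype ι]

/-- The residue field of `q` extends that of its image, and rank is insensitive to field extensions.
-/
lemma rankAt_map {B : Type*} [CommRing B] (f : A →+* B) (M : Matrix ι ι A)
    (q : PrimeSpectrum B) : rankAt (M.map f) q = rankAt M (PrimeSpectrum.comap f q) := by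
  rw [rankAt, rankAt, ← rank_map (Ideal.ResidueField.map (PrimeSpectrum.comap f q).asIdeal
    q.asIdeal f rfl), Matrix.map_map, Matrix.map_map]
  congr 2
  ext a
  exact (Ideal.ResidueField.map_algebraMap _ _ f rfl a).symm

omit [Fintype ι] in
lemma det_map_residueField_ne_zero {r : ℕ} {M : Matrix ι ι A} {q : PrimeSpectrum A}
    {J : Fin r → ι} : ((M.map (algebraMap A q.asIdeal.ResidueField)).submatrix J J).det ≠ 0 ↔
      (M.submatrix J J).det ∉ q.asIdeal := by
  change (((algebraMap A q.asIdeal.ResidueField).mapMatrix (M.submatrix J J)).det ≠ 0) ↔ _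
  rw [← RingHom.map_det, Ne, Ideal.algebraMap_residueField_eq_zero]

lemma le_rankAt_of_minor {r : ℕ} {M : Matrix ι ι A} {q : PrimeSpectrum A}
    {J : Fin r → ι} (h : (M.submatrix J J).det ∉ q.asIdeal) : r ≤ rankAt M q :=
  le_rank_of_minor _ J J (det_map_residueField_ne_zero.mpr h)

lemma exists_minor_of_rankAt {r : ℕ} {M : Matrix ι ι A} (hM : M.IsSymm) {q : PrimeSpectrum A}
    (h : rankAt M q = r) : ∃ J : Fin r → ι, (M.submatrix J J).det ∉ q.asIdeal := by
  obtain ⟨J, hJ⟩ := exists_principal_minor (M.map (algebraMap A q.asIdeal.ResidueField))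
    (by rw [IsSymm, ← transpose_map, hM]) h
  exact ⟨J, det_map_residueField_ne_zero.mp hJ⟩

end RankAt

/-! ### Points of `Quad_{n,r}` with values in algebras -/

section QuadPoints

open Matrix

variable {k : Type u} [Field k] {n r : ℕ}

/-- The polar matrix of the universal quadratic form. -/
abbrev genericMat (k : Type u) [Field k] (n : ℕ) : Matrix (Fin n) (Fin n) (QuadRing k n) :=
  polarMat MvPolynomial.X

lemma formRank_formAt (x : PrimeSpectrum (QuadRing k n)) :
    formRank (formAt x) = rankAt (genericMat k n) x := by
  rw [formAt, formRank_formOfCoeffs, polarMat_map, rankAt]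

lemma mem_rankLE {x : PrimeSpectrum (QuadRing k n)} :
    x ∈ rankLE k n r ↔ rankAt (genericMat k n) x ≤ r := by
  rw [← formRank_formAt]; rfl

lemma mem_rankLT {x : PrimeSpectrum (QuadRing k n)} :
    x ∈ rankLT k n r ↔ rankAt (genericMat k n) x < r := by
  rw [← formRank_formAt]; rfl

/-- Lower semicontinuity of the rank: a minor of size `r` that is nonzero at `x` stays nonzero on a
basic open set, which therefore misses the forms of smaller rank. -/
lemma notMem_closure_rankLT {x : PrimeSpectrum (QuadRing k n)}
    (h : rankAt (genericMat k n) x = r) : x ∉ closure (rankLT k n r) := by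
  obtain ⟨J, hJ⟩ := exists_minor_of_rankAt (polarMat_isSymm _) h
  rw [mem_closure_iff]
  push Not
  refine ⟨PrimeSpectrum.basicOpen ((genericMat k n).submatrix J J).det,
    (PrimeSpectrum.basicOpen _).isOpen, hJ, ?_⟩
  rw [Set.eq_empty_iff_forall_notMem]
  rintro y ⟨hy, hy'⟩
  exact absurd (le_rankAt_of_minor hy) (not_le.mpr (mem_rankLT.mp hy'))

variable {A : Type u} [CommRing A] [Algebra k A]

lemma genericMat_map_aeval (c : Sym2 (Fin n) → A) :
    (genericMat k n).map (MvPolynomial.aeval (R := k) c) = polarMat c := by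
  rw [← polarMat_map]; simp

lemma rankAt_polarMat (c : Sym2 (Fin n) → A) (q : PrimeSpectrum A) :
    rankAt (polarMat c) q = rankAt (genericMat k n)
      (PrimeSpectrum.comap (MvPolynomial.aeval (R := k) c).toRingHom q) := by
  rw [← rankAt_map, ← genericMat_map_aeval (k := k) c]
  rfl

/-- The conditions on a tuple of coefficients to define an `A`-valued point of `Quad_{n, r}`. -/
structure IsQuadPoint (k : Type u) [Field k] {A : Type u} [CommRing A] [Algebra k A] (n r : ℕ)
    (c : Sym2 (Fin n) → A) : Prop where
  aeval_eq_zero : ∀ p ∈ PrimeSpectrum.vanishingIdeal (rankLE k n r), MvPolynomial.aeval c p = 0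
  rankAt_eq : ∀ q, rankAt (polarMat c) q = r

/-- The coefficients of the quadratic form given by a point of `Quad_{n, r}`. -/
def coeffs (x : specOver k A ⟶ quad k n r) : Sym2 (Fin n) → A := fun s =>
  (Spec.preimage (R := .of (QuadRing k n)) (S := .of A) (x ≫ quadι k n r).left).hom
      (MvPolynomial.X s)

lemma formOfPoint_eq (x : specOver k A ⟶ quad k n r) : formOfPoint x = formOfCoeffs (coeffs x) :=
  rfl

/-- The point of the affine space of quadratic forms given by a homomorphism. -/
def toQuadAll (f : QuadRing k n →ₐ[k] A) : specOver k A ⟶ quadAll k n := specOverMap f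

lemma toQuadAll_injective :
    Function.Injective (toQuadAll : (QuadRing k n →ₐ[k] A) → (specOver k A ⟶ quadAll k n)) :=
  fun _ _ h => specOverMap_injective h

lemma comp_toQuadAll {B : Type u} [CommRing B] [Algebra k B] (g : A →ₐ[k] B)
    (f : QuadRing k n →ₐ[k] A) : specOverMap g ≫ toQuadAll f = toQuadAll (g.comp f) :=
  (specOverMap_comp f g).symm

/-- The point of `Quad_{n, ≤ r}` given by a homomorphism. -/
def toQuadLE (f : (QuadRing k n ⧸ PrimeSpectrum.vanishingIdeal (rankLE k n r)) →ₐ[k] A) :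
    specOver k A ⟶ quadLE k n r := specOverMap f

lemma toQuadLE_comp (f : (QuadRing k n ⧸ PrimeSpectrum.vanishingIdeal (rankLE k n r)) →ₐ[k] A) :
    toQuadLE f ≫ quadLEι k n r = toQuadAll (f.comp (Ideal.Quotient.mkₐ k _)) :=
  (specOverMap_comp _ _).symm

/-- The open immersion of `Quad_{n, r}` in `Quad_{n, ≤ r}`. -/
def quadOpenι (k : Type u) [Field k] (n r : ℕ) : quad k n r ⟶ quadLE k n r :=
  Over.homMk (quadOpen k n r).ι rfl

instance : IsOpenImmersion (quadOpenι k n r).left :=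
  inferInstanceAs (IsOpenImmersion (quadOpen k n r).ι)

lemma range_quadOpenι : Set.range (quadOpenι k n r).left = (quadOpen k n r : Set _) :=
  Scheme.Opens.range_ι _

lemma quadι_eq : quadι k n r = quadOpenι k n r ≫ quadLEι k n r := rfl

lemma comp_quadι (x : specOver k A ⟶ quad k n r) :
    x ≫ quadι k n r = toQuadAll (MvPolynomial.aeval (R := k) (coeffs x)) := by
  obtain ⟨φ, hφ⟩ := exists_specOverMap (k := k) (A := QuadRing k n) (x ≫ quadι k n r)
  refine hφ.trans (congrArg specOverMap ?_)
  ext s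
  rw [MvPolynomial.aeval_X, coeffs]
  have : (x ≫ quadι k n r).left = Spec.map (CommRingCat.ofHom φ.toRingHom) :=
    congrArg (fun f => Over.Hom.left f) hφ
  rw [this, Spec.preimage_map]
  rfl

lemma coeffs_eq_iff (x : specOver k A ⟶ quad k n r) (c : Sym2 (Fin n) → A) :
    coeffs x = c ↔ x ≫ quadι k n r = toQuadAll (MvPolynomial.aeval (R := k) c) := by
  rw [comp_quadι, toQuadAll_injective.eq_iff]
  constructor
  · rintro rfl; rfl
  · intro h
    ext s
    simpa using congr($h (MvPolynomial.X s))

lemma coeffs_comp {B : Type u} [CommRing B] [Algebra k B] (f : A →ₐ[k] B)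
    (x : specOver k A ⟶ quad k n r) : coeffs (specOverMap f ≫ x) = fun s => f (coeffs x s) := by
  rw [coeffs_eq_iff, Category.assoc, comp_quadι, comp_toQuadAll]
  congr 1
  ext s
  simp

instance mono_quadι : Mono (quadι k n r).left := by
  have h1 : IsClosedImmersion (quadLEι k n r).left := by
    change IsClosedImmersion (Spec.map _)
    exact IsClosedImmersion.spec_of_surjective _ Ideal.Quotient.mk_surjective
  change Mono ((quadOpenι k n r).left ≫ (quadLEι k n r).left)
  infer_instance

lemma coeffs_injective : Function.Injective (coeffs (k := k) (A := A) (n := n) (r := r)) := by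
  intro x y h
  have h2 : x ≫ quadι k n r = y ≫ quadι k n r := by rw [comp_quadι, comp_quadι, h]
  ext1
  rw [← cancel_mono (quadι k n r).left]
  exact congr(($h2).left)

lemma minor_polarMat {ι : Type*} [Fintype ι] [DecidableEq ι] (c : Sym2 (Fin n) → A)
    (J : ι → Fin n) : ((polarMat c).submatrix J J).det =
      MvPolynomial.aeval (R := k) c ((genericMat k n).submatrix J J).det := by
  rw [AlgHom.map_det, ← genericMat_map_aeval (k := k)]
  rfl

/-- Principal minors of size larger than `r` vanish on `Quad_{n, ≤ r}`. -/
lemma minor_mem_vanishingIdeal {s : ℕ} (hs : r < s) (J : Fin s → Fin n) :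
    ((genericMat k n).submatrix J J).det ∈ PrimeSpectrum.vanishingIdeal (rankLE k n r) := by
  rw [PrimeSpectrum.mem_vanishingIdeal]
  intro x hx
  by_contra h
  exact absurd ((le_rankAt_of_minor h).trans (mem_rankLE.mp hx)) (not_le.mpr hs)

lemma map_submatrix_mul_adjugate_mul {R S ι κ F : Type*} [CommRing R] [CommRing S] [Fintype κ]
    [DecidableEq κ] [FunLike F R S] [RingHomClass F R S] (f : F) (N : Matrix ι ι R) (J : κ → ι)
    (i j : ι) :
    f ((N.submatrix id J * (N.submatrix J J).adjugate * N.submatrix J id) i j) =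
      ((N.map f).submatrix id J * ((N.map f).submatrix J J).adjugate *
        (N.map f).submatrix J id) i j := by
  have : ((N.map f).submatrix J J).adjugate = (N.submatrix J J).adjugate.map f :=
    (RingHom.map_adjugate (f : R →+* S) _).symm
  rw [this]
  simp only [submatrix_map, ← Matrix.map_mul]
  rfl

/-- On `Quad_{n, ≤ r}` a symmetric matrix is determined by its rows through a principal block
of size `r`, where the determinant of the block does not vanish. -/
lemma schur_mem_vanishingIdeal (J : Fin r → Fin n) (i j : Fin n) :
    ((genericMat k n).submatrix J J).det * (((genericMat k n).submatrix J J).det *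
      genericMat k n i j - ((genericMat k n).submatrix id J *
        ((genericMat k n).submatrix J J).adjugate * (genericMat k n).submatrix J id) i j) ∈
      PrimeSpectrum.vanishingIdeal (rankLE k n r) := by
  rw [PrimeSpectrum.mem_vanishingIdeal]
  intro x hx
  -- The outer factor covers the points where the block is singular. Elsewhere the claim is the
  -- factorization of `eq_of_rank_le_of_minor`, cleared of its denominator.
  by_cases hd : ((genericMat k n).submatrix J J).det ∈ x.asIdeal
  · exact Ideal.mul_mem_right _ _ hd
  · apply Ideal.mul_mem_left
    rw [← Ideal.algebraMap_residueField_eq_zero]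
    set f := algebraMap (QuadRing k n) x.asIdeal.ResidueField
    set M := (genericMat k n).map f with hMdef
    have hJ : (M.submatrix J J).det ≠ 0 := det_map_residueField_ne_zero.mpr hd
    have h1 := eq_of_rank_le_of_minor M J J hJ (mem_rankLE.mp hx)
    have h2 : f ((genericMat k n).submatrix J J).det = (M.submatrix J J).det := by
      rw [RingHom.map_det]; rfl
    have h3 : f (((genericMat k n).submatrix id J *
        ((genericMat k n).submatrix J J).adjugate * (genericMat k n).submatrix J id) i j) =
        (M.submatrix id J * (M.submatrix J J).adjugate * M.submatrix J id) i j :=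
      map_submatrix_mul_adjugate_mul f _ J i j
    have h4 : f (genericMat k n i j) = M i j := rfl
    rw [map_sub, map_mul, h2, h3, h4]
    conv_lhs => enter [1, 2]; rw [h1]
    rw [inv_def, Matrix.mul_smul, Matrix.smul_mul, Matrix.smul_apply, smul_eq_mul,
      Ring.inverse_eq_inv', mul_inv_cancel_left₀ hJ, sub_self]

/-- The matrix of a form of constant rank is von Neumann regular. -/
lemma IsQuadPoint.exists_regular {c : Sym2 (Fin n) → A} (hc : IsQuadPoint k n r c) :
    ∃ X : Matrix (Fin n) (Fin n) A, polarMat c * X * polarMat c = polarMat c := by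
  set M := polarMat c
  let d (J : Fin r → Fin n) : A := (M.submatrix J J).det
  -- A quasi-inverse up to the factor `d J ^ 2`: the adjugate of the block `J`, placed back in the
  -- rows and columns `J`. The identity is the relation of `schur_mem_vanishingIdeal`.
  have h1 : ∀ J, (d J) ^ 2 • M = M * (d J • ((1 : Matrix (Fin n) (Fin n) A).submatrix id J *
      (M.submatrix J J).adjugate * (1 : Matrix (Fin n) (Fin n) A).submatrix J id)) * M := by
    intro J
    have e1 : M * (1 : Matrix (Fin n) (Fin n) A).submatrix id J = M.submatrix id J := by
      ext; simp [mul_apply, one_apply]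
    have e2 : (1 : Matrix (Fin n) (Fin n) A).submatrix J id * M = M.submatrix J id := by
      ext; simp [mul_apply, one_apply]
    rw [Matrix.mul_smul, Matrix.smul_mul, ← Matrix.mul_assoc, ← Matrix.mul_assoc, e1,
      Matrix.mul_assoc _ _ M, e2]
    ext i j
    have := hc.aeval_eq_zero _ (schur_mem_vanishingIdeal J i j)
    have e3 : MvPolynomial.aeval (R := k) c (genericMat k n i j) = M i j :=
      congrFun (congrFun (genericMat_map_aeval (k := k) c) i) j
    rw [map_mul, map_sub, map_mul, ← minor_polarMat, e3, map_submatrix_mul_adjugate_mul,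
      genericMat_map_aeval] at this
    simp only [Matrix.smul_apply, smul_eq_mul]
    linear_combination this
  -- The rank is `r` at every prime, so no maximal ideal contains all principal minors of size `r`,
  -- nor all their squares.
  have h2 : Ideal.span (Set.range fun J => d J ^ 2) = ⊤ := by
    by_contra h
    obtain ⟨q, hq, hle⟩ := Ideal.exists_le_maximal _ h
    obtain ⟨J, hJ⟩ := exists_minor_of_rankAt (polarMat_isSymm c) (hc.rankAt_eq ⟨q, hq.isPrime⟩)
    exact hJ (hq.isPrime.mem_of_pow_mem 2 (hle (Ideal.subset_span ⟨J, rfl⟩)))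
  obtain ⟨a, ha⟩ := (Ideal.mem_span_range_iff_exists_fun).mp (h2 ▸ Submodule.mem_top (x := (1 : A)))
  -- The equation `M X M = M` is affine in `X`, so the local solutions combine by means of `∑ a J *
  -- d J ^ 2 = 1`.
  refine ⟨∑ J, a J • (d J • ((1 : Matrix (Fin n) (Fin n) A).submatrix id J *
      (M.submatrix J J).adjugate * (1 : Matrix (Fin n) (Fin n) A).submatrix J id)), ?_⟩
  rw [Matrix.mul_sum, Matrix.sum_mul]
  have h3 : ∀ J, M * (a J • (d J • ((1 : Matrix (Fin n) (Fin n) A).submatrix id J *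
      (M.submatrix J J).adjugate * (1 : Matrix (Fin n) (Fin n) A).submatrix J id))) * M =
      (a J * d J ^ 2) • M := by
    intro J
    rw [Matrix.mul_smul, Matrix.smul_mul, ← h1, smul_smul]
  rw [Finset.sum_congr rfl fun J _ => h3 J, ← Finset.sum_smul, ha, one_smul]

/-- `quadOpen` removes the closure of the locus of smaller rank. For a point of `Quad_{n, ≤ r}`,
avoiding that closure means rank exactly `r`: larger minors vanish by the equations, a smaller rank
lies in the closure, and rank `r` avoids it by semicontinuity. -/
lemma comap_mem_compl_iff {c : Sym2 (Fin n) → A}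
    (φ : (QuadRing k n ⧸ PrimeSpectrum.vanishingIdeal (rankLE k n r)) →ₐ[k] A)
    (hφ : φ.comp (Ideal.Quotient.mkₐ k _) = MvPolynomial.aeval c) (q : PrimeSpectrum A) :
    (toQuadLE φ).left q ∈ quadOpen k n r ↔ rankAt (polarMat c) q = r := by
  have h1 : (toQuadLE φ).left q ∈ quadOpen k n r ↔
      PrimeSpectrum.comap (MvPolynomial.aeval (R := k) c).toRingHom q ∉
        closure (rankLT k n r) := by
    rw [← hφ]; rfl
  rw [h1, rankAt_polarMat (k := k)]
  refine ⟨fun h => le_antisymm ?_ ?_, notMem_closure_rankLT⟩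
  · by_contra! hlt
    rw [← rankAt_polarMat] at hlt
    obtain ⟨J, hJ⟩ := exists_minor_of_rankAt (polarMat_isSymm c) (rfl : rankAt (polarMat c) q = _)
    apply hJ
    rw [minor_polarMat (k := k), ← hφ, AlgHom.comp_apply, Ideal.Quotient.mkₐ_eq_mk,
      Ideal.Quotient.eq_zero_iff_mem.mpr (minor_mem_vanishingIdeal hlt J), map_zero]
    exact zero_mem _
  · rw [← not_lt, ← mem_rankLT]
    exact fun h' => h (subset_closure h')

/-- With `exists_point` and `coeffs_injective`, this identifies the `A`-points of `Quad_{n,r}` with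
the tuples that satisfy `IsQuadPoint`. -/
lemma isQuadPoint_coeffs (x : specOver k A ⟶ quad k n r) : IsQuadPoint k n r (coeffs x) := by
  obtain ⟨φ, hφ⟩ := exists_specOverMap (k := k)
    (A := QuadRing k n ⧸ PrimeSpectrum.vanishingIdeal (rankLE k n r)) (x ≫ quadOpenι k n r)
  replace hφ : x ≫ quadOpenι k n r = toQuadLE φ := hφ
  have h2 : MvPolynomial.aeval (R := k) (coeffs x) = φ.comp (Ideal.Quotient.mkₐ k _) := by
    apply toQuadAll_injective
    rw [← comp_quadι, ← toQuadLE_comp, ← hφ, Category.assoc, quadι_eq]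
  refine ⟨fun p hp => ?_, fun q => ?_⟩
  · rw [h2, AlgHom.comp_apply, Ideal.Quotient.mkₐ_eq_mk, Ideal.Quotient.eq_zero_iff_mem.mpr hp,
      map_zero]
  · rw [← comap_mem_compl_iff φ h2.symm, ← hφ]
    have h3 : (x ≫ quadOpenι k n r).left q ∈ Set.range (quadOpenι k n r).left := ⟨x.left q, rfl⟩
    rwa [range_quadOpenι] at h3

lemma exists_point {c : Sym2 (Fin n) → A} (hc : IsQuadPoint k n r c) :
    ∃ x : specOver k A ⟶ quad k n r, coeffs x = c := by
  let φ : (QuadRing k n ⧸ PrimeSpectrum.vanishingIdeal (rankLE k n r)) →ₐ[k] A :=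
    Ideal.Quotient.liftₐ _ (MvPolynomial.aeval c) hc.aeval_eq_zero
  have h1 : φ.comp (Ideal.Quotient.mkₐ k _) = MvPolynomial.aeval c := by
    exact Ideal.Quotient.liftₐ_comp _ _ _
  have h2 : Set.range (toQuadLE φ).left ⊆ Set.range (quadOpenι k n r).left := by
    rw [range_quadOpenι]
    rintro _ ⟨q, rfl⟩
    exact (comap_mem_compl_iff φ h1 q).mpr (hc.rankAt_eq q)
  let x : specOver k A ⟶ quad k n r :=
    Over.homMk (IsOpenImmersion.lift (quadOpenι k n r).left (toQuadLE φ).left h2) (by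
      rw [← Over.w (quadOpenι k n r), IsOpenImmersion.lift_fac_assoc]
      exact Over.w (toQuadLE φ))
  refine ⟨x, (coeffs_eq_iff _ _).mpr ?_⟩
  have : x ≫ quadOpenι k n r = toQuadLE φ := by
    ext1
    exact IsOpenImmersion.lift_fac _ _ _
  rw [quadι_eq, ← Category.assoc, this, toQuadLE_comp, h1]

end QuadPoints

/-! ### Submodules of `A ^ n` with locally free quotient, as kernels of idempotent matrices -/

section Grass

open Matrix

variable {A B : Type*} [CommRing A] [CommRing B] {n r : ℕ}

/-- A submodule of `A ^ n` with locally free quotient of rank `r`. -/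
structure IsGrass (N : Submodule A (Fin n → A)) (r : ℕ) : Prop where
  finite : Module.Finite A ((Fin n → A) ⧸ N)
  projective : Module.Projective A ((Fin n → A) ⧸ N)
  rankAtStalk_eq : ∀ p, Module.rankAtStalk (R := A) ((Fin n → A) ⧸ N) p = r

lemma isGrass_ker {W : Type*} [AddCommGroup W] [Module A W] [Module.Finite A W]
    [Module.Projective A W] (π : (Fin n → A) →ₗ[A] W) (hπ : Function.Surjective π)
    (hr : ∀ p, Module.rankAtStalk (R := A) W p = r) : IsGrass (LinearMap.ker π) r := by
  have e := π.quotKerEquivOfSurjective hπ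
  exact ⟨Module.Finite.equiv e.symm, Module.Projective.of_equiv e.symm, fun p => by
    rw [Module.rankAtStalk_eq_of_equiv e, hr]⟩

/-- The rank of a projective module at a point, in terms of an idempotent matrix whose image
is the module. -/
lemma rankAtStalk_range_idempotent (E : Matrix (Fin n) (Fin n) A) (hE : E * E = E)
    (q : PrimeSpectrum A) :
    Module.Projective A (LinearMap.range E.mulVecLin) ∧
    Module.rankAtStalk (R := A) (LinearMap.range E.mulVecLin) q = rankAt E q := by
  set W := LinearMap.range E.mulVecLin
  have hEE : E.mulVecLin ∘ₗ W.subtype = W.subtype := by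
    ext ⟨_, w, rfl⟩ : 1
    simp [hE]
  have hρ : E.mulVecLin.rangeRestrict ∘ₗ W.subtype = LinearMap.id := by
    ext ⟨_, w, rfl⟩ : 1
    apply Subtype.ext
    simp [hE]
  have hproj : Module.Projective A W := Module.Projective.of_split _ _ hρ
  refine ⟨hproj, ?_⟩
  rw [Module.rankAtStalk_eq]
  set K := q.asIdeal.ResidueField
  -- The inclusion of the range splits, so it stays injective over the residue field, and the fibre
  -- of the module is the range of the base-changed matrix.
  have h1 : Function.Injective (W.subtype.baseChange K) := by
    apply Function.LeftInverse.injective (g := E.mulVecLin.rangeRestrict.baseChange K)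
    intro x
    rw [← LinearMap.comp_apply, ← LinearMap.baseChange_comp, hρ, LinearMap.baseChange_id,
      LinearMap.id_apply]
  have h2 : LinearMap.range (W.subtype.baseChange K) =
      LinearMap.range (E.mulVecLin.baseChange K) := by
    have : E.mulVecLin = W.subtype ∘ₗ E.mulVecLin.rangeRestrict := rfl
    rw [this, LinearMap.baseChange_comp, LinearMap.range_comp_of_range_eq_top]
    rw [LinearMap.range_eq_top]
    exact LinearMap.baseChange_surjective _ E.mulVecLin.surjective_rangeRestrict
  change Module.finrank K (K ⊗[A] W) = _
  rw [← LinearMap.finrank_range_of_inj h1, h2, rankAt, Matrix.rank_eq_finrank_range_toLin _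
    (Algebra.TensorProduct.basis K (Pi.basisFun A (Fin n))) (Algebra.TensorProduct.basis K (Pi.basisFun A (Fin n)))]
  have h3 : E.map (algebraMap A K) = LinearMap.toMatrix (Algebra.TensorProduct.basis K (Pi.basisFun A (Fin n)))
      (Algebra.TensorProduct.basis K (Pi.basisFun A (Fin n))) (E.mulVecLin.baseChange K) := by
    have := LinearMap.toMatrix_baseChange K E.mulVecLin (Pi.basisFun A (Fin n)) (Pi.basisFun A (Fin n))
    rw [← Matrix.toLin'_apply', LinearMap.toMatrix_eq_toMatrix', LinearMap.toMatrix'_toLin'] at this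
    exact this.symm
  rw [h3, Matrix.toLin_toMatrix]

lemma isGrass_ker_of_idempotent {E : Matrix (Fin n) (Fin n) A} (hE : E * E = E)
    (hr : ∀ q, rankAt E q = r) : IsGrass (LinearMap.ker E.mulVecLin) r := by
  have h1 : Module.Projective A (LinearMap.range E.mulVecLin) := by
    have hρ : E.mulVecLin.rangeRestrict ∘ₗ (LinearMap.range E.mulVecLin).subtype =
        LinearMap.id := by
      ext ⟨_, w, rfl⟩ : 1
      apply Subtype.ext
      simp [hE]
    exact Module.Projective.of_split _ _ hρ
  have := isGrass_ker E.mulVecLin.rangeRestrict E.mulVecLin.surjective_rangeRestrict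
    fun q => ((rankAtStalk_range_idempotent E hE q).2.trans (hr q))
  rwa [LinearMap.ker_rangeRestrict] at this

/-- Projectivity gives a section of the quotient map, and the quotient map followed by the section
is a projector with kernel `N`. With such a matrix, base change and localization of `N` become
explicit. -/
lemma IsGrass.exists_idempotent {N : Submodule A (Fin n → A)} (hN : IsGrass N r) :
    ∃ E : Matrix (Fin n) (Fin n) A, E * E = E ∧ LinearMap.ker E.mulVecLin = N ∧
      ∀ q, rankAt E q = r := by
  have := hN.projective
  obtain ⟨s, hs⟩ := Module.projective_lifting_property N.mkQ LinearMap.id N.mkQ_surjective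
  let e : (Fin n → A) →ₗ[A] (Fin n → A) := s ∘ₗ N.mkQ
  have hs' : ∀ w, N.mkQ (s w) = w := fun w => congr($hs w)
  have hee : e ∘ₗ e = e := by
    apply LinearMap.ext
    intro x
    simp only [LinearMap.comp_apply, e, hs']
  have hE : LinearMap.toMatrix' e * LinearMap.toMatrix' e = LinearMap.toMatrix' e := by
    rw [← LinearMap.toMatrix'_comp, hee]
  have hker : LinearMap.ker e = N := by
    rw [LinearMap.ker_comp_of_ker_eq_bot, N.ker_mkQ]
    exact LinearMap.ker_eq_bot.mpr (Function.LeftInverse.injective hs')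
  have hlin : (LinearMap.toMatrix' e).mulVecLin = e := by
    rw [← toLin'_apply', toLin'_toMatrix']
  refine ⟨LinearMap.toMatrix' e, hE, by rw [hlin, hker], fun q => ?_⟩
  rw [← (rankAtStalk_range_idempotent _ hE q).2, ← hN.rankAtStalk_eq q, hlin]
  have e1 := e.quotKerEquivRange
  rw [hker] at e1
  rw [Module.rankAtStalk_eq_of_equiv e1]

/-- The base change of a submodule of `A ^ n`, as the submodule spanned by its image. -/
def baseChangeSub (f : A →+* B) (N : Submodule A (Fin n → A)) : Submodule B (Fin n → B) :=
  Submodule.span B ((fun v => f ∘ v) '' N)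

lemma map_mulVec {ι κ : Type*} [Fintype κ] (f : A →+* B) (M : Matrix ι κ A) (v : κ → A) :
    M.map f *ᵥ (f ∘ v) = f ∘ (M *ᵥ v) := by
  ext i
  simp [mulVec, dotProduct]

lemma baseChangeSub_ker_le {m : Type*} (f : A →+* B) (M : Matrix m (Fin n) A) :
    baseChangeSub f (LinearMap.ker M.mulVecLin) ≤ LinearMap.ker (M.map f).mulVecLin := by
  rw [baseChangeSub, Submodule.span_le]
  rintro _ ⟨v, hv, rfl⟩
  have hv' : M *ᵥ v = 0 := hv
  change M.map f *ᵥ (f ∘ v) = 0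
  rw [map_mulVec, hv']
  ext; simp

/-- The kernel of a regular matrix commutes with base change. -/
lemma baseChangeSub_ker {m : Type*} [Fintype m] (f : A →+* B) {M : Matrix m (Fin n) A}
    {X : Matrix (Fin n) m A} (hX : M * X * M = M) :
    baseChangeSub f (LinearMap.ker M.mulVecLin) = LinearMap.ker (M.map f).mulVecLin := by
  apply le_antisymm (baseChangeSub_ker_le f M)
  intro v hv
  replace hv : M.map f *ᵥ v = 0 := hv
  -- A vector killed by `M` equals `(1 - X M) v`, and the columns of `1 - X M` already lie in `ker
  -- M` over `A`.
  have h1 : v = ((1 : Matrix (Fin n) (Fin n) A) - X * M).map f *ᵥ v := by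
    have : ((1 : Matrix (Fin n) (Fin n) A) - X * M).map f = 1 - X.map f * M.map f := by
      rw [Matrix.map_sub _ (map_sub f), Matrix.map_mul, Matrix.map_one _ (map_zero f) (map_one f)]
    rw [this, sub_mulVec, one_mulVec, ← mulVec_mulVec, hv, mulVec_zero, sub_zero]
  rw [h1, mulVec_eq_sum]
  refine Submodule.sum_mem _ fun i _ => ?_
  rw [op_smul_eq_smul]
  refine Submodule.smul_mem _ _ (Submodule.subset_span ⟨(1 - X * M).col i, ?_, rfl⟩)
  change M *ᵥ _ = 0
  rw [← mulVec_single_one, mulVec_mulVec, Matrix.mul_sub, ← Matrix.mul_assoc, hX, Matrix.mul_one,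
    sub_self, zero_mulVec]

lemma mul_self_mul_self {E : Matrix (Fin n) (Fin n) A} (hE : E * E = E) :
    E * 1 * E = E := by rw [Matrix.mul_one, hE]

lemma IsGrass.baseChangeSub {N : Submodule A (Fin n → A)} (hN : IsGrass N r) (f : A →+* B) :
    IsGrass (baseChangeSub f N) r := by
  obtain ⟨E, hE, rfl, hr⟩ := hN.exists_idempotent
  rw [baseChangeSub_ker f (mul_self_mul_self hE)]
  refine isGrass_ker_of_idempotent ?_ fun q => by rw [rankAt_map, hr]
  rw [← Matrix.map_mul, hE]

omit [CommRing B] in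
-- The coordinates in `I` map the range of `E` onto `A ^ r`, preimages being supplied by the block
-- `I, J`. Both modules are projective of rank `r`, so the surjection is bijective, and `E v`
-- vanishes as soon as its coordinates in `I` do.
lemma ker_submatrix_eq {E : Matrix (Fin n) (Fin n) A} (hE : E * E = E)
    (hr : ∀ q, rankAt E q = r) {I J : Fin r → Fin n} (hIJ : IsUnit (E.submatrix I J).det) :
    LinearMap.ker (E.submatrix I id).mulVecLin = LinearMap.ker E.mulVecLin := by
  let W := LinearMap.range E.mulVecLin
  have hW : Module.Projective A W := by
    by_cases h : Nonempty (PrimeSpectrum A)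
    · exact (rankAtStalk_range_idempotent E hE h.some).1
    · have : Subsingleton A := by
        by_contra hA
        have := not_subsingleton_iff_nontrivial.mp hA
        exact h inferInstance
      have := Module.subsingleton A W
      infer_instance
  let φ : W →ₗ[A] (Fin r → A) := LinearMap.funLeft A A I ∘ₗ W.subtype
  have hφ : Function.Surjective φ := by
    intro y
    let z := (E.submatrix I J)⁻¹ *ᵥ y
    refine ⟨⟨E *ᵥ ((1 : Matrix (Fin n) (Fin n) A).submatrix id J *ᵥ z), ⟨_, rfl⟩⟩, ?_⟩
    have h1 : E * (1 : Matrix (Fin n) (Fin n) A).submatrix id J = E.submatrix id J := by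
      ext; simp [mul_apply, one_apply]
    change (E *ᵥ ((1 : Matrix (Fin n) (Fin n) A).submatrix id J *ᵥ z)) ∘ I = y
    rw [mulVec_mulVec, h1]
    change E.submatrix I J *ᵥ z = y
    rw [mulVec_mulVec, mul_nonsing_inv _ hIJ, one_mulVec]
  have hbij := Module.bijective_of_surjective_of_rankAtStalk_eq hφ fun m hm => by
    have := hm.ne_top
    have : Nontrivial A := ⟨0, 1, fun h => this (by rw [Ideal.eq_top_iff_one, ← h]; exact m.zero_mem)⟩
    rw [(rankAtStalk_range_idempotent E hE _).2, hr, Module.rankAtStalk_eq_finrank_of_free]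
    simp
  ext v
  constructor
  · intro hv
    have h2 : φ (E.mulVecLin.rangeRestrict v) = 0 := hv
    have h3 := hbij.1 (h2.trans (map_zero φ).symm)
    exact congrArg Subtype.val h3
  · intro hv
    have hv' : E *ᵥ v = 0 := hv
    ext i
    exact congrFun hv' (I i)

/-- Zariski locally, a submodule with locally free quotient is the kernel of a matrix that has
an identity block. -/
lemma IsGrass.exists_chart {A : Type*} [CommRing A] {N : Submodule A (Fin n → A)}
    (hN : IsGrass N r) (q : PrimeSpectrum A) :
    ∃ f ∉ q.asIdeal, ∃ (J : Fin r → Fin n) (Φ : Matrix (Fin r) (Fin n) (Localization.Away f)),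
      Φ.submatrix id J = 1 ∧
        QuadMotive.baseChangeSub (algebraMap A (Localization.Away f)) N =
          LinearMap.ker Φ.mulVecLin := by
  obtain ⟨E, hE, rfl, hr⟩ := hN.exists_idempotent
  obtain ⟨I, J, hIJ⟩ := exists_minor _ (hr q)
  have hf : (E.submatrix I J).det ∉ q.asIdeal := by
    rw [← Ideal.algebraMap_residueField_eq_zero, RingHom.map_det]
    exact hIJ
  refine ⟨_, hf, J, ?_⟩
  set f := (E.submatrix I J).det
  set g := algebraMap A (Localization.Away f)
  have hu : IsUnit ((E.map g).submatrix I J).det := by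
    have : ((E.map g).submatrix I J).det = g f := (RingHom.map_det g _).symm
    rw [this]
    exact IsLocalization.Away.algebraMap_isUnit f
  -- Once a minor of size `r` is inverted, the rows in `I` suffice to cut out the kernel, and the
  -- inverse of the block turns the columns in `J` into the identity.
  refine ⟨((E.map g).submatrix I J)⁻¹ * (E.map g).submatrix I id, ?_, ?_⟩
  · rw [submatrix_mul _ _ _ id _ Function.bijective_id, submatrix_id_id, submatrix_submatrix]
    exact nonsing_inv_mul _ hu
  · have hEg : E.map g * E.map g = E.map g := by rw [← Matrix.map_mul, hE]
    rw [baseChangeSub_ker g (mul_self_mul_self hE),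
      ← ker_submatrix_eq hEg (fun q => by rw [rankAt_map, hr]) hu]
    ext v
    simp only [LinearMap.mem_ker, mulVecLin_apply, ← mulVec_mulVec]
    constructor
    · intro h
      rw [h, mulVec_zero]
    · intro h
      have := congrArg ((E.map g).submatrix I J *ᵥ ·) h
      simpa [mulVec_mulVec, mul_nonsing_inv_cancel_left _ _ hu] using this

lemma isGrass_ker_of_section {Φ : Matrix (Fin r) (Fin n) A} {X : Matrix (Fin n) (Fin r) A}
    (h : Φ * X = 1) : IsGrass (LinearMap.ker Φ.mulVecLin) r := by
  refine isGrass_ker _ (fun y => ⟨X *ᵥ y, by simp [h]⟩) fun p => ?_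
  have : Nontrivial A := p.nontrivial
  simp

/-- A matrix with a section is determined by its kernel and the section. -/
lemma eq_of_ker_le {m : Type*} [Fintype m] {Φ : Matrix (Fin r) (Fin n) A} {X : Matrix (Fin n) (Fin r) A}
    (h : Φ * X = 1) (Ψ : Matrix m (Fin n) A)
    (hker : LinearMap.ker Φ.mulVecLin ≤ LinearMap.ker Ψ.mulVecLin) : Ψ = Ψ * X * Φ := by
  apply Matrix.ext_of_mulVec_single
  intro i
  have h1 : Pi.single i 1 - (X * Φ) *ᵥ Pi.single i 1 ∈ LinearMap.ker Ψ.mulVecLin := by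
    apply hker
    change Φ *ᵥ _ = 0
    rw [mulVec_sub, mulVec_mulVec, ← Matrix.mul_assoc, h, Matrix.one_mul, sub_self]
  have h2 : Ψ *ᵥ _ = 0 := h1
  rw [mulVec_sub, sub_eq_zero, mulVec_mulVec, ← Matrix.mul_assoc] at h2
  exact h2

lemma mul_submatrix_one {ι κ m : Type*} [Fintype κ] [DecidableEq κ] (Φ : Matrix m κ A)
    (J : ι → κ) : Φ * (1 : Matrix κ κ A).submatrix id J = Φ.submatrix id J := by
  ext; simp [mul_apply, one_apply]

end Grass

/-! ### Radicals of forms of constant rank, and pull-backs of nondegenerate forms -/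

section QuadGrass

open Matrix

variable {k : Type u} [Field k] {n r : ℕ} {A : Type u} [CommRing A] [Algebra k A]

/-- For a quasi-inverse `X` of `M`, the matrix `X M` is idempotent and has the same kernel and the
same rank at every point as `M`. -/
lemma IsQuadPoint.exists_idempotent {c : Sym2 (Fin n) → A} (hc : IsQuadPoint k n r c) :
    ∃ X, polarMat c * X * polarMat c = polarMat c ∧
      IsGrass (LinearMap.ker (polarMat c).mulVecLin) r := by
  obtain ⟨X, hX⟩ := hc.exists_regular
  refine ⟨X, hX, ?_⟩
  have hE : X * polarMat c * (X * polarMat c) = X * polarMat c := by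
    rw [Matrix.mul_assoc, ← Matrix.mul_assoc (polarMat c), hX]
  have hker : LinearMap.ker (polarMat c).mulVecLin = LinearMap.ker (X * polarMat c).mulVecLin := by
    ext v
    simp only [LinearMap.mem_ker, mulVecLin_apply]
    constructor
    · intro h; rw [← mulVec_mulVec, h, mulVec_zero]
    · intro h
      rw [← hX, Matrix.mul_assoc, ← mulVec_mulVec, h, mulVec_zero]
  rw [hker]
  refine isGrass_ker_of_idempotent hE fun q => ?_
  rw [← hc.rankAt_eq q, rankAt, rankAt]
  apply le_antisymm
  · rw [Matrix.map_mul]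
    exact rank_mul_le_right _ _
  · conv_lhs => rw [← hX, Matrix.mul_assoc, Matrix.map_mul]
    exact rank_mul_le_right _ _

lemma isGrass_rad (x : specOver k A ⟶ quad k n r) : IsGrass (rad (formOfPoint x)) r := by
  rw [formOfPoint_eq, rad_formOfCoeffs]
  exact (isQuadPoint_coeffs x).exists_idempotent.choose_spec.2

/-- Kernels commute with arbitrary base change here because the polar matrix has a quasi-inverse. -/
lemma rad_comp {B : Type u} [CommRing B] [Algebra k B] (f : A →ₐ[k] B)
    (x : specOver k A ⟶ quad k n r) :
    rad (formOfPoint (specOverMap f ≫ x)) = baseChangeSub f.toRingHom (rad (formOfPoint x)) := by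
  rw [formOfPoint_eq, formOfPoint_eq, rad_formOfCoeffs, rad_formOfCoeffs, coeffs_comp,
    polarMat_map, baseChangeSub_ker _ (isQuadPoint_coeffs x).exists_idempotent.choose_spec.1]
  rfl

lemma det_ne_zero_of_le_rank {K : Type*} [Field K] {M : Matrix (Fin r) (Fin r) K}
    (h : r ≤ M.rank) : M.det ≠ 0 := by
  rw [← isUnit_iff_ne_zero, ← isUnit_iff_isUnit_det, ← linearIndependent_rows_iff_isUnit,
    linearIndependent_iff_card_eq_finrank_span, Set.finrank,
    ← rank_eq_finrank_span_row, Fintype.card_fin]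
  exact le_antisymm h (rank_le_height M)

lemma det_isUnit_of_rankAt {A : Type*} [CommRing A] {M : Matrix (Fin r) (Fin r) A}
    (h : ∀ q, r ≤ rankAt M q) : IsUnit M.det := by
  by_contra hM
  obtain ⟨q, hq, hle⟩ := exists_max_ideal_of_mem_nonunits hM
  have := hq.isPrime
  have h1 := det_ne_zero_of_le_rank (h ⟨q, hq.isPrime⟩)
  have h2 := (RingHom.map_det (algebraMap A q.ResidueField) M)
  rw [Ideal.algebraMap_residueField_eq_zero.mpr hle] at h2
  exact h1 h2.symm

lemma isUnit_two (A : Type*) [CommRing A] [Algebra k A] (h2 : (2 : k) ≠ 0) : IsUnit (2 : A) := by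
  have := (isUnit_iff_ne_zero.mpr h2).map (algebraMap k A)
  rwa [map_ofNat] at this

/-- The pull-back of a form in `r` variables by a matrix vanishes on the equations of the locus of
forms of rank at most `r`. -/
lemma aeval_eq_zero_of_conj (h2 : (2 : k) ≠ 0) {c : Sym2 (Fin n) → A} {d : Sym2 (Fin r) → A}
    {Φ : Matrix (Fin r) (Fin n) A} (hc : polarMat c = Φᵀ * polarMat d * Φ) {p : QuadRing k n}
    (hp : p ∈ PrimeSpectrum.vanishingIdeal (rankLE k n r)) : MvPolynomial.aeval c p = 0 := by
  -- The universal case: the entries of `Φ` and the coefficients of `d` become indeterminates. `P`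
  -- is a domain, so vanishing can be tested at its generic point `⊥`, where the rank is at most `r`
  -- because the matrix factors through dimension `r`. The given data are a specialization `ψ`.
  let P := MvPolynomial ((Fin r × Fin n) ⊕ Sym2 (Fin r)) k
  let d' : Sym2 (Fin r) → P := fun s => MvPolynomial.X (.inr s)
  let Φ' : Matrix (Fin r) (Fin n) P := .of fun i j => MvPolynomial.X (.inl (i, j))
  obtain ⟨c', hc'⟩ := exists_polarMat_eq (isUnit_two P h2) (M := Φ'ᵀ * polarMat d' * Φ') (by
    rw [IsSymm, transpose_mul, transpose_mul, transpose_transpose, polarMat_isSymm,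
      Matrix.mul_assoc])
  have h0 : MvPolynomial.aeval c' p = 0 := by
    let q : PrimeSpectrum P := ⊥
    have hq : PrimeSpectrum.comap (MvPolynomial.aeval (R := k) c').toRingHom q ∈ rankLE k n r := by
      rw [mem_rankLE, ← rankAt_polarMat, hc', rankAt, Matrix.map_mul]
      exact (rank_mul_le_right _ _).trans (rank_le_height _)
    exact (PrimeSpectrum.mem_vanishingIdeal _ _).mp hp _ hq
  let ψ : P →ₐ[k] A := MvPolynomial.aeval (Sum.elim (fun ij => Φ ij.1 ij.2) d)
  have h1 : (fun s => ψ (c' s)) = c := by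
    apply polarMat_injective (isUnit_two A h2)
    have hd : (polarMat d').map ψ = polarMat d := by
      rw [← polarMat_map]
      exact congrArg polarMat (funext fun s => MvPolynomial.aeval_X _ _)
    have hΦ : Φ'.map ψ = Φ := by
      ext i j
      exact MvPolynomial.aeval_X _ _
    rw [polarMat_map, hc', Matrix.map_mul, Matrix.map_mul, transpose_map, hd, hΦ, hc]
  have h3 : MvPolynomial.aeval c = ψ.comp (MvPolynomial.aeval (R := k) c') := by
    ext s; simp [← h1]
  rw [h3, AlgHom.comp_apply, h0, map_zero]

/-- The factorization bounds the rank above by `r`, and `Xᵀ (Φᵀ D Φ) X = D` with `D` invertible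
bounds it below. -/
lemma isQuadPoint_conj (h2 : (2 : k) ≠ 0) {c : Sym2 (Fin n) → A} {d : Sym2 (Fin r) → A}
    {Φ : Matrix (Fin r) (Fin n) A} {X : Matrix (Fin n) (Fin r) A} (hX : Φ * X = 1)
    (hd : IsUnit (polarMat d).det) (hc : polarMat c = Φᵀ * polarMat d * Φ) :
    IsQuadPoint k n r c := by
  refine ⟨fun p hp => aeval_eq_zero_of_conj h2 hc hp, fun q => le_antisymm ?_ ?_⟩
  · rw [hc, rankAt, Matrix.map_mul]
    exact (rank_mul_le_right _ _).trans (rank_le_height _)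
  · have h3 : polarMat d = Xᵀ * polarMat c * X := by
      have h4 : Xᵀ * Φᵀ = 1 := by rw [← transpose_mul, hX, transpose_one]
      rw [hc, Matrix.mul_assoc, Matrix.mul_assoc, Matrix.mul_assoc, hX, ← Matrix.mul_assoc, h4,
        Matrix.one_mul, Matrix.mul_one]
    have h5 : ((polarMat d).map (algebraMap A q.asIdeal.ResidueField)).rank = r := by
      rw [rank_of_isUnit _ ((isUnit_iff_isUnit_det _).mpr ?_), Fintype.card_fin]
      have := hd.map (algebraMap A q.asIdeal.ResidueField)
      rwa [RingHom.map_det] at this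
    rw [rankAt]
    conv_lhs => rw [← h5, h3, Matrix.map_mul, Matrix.map_mul]
    exact (rank_mul_le_left _ _).trans (rank_mul_le_right _ _)

lemma isQuadPoint_self_iff (h2 : (2 : k) ≠ 0) {c : Sym2 (Fin n) → A} :
    IsQuadPoint k n n c ↔ IsUnit (polarMat c).det := by
  refine ⟨fun h => det_isUnit_of_rankAt fun q => (h.rankAt_eq q).ge, fun h => ?_⟩
  exact isQuadPoint_conj h2 (Φ := 1) (X := 1) (by simp) h (by simp)

/-- Since `ker Φ ≤ ker M`, one has `M = M X Φ`. Its transpose is `M = Φᵀ Xᵀ M`, and substituting one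
in the other gives the factorization. The inner square matrix of size `r` then has full rank at
every prime. -/
lemma IsQuadPoint.eq_conj {c : Sym2 (Fin n) → A} (hc : IsQuadPoint k n r c)
    {Φ : Matrix (Fin r) (Fin n) A} {X : Matrix (Fin n) (Fin r) A} (hX : Φ * X = 1)
    (hker : LinearMap.ker (polarMat c).mulVecLin = LinearMap.ker Φ.mulVecLin) :
    polarMat c = Φᵀ * (Xᵀ * polarMat c * X) * Φ ∧ IsUnit (Xᵀ * polarMat c * X).det := by
  have h3 := eq_of_ker_le hX (polarMat c) hker.ge
  have h4 : polarMat c = Φᵀ * (Xᵀ * polarMat c * X) * Φ := by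
    have h5 := congrArg transpose h3
    rw [polarMat_isSymm, transpose_mul, transpose_mul, polarMat_isSymm] at h5
    conv_lhs => rw [h3]
    conv_lhs => rw [h5]
    simp only [Matrix.mul_assoc]
  refine ⟨h4, det_isUnit_of_rankAt fun q => ?_⟩
  refine (hc.rankAt_eq q).ge.trans ?_
  rw [rankAt, rankAt]
  conv_lhs => rw [h4, Matrix.map_mul, Matrix.map_mul]
  exact (rank_mul_le_left _ _).trans (rank_mul_le_right _ _)

end QuadGrass

/-! ### Isomorphisms from bijective natural relations on points -/

section Relations

variable {k : Type u} [Field k]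

/-- A natural functional relation between the points of `X` and `Y` comes from a natural family
of maps. -/
def PointsMap.ofRel {X Y : Over (Spec (.of k))}
    (R : ∀ (A : Type u) [CommRing A] [Algebra k A], (specOver k A ⟶ X) → (specOver k A ⟶ Y) → Prop)
    (hR : ∀ {A B : Type u} [CommRing A] [Algebra k A] [CommRing B] [Algebra k B] (f : A →ₐ[k] B)
      (x : specOver k A ⟶ X) (y : specOver k A ⟶ Y), R A x y →
        R B (specOverMap f ≫ x) (specOverMap f ≫ y))
    (h : ∀ (A : Type u) [CommRing A] [Algebra k A] (x : specOver k A ⟶ X), ∃! y, R A x y) :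
    PointsMap X Y where
  app A _ _ x := (h A x).choose
  naturality {A B} _ _ _ _ f x := ((h B _).choose_spec.2 _ (hR f x _ (h A x).choose_spec.1)).symm

/-- A relation that is functional in both directions needs only stability under base change:
naturality of the two resulting maps, and that they are mutually inverse, follow from uniqueness. -/
lemma exists_iso_of_rel {X Y : Over (Spec (.of k))}
    (R : ∀ (A : Type u) [CommRing A] [Algebra k A], (specOver k A ⟶ X) → (specOver k A ⟶ Y) → Prop)
    (hR : ∀ {A B : Type u} [CommRing A] [Algebra k A] [CommRing B] [Algebra k B] (f : A →ₐ[k] B)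
      (x : specOver k A ⟶ X) (y : specOver k A ⟶ Y), R A x y →
        R B (specOverMap f ≫ x) (specOverMap f ≫ y))
    (h : ∀ (A : Type u) [CommRing A] [Algebra k A] (x : specOver k A ⟶ X), ∃! y, R A x y)
    (h' : ∀ (A : Type u) [CommRing A] [Algebra k A] (y : specOver k A ⟶ Y), ∃! x, R A x y) :
    ∃ φ : X ≅ Y, ∀ (A : Type u) [CommRing A] [Algebra k A] (x : specOver k A ⟶ X),
      R A x (x ≫ φ.hom) := by
  let η := PointsMap.ofRel R hR h
  let ξ := PointsMap.ofRel (fun A _ _ y x => R A x y) (fun f y x => hR f x y) h'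
  have h1 : ∀ (A : Type u) [CommRing A] [Algebra k A] (x : specOver k A ⟶ X), R A x (η.app A x) :=
    fun A _ _ x => (h A x).choose_spec.1
  have h2 : ∀ (A : Type u) [CommRing A] [Algebra k A] (y : specOver k A ⟶ Y), R A (ξ.app A y) y :=
    fun A _ _ y => (h' A y).choose_spec.1
  refine ⟨isoOfPoints η ξ (fun A _ _ x => (h' A _).unique (h2 A _) (h1 A x))
    (fun A _ _ y => (h A _).unique (h1 A _) (h2 A y)), fun A _ _ x => ?_⟩
  change R A x (x ≫ η.hom)
  rw [η.comp_hom]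
  exact h1 A x

end Relations

/-! ### Points of the Grassmannian functor as submodules of `A ^ n` -/

section Planes

open Matrix

variable {k : Type u} [Field k] {n r : ℕ}

/-- The submodule of `A ^ n` corresponding to a point of the Grassmannian functor. -/
def planeOf {A : Type u} [CommRing A] [Algebra k A]
    (G : Module.Grassmannian A (A ⊗[k] (Fin n → k)) r) : Submodule A (Fin n → A) :=
  G.toSubmodule.map (TensorProduct.piScalarRight k A A (Fin n)).toLinearMap

variable {A B : Type u} [CommRing A] [Algebra k A] [CommRing B] [Algebra k B]

lemma isGrass_planeOf (G : Module.Grassmannian A (A ⊗[k] (Fin n → k)) r) :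
    IsGrass (planeOf G) r := by
  have e : ((A ⊗[k] (Fin n → k)) ⧸ G.toSubmodule) ≃ₗ[A] ((Fin n → A) ⧸ planeOf G) :=
    Submodule.Quotient.equiv _ _ (TensorProduct.piScalarRight k A A (Fin n)) rfl
  exact ⟨Module.Finite.equiv e, Module.Projective.of_equiv e, fun p => by
    rw [← Module.rankAtStalk_eq_of_equiv e, G.rankAtStalk_eq]⟩

lemma planeOf_injective : Function.Injective
    (planeOf : Module.Grassmannian A (A ⊗[k] (Fin n → k)) r → _) := by
  intro G G' h
  ext1
  exact Submodule.map_injective_of_injective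
    (TensorProduct.piScalarRight k A A (Fin n)).injective h

lemma exists_planeOf {N : Submodule A (Fin n → A)} (hN : IsGrass N r) :
    ∃ G : Module.Grassmannian A (A ⊗[k] (Fin n → k)) r, planeOf G = N := by
  let σ := (TensorProduct.piScalarRight k A A (Fin n))
  have e : ((Fin n → A) ⧸ N) ≃ₗ[A] ((A ⊗[k] (Fin n → k)) ⧸ N.map σ.symm.toLinearMap) :=
    Submodule.Quotient.equiv _ _ σ.symm rfl
  have := hN.finite
  have := hN.projective
  refine ⟨⟨N.map σ.symm.toLinearMap, Module.Finite.equiv e, Module.Projective.of_equiv e,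
    fun p => by rw [← Module.rankAtStalk_eq_of_equiv e, hN.rankAtStalk_eq]⟩, ?_⟩
  change (N.map σ.symm.toLinearMap).map σ.toLinearMap = N
  rw [← Submodule.map_comp]
  simp

/-- `G.map f` is the kernel of the base-changed quotient map `β`, whereas `baseChangeSub` is a span.
The spanning vectors lie in the kernel by `hβ`. Conversely, an idempotent `E` with kernel `planeOf
G` factors through the quotient, so `β x = 0` forces `E.map f *ᵥ τ x = 0`, and the kernel of `E.map
f` is the span. -/
lemma planeOf_map (f : A →ₐ[k] B) (G : Module.Grassmannian A (A ⊗[k] (Fin n → k)) r) :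
    planeOf (G.map f) = baseChangeSub f.toRingHom (planeOf G) := by
  let : Algebra A B := f.toAlgebra
  have : IsScalarTower k A B := IsScalarTower.of_algebraMap_eq' f.comp_algebraMap.symm
  obtain ⟨E, hE, hker, -⟩ := (isGrass_planeOf G).exists_idempotent
  let σ := TensorProduct.piScalarRight k A A (Fin n)
  let τ := TensorProduct.piScalarRight k B B (Fin n)
  let β := Module.Grassmannian.baseChangeMkQ B G.toSubmodule
  have hmap : planeOf (G.map f) = (LinearMap.ker β).map τ.toLinearMap := rfl
  have hmem : ∀ v : Fin n → A, v ∈ planeOf G ↔ σ.symm v ∈ G.toSubmodule := fun v =>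
    Submodule.mem_map_equiv (e := σ) _
  have hβt : ∀ (b : B) (m : Fin n → k), β (b ⊗ₜ m) = b ⊗ₜ G.toSubmodule.mkQ (1 ⊗ₜ m) :=
    fun b m => rfl
  have hβ : ∀ v : Fin n → A, β (τ.symm (f ∘ v)) = 1 ⊗ₜ G.toSubmodule.mkQ (σ.symm v) := by
    intro v
    have h1 : f ∘ v = ∑ i, Pi.single i (f (v i)) := by
      rw [Finset.univ_sum_single]; rfl
    conv_rhs => rw [← Finset.univ_sum_single v]
    rw [h1, map_sum, map_sum, map_sum, map_sum, TensorProduct.tmul_sum]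
    refine Finset.sum_congr rfl fun i _ => ?_
    rw [TensorProduct.piScalarRight_symm_single, TensorProduct.piScalarRight_symm_single, hβt]
    have : v i ⊗ₜ[k] (Pi.single i 1 : Fin n → k) = v i • (1 ⊗ₜ[k] Pi.single i 1) := by
      rw [TensorProduct.smul_tmul', smul_eq_mul, mul_one]
    rw [this, map_smul, ← TensorProduct.smul_tmul, Algebra.smul_def, mul_one]
    rfl
  rw [hmap]
  apply le_antisymm
  · rw [← hker, baseChangeSub_ker f.toRingHom (mul_self_mul_self hE)]
    have hθ : G.toSubmodule ≤ LinearMap.ker (E.mulVecLin ∘ₗ σ.toLinearMap) := by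
      intro x hx
      have h1 : σ x ∈ LinearMap.ker E.mulVecLin := by
        rw [hker, hmem, σ.symm_apply_apply]
        exact hx
      exact h1
    let θ := G.toSubmodule.liftQ _ hθ
    let Θ := (TensorProduct.piScalarRight A B B (Fin n)).toLinearMap ∘ₗ θ.baseChange B
    have hΘ : ∀ x, Θ (β x) = E.map f *ᵥ τ x := by
      intro x
      induction x with
      | zero => simp
      | add x y hx hy => rw [map_add, map_add, hx, hy, map_add, mulVec_add]
      | tmul b m =>
        rw [hβt]
        have h1 : σ (1 ⊗ₜ m) = algebraMap k A ∘ m := by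
          ext j; simp [σ, Algebra.smul_def]
        have h2 : τ (b ⊗ₜ m) = b • (f ∘ algebraMap k A ∘ m) := by
          ext j; simp [τ, Algebra.smul_def, mul_comm]
        have h3 : Θ (b ⊗ₜ G.toSubmodule.mkQ (1 ⊗ₜ m)) =
            TensorProduct.piScalarRight A B B (Fin n) (b ⊗ₜ (E *ᵥ (σ (1 ⊗ₜ m)))) := rfl
        rw [h3, h1, h2, mulVec_smul]
        have := map_mulVec f.toRingHom E (algebraMap k A ∘ m)
        change E.map f *ᵥ (f ∘ _) = _ at this
        rw [this]
        ext j
        simp [Algebra.smul_def, mul_comm]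
        rfl
    rintro _ ⟨x, hx, rfl⟩
    change E.map f *ᵥ τ x = 0
    rw [← hΘ, show β x = 0 from hx, map_zero]
  · rw [baseChangeSub, Submodule.span_le]
    rintro _ ⟨v, hv, rfl⟩
    refine ⟨τ.symm (f ∘ v), ?_, by simp⟩
    change β _ = 0
    rw [hβ, Submodule.mkQ_apply, (Submodule.Quotient.mk_eq_zero _).mpr ((hmem v).mp hv),
      TensorProduct.tmul_zero]

end Planes

/-! ### The radical map and its local trivializations -/

section RadicalMap

open Matrix

variable {k : Type u} [Field k] {m n : ℕ} {G : Over (Spec (.of k))}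

namespace GrassmannianData

variable (e : GrassmannianData m n G) {A B : Type u} [CommRing A] [Algebra k A] [CommRing B]
  [Algebra k B]

lemma isGrass_plane (x : specOver k A ⟶ G) : IsGrass (e.plane x) (n - m) :=
  isGrass_planeOf _

lemma plane_comp (f : A →ₐ[k] B) (x : specOver k A ⟶ G) :
    e.plane (specOverMap f ≫ x) = baseChangeSub f.toRingHom (e.plane x) := by
  change planeOf (e.pointEquiv B _) = _
  rw [e.pointEquiv_comp, planeOf_map]
  rfl

lemma plane_injective : Function.Injective (e.plane : (specOver k A ⟶ G) → _) :=
  planeOf_injective.comp (e.pointEquiv A).injective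

lemma exists_plane {N : Submodule A (Fin n → A)} (hN : IsGrass N (n - m)) :
    ∃ x : specOver k A ⟶ G, e.plane x = N := by
  obtain ⟨g, rfl⟩ := exists_planeOf (k := k) hN
  exact ⟨(e.pointEquiv A).symm g, by simp [plane, planeOf]⟩

/-- The radical, as a natural map on points. -/
def radPoints : PointsMap (quad k n (n - m)) G where
  app A _ _ x := (e.exists_plane (isGrass_rad x)).choose
  naturality f x := e.plane_injective (by
    rw [e.plane_comp, (e.exists_plane (isGrass_rad x)).choose_spec,
      (e.exists_plane (isGrass_rad _)).choose_spec, rad_comp])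

/-- The morphism `Q ↦ rad Q`. -/
def radMap : quad k n (n - m) ⟶ G := e.radPoints.hom

lemma plane_comp_radMap (x : specOver k A ⟶ quad k n (n - m)) :
    e.plane (x ≫ e.radMap) = LinearMap.ker (polarMat (coeffs x)).mulVecLin := by
  rw [radMap, e.radPoints.comp_hom, ← rad_formOfCoeffs]
  exact (e.exists_plane (isGrass_rad x)).choose_spec

lemma isRadicalMap_radMap : IsRadicalMap e e.radMap := fun A _ _ x => by
  rw [plane_comp_radMap, formOfPoint_eq, rad_formOfCoeffs]

/-- Over a field of characteristic not two, the morphism `Q ↦ rad Q` is a trivial fibration over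
every open subset on which the universal submodule is the kernel of a matrix with a section. -/
lemma exists_trivialization (h2 : (2 : k) ≠ 0) (y : specOver k B ⟶ G) [IsOpenImmersion y.left]
    {Φ : Matrix (Fin (n - m)) (Fin n) B} {X : Matrix (Fin n) (Fin (n - m)) B} (hX : Φ * X = 1)
    (hy : e.plane y = LinearMap.ker Φ.mulVecLin) :
    ∃ φ : (e.radMap.left ⁻¹ᵁ y.left.opensRange).toScheme ≅
        pullback (y.left.opensRange.ι ≫ G.hom) (quad k (n - m) (n - m)).hom,
      φ.hom ≫ pullback.fst (y.left.opensRange.ι ≫ G.hom) (quad k (n - m) (n - m)).hom =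
        e.radMap.left ∣_ y.left.opensRange := by
  set U := y.left.opensRange
  let E := PointsMap.openOver (quad k n (n - m)) (e.radMap.left ⁻¹ᵁ U)
  let ιE : E ⟶ quad k n (n - m) := PointsMap.openι _ _
  let V := PointsMap.openOver G U
  let ιV : V ⟶ G := PointsMap.openι _ _
  let P : Over (Spec (.of k)) :=
    Over.mk (pullback.fst (U.ι ≫ G.hom) (quad k (n - m) (n - m)).hom ≫ U.ι ≫ G.hom)
  let fstP : P ⟶ V := Over.homMk (pullback.fst (U.ι ≫ G.hom) (quad k (n - m) (n - m)).hom) rfl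
  let sndP : P ⟶ quad k (n - m) (n - m) := Over.homMk (pullback.snd (U.ι ≫ G.hom) (quad k (n - m) (n - m)).hom)
    pullback.condition.symm
  let πU : E ⟶ V := Over.homMk (e.radMap.left ∣_ U) (by
    change _ ≫ U.ι ≫ G.hom = (e.radMap.left ⁻¹ᵁ U).ι ≫ (quad k n (n - m)).hom
    rw [morphismRestrict_ι_assoc, Over.w])
  have hπU : πU ≫ ιV = ιE ≫ e.radMap := by
    ext1
    exact morphismRestrict_ι _ _
  have monoE : Mono ιE.left := inferInstanceAs (Mono (e.radMap.left ⁻¹ᵁ U).ι)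
  have monoV : Mono ιV.left := inferInstanceAs (Mono U.ι)
  -- The graph of the trivialization: `t` and `w` lie over the same point of `U`, and if that point
  -- is `y` pulled back along `g`, the form of `t` is the pull-back by `Φ.map g` of the form of `w`.
  let R : ∀ (A : Type u) [CommRing A] [Algebra k A], (specOver k A ⟶ E) → (specOver k A ⟶ P) → Prop :=
    fun A _ _ t w => t ≫ πU = w ≫ fstP ∧ ∃ g : B →ₐ[k] A, t ≫ ιE ≫ e.radMap = specOverMap g ≫ y ∧
      polarMat (coeffs (t ≫ ιE)) = (Φ.map g)ᵀ * polarMat (coeffs (w ≫ sndP)) * Φ.map g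
  -- The open immersion `y` has image `U`, so every point of `U` factors uniquely through `Spec B`.
  have hg : ∀ (A : Type u) [CommRing A] [Algebra k A] (v : specOver k A ⟶ V),
      ∃! g : B →ₐ[k] A, v ≫ ιV = specOverMap g ≫ y := by
    intro A _ _ v
    have hr : Set.range (v ≫ ιV).left ⊆ Set.range y.left := by
      rintro _ ⟨p, rfl⟩
      exact (v.left p).2
    let w : specOver k A ⟶ specOver k B :=
      Over.homMk (IsOpenImmersion.lift y.left (v ≫ ιV).left hr) (by
        rw [← Over.w y, IsOpenImmersion.lift_fac_assoc, Over.w])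
    obtain ⟨g, hg⟩ := exists_specOverMap w
    have hw : w ≫ y = v ≫ ιV := by
      ext1
      exact IsOpenImmersion.lift_fac _ _ _
    refine ⟨g, by change v ≫ ιV = specOverMap g ≫ y; rw [← hg, hw], fun g' hg' => specOverMap_injective ?_⟩
    rw [← hg]
    ext1
    rw [← cancel_mono y.left]
    exact congrArg (fun f => Over.Hom.left f) (hg'.symm.trans hw.symm)
  have hΦg : ∀ (A : Type u) [CommRing A] [Algebra k A] (g : B →ₐ[k] A),
      Φ.map g * X.map g = 1 ∧
      e.plane (specOverMap g ≫ y) = LinearMap.ker (Φ.map g).mulVecLin := by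
    intro A _ _ g
    refine ⟨?_, ?_⟩
    · rw [← Matrix.map_mul, hX, Matrix.map_one _ (map_zero g) (map_one g)]
    · rw [e.plane_comp, hy, baseChangeSub_ker _ (X := X) (by rw [hX, Matrix.one_mul])]
      rfl
  have hiso : ∃ φ : E ≅ P, ∀ (A : Type u) [CommRing A] [Algebra k A] (x : specOver k A ⟶ E),
      R A x (x ≫ φ.hom) := by
    refine exists_iso_of_rel R ?_ ?_ ?_
    · rintro A A' _ _ _ _ f t w ⟨h1, g, h3, h4⟩
      refine ⟨by simp only [Category.assoc, h1], f.comp g, ?_, ?_⟩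
      · rw [Category.assoc, h3, specOverMap_comp, Category.assoc]
      · rw [Category.assoc, Category.assoc, coeffs_comp, coeffs_comp, polarMat_map, polarMat_map, h4,
          Matrix.map_mul, Matrix.map_mul]
        rfl
    · intro A _ _ t
      obtain ⟨g, hgt, hgu⟩ := hg A (t ≫ πU)
      rw [Category.assoc, hπU] at hgt
      obtain ⟨hX', hpl⟩ := hΦg A g
      have hc := isQuadPoint_coeffs (t ≫ ιE)
      have hker : LinearMap.ker (polarMat (coeffs (t ≫ ιE))).mulVecLin =
          LinearMap.ker (Φ.map g).mulVecLin := by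
        rw [← hpl, ← hgt, ← Category.assoc, plane_comp_radMap]
      obtain ⟨h4, h5⟩ := hc.eq_conj hX' hker
      -- The nondegenerate form induced on the quotient by the radical is read off along the section
      -- `X` of `Φ`.
      obtain ⟨d, hd⟩ := exists_polarMat_eq (isUnit_two A h2)
        (M := (X.map g)ᵀ * polarMat (coeffs (t ≫ ιE)) * X.map g) (by
          rw [IsSymm, transpose_mul, transpose_mul, transpose_transpose, polarMat_isSymm,
            Matrix.mul_assoc])
      rw [← hd] at h4 h5
      obtain ⟨z, rfl⟩ := exists_point ((isQuadPoint_self_iff h2).mpr h5)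
      let w : specOver k A ⟶ P := Over.homMk (pullback.lift (t ≫ πU).left z.left (by
        exact (Over.w (t ≫ πU)).trans (Over.w z).symm)) (by
          change pullback.lift _ _ _ ≫ pullback.fst _ _ ≫ _ = _
          rw [pullback.lift_fst_assoc]
          exact Over.w (t ≫ πU))
      have hw1 : w ≫ fstP = t ≫ πU := by
        ext1
        exact pullback.lift_fst _ _ _
      have hw2 : w ≫ sndP = z := by
        ext1
        exact pullback.lift_snd _ _ _
      refine ⟨w, ⟨hw1.symm, g, hgt, by rw [hw2]; exact h4⟩, ?_⟩
      rintro w' ⟨h6, g', h7, h8⟩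
      obtain rfl : g' = g := hgu g' (by
        change (t ≫ πU) ≫ ιV = _
        rw [Category.assoc, hπU]
        exact h7)
      have h9 : w' ≫ sndP = z := by
        apply coeffs_injective
        apply polarMat_injective (isUnit_two A h2)
        have hX'' : (X.map g')ᵀ * (Φ.map g')ᵀ = 1 := by
          rw [← transpose_mul, hX', transpose_one]
        have h10 : ∀ D : Matrix (Fin (n - m)) (Fin (n - m)) A,
            (X.map g')ᵀ * ((Φ.map g')ᵀ * D * Φ.map g') * X.map g' = D := fun D => by
          rw [← Matrix.mul_assoc, ← Matrix.mul_assoc, hX'', Matrix.one_mul, Matrix.mul_assoc, hX',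
            Matrix.mul_one]
        rw [hd, h8, h10]
      ext1
      apply pullback.hom_ext
      · exact congrArg (fun f => Over.Hom.left f) (h6.symm.trans hw1.symm)
      · exact congrArg (fun f => Over.Hom.left f) (h9.trans hw2.symm)
    · intro A _ _ w
      obtain ⟨g, hgt, hgu⟩ := hg A (w ≫ fstP)
      obtain ⟨hX', hpl⟩ := hΦg A g
      rw [Category.assoc] at hgt
      obtain ⟨c, hc⟩ := exists_polarMat_eq (isUnit_two A h2)
        (M := (Φ.map g)ᵀ * polarMat (coeffs (w ≫ sndP)) * Φ.map g) (by
          rw [IsSymm, transpose_mul, transpose_mul, transpose_transpose, polarMat_isSymm,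
            Matrix.mul_assoc])
      have hd : IsUnit (polarMat (coeffs (w ≫ sndP))).det :=
        (isQuadPoint_self_iff h2).mp (isQuadPoint_coeffs _)
      have hqc := isQuadPoint_conj h2 hX' hd hc
      obtain ⟨x, rfl⟩ := exists_point hqc
      -- The radical of `Φᵀ D Φ` is exactly `ker Φ`, because `D` is invertible and `Φᵀ` has the left
      -- inverse `Xᵀ`.
      have hxπ : x ≫ e.radMap = w ≫ fstP ≫ ιV := by
        apply e.plane_injective
        rw [plane_comp_radMap, hgt, hpl]
        refine le_antisymm ?_ ?_
        · have hh : Φ.map g = ((polarMat (coeffs (w ≫ sndP)))⁻¹ * (X.map g)ᵀ) *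
              polarMat (coeffs x) := by
            have hX'' : (X.map g)ᵀ * (Φ.map g)ᵀ = 1 := by
              rw [← transpose_mul, hX', transpose_one]
            rw [hc, Matrix.mul_assoc, ← Matrix.mul_assoc (X.map g)ᵀ,
              ← Matrix.mul_assoc (X.map g)ᵀ, hX'', Matrix.one_mul, ← Matrix.mul_assoc,
              nonsing_inv_mul _ hd, Matrix.one_mul]
          intro v hv
          change Φ.map g *ᵥ v = 0
          rw [hh, ← mulVec_mulVec, show polarMat (coeffs x) *ᵥ v = 0 from hv, mulVec_zero]
        · intro v hv
          change polarMat (coeffs x) *ᵥ v = 0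
          rw [hc, ← mulVec_mulVec, show Φ.map g *ᵥ v = 0 from hv, mulVec_zero]
      have hr : Set.range x.left ⊆ Set.range ιE.left := by
        rintro _ ⟨p, rfl⟩
        change _ ∈ Set.range (e.radMap.left ⁻¹ᵁ U).ι
        rw [Scheme.Opens.range_ι]
        change e.radMap.left (x.left p) ∈ U
        have : e.radMap.left (x.left p) = ((w ≫ fstP).left p : U.toScheme).1 := by
          have h := congrArg (fun f : specOver k A ⟶ G => f.left p) hxπ
          exact h
        rw [this]
        exact ((w ≫ fstP).left p : U.toScheme).2
      have : IsOpenImmersion ιE.left :=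
        inferInstanceAs (IsOpenImmersion (e.radMap.left ⁻¹ᵁ U).ι)
      let t : specOver k A ⟶ E :=
        Over.homMk (IsOpenImmersion.lift ιE.left x.left hr) (by
          rw [← Over.w ιE, IsOpenImmersion.lift_fac_assoc, Over.w])
      have ht : t ≫ ιE = x := by
        ext1
        exact IsOpenImmersion.lift_fac _ _ _
      have ht2 : t ≫ πU = w ≫ fstP := by
        ext1
        rw [← cancel_mono ιV.left]
        refine congrArg (fun f => Over.Hom.left f) (?_ : (t ≫ πU) ≫ ιV = (w ≫ fstP) ≫ ιV)
        rw [Category.assoc, hπU, ← Category.assoc, ht, hxπ, Category.assoc]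
      refine ⟨t, ⟨ht2, g, ?_, ?_⟩, ?_⟩
      · rw [← Category.assoc, ht, hxπ, hgt]
      · rw [ht, hc]
      · rintro t' ⟨h6, g', h7, h8⟩
        obtain rfl : g' = g := hgu g' (by
          change (w ≫ fstP) ≫ ιV = _
          rw [← h6, Category.assoc, hπU]
          exact h7)
        ext1
        rw [← cancel_mono ιE.left]
        refine congrArg (fun f => Over.Hom.left f) (?_ : t' ≫ ιE = t ≫ ιE)
        apply coeffs_injective
        apply polarMat_injective (isUnit_two A h2)
        rw [h8, ht, hc]
  obtain ⟨φ, hφ⟩ := hiso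
  have h1 : φ.hom ≫ fstP = πU := hom_ext_of_points fun A _ _ x => by
    rw [← Category.assoc, ← (hφ A x).1]
  refine ⟨(Over.forget _).mapIso φ, ?_⟩
  exact congrArg (fun f => Over.Hom.left f) h1

/-- The Grassmannian is covered by open affine subschemes on which the universal submodule is the
kernel of a matrix that contains an identity matrix. -/
lemma exists_chart (b : G.left) : ∃ (B : Type u) (_ : CommRing B) (_ : Algebra k B)
    (y : specOver k B ⟶ G) (_ : IsOpenImmersion y.left) (J : Fin (n - m) → Fin n)
    (Φ : Matrix (Fin (n - m)) (Fin n) B), b ∈ y.left.opensRange ∧ Φ.submatrix id J = 1 ∧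
      e.plane y = LinearMap.ker Φ.mulVecLin := by
  obtain ⟨_, ⟨W, hW, rfl⟩, hbW, -⟩ :=
    G.left.isBasis_affineOpens.exists_subset_of_mem_open (Set.mem_univ b) isOpen_univ
  have : IsAffine (PointsMap.openOver G W).left := hW
  let := globalAlgebra (PointsMap.openOver G W)
  let S := Γ((PointsMap.openOver G W).left, ⊤)
  let y : specOver k S ⟶ G := (affineIso (PointsMap.openOver G W)).inv ≫ PointsMap.openι G W
  have : IsIso (affineIso (PointsMap.openOver G W)).inv.left :=
    inferInstanceAs (IsIso ((Over.forget _).map (affineIso (PointsMap.openOver G W)).inv))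
  have hy : IsOpenImmersion y.left :=
    inferInstanceAs (IsOpenImmersion ((affineIso (PointsMap.openOver G W)).inv.left ≫ Scheme.Opens.ι W))
  let q : PrimeSpectrum S := (affineIso (PointsMap.openOver G W)).hom.left ⟨b, hbW⟩
  have hq : y.left q = b := by
    have h1 : (affineIso (PointsMap.openOver G W)).hom ≫ y = PointsMap.openι G W := by simp [y]
    exact congrArg (fun f : PointsMap.openOver G W ⟶ G => f.left ⟨b, hbW⟩) h1
  obtain ⟨f, hf, J, Φ, hΦ, hN⟩ := (e.isGrass_plane y).exists_chart q
  let ℓ : S →ₐ[k] Localization.Away f := IsScalarTower.toAlgHom k S _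
  have hℓ : IsOpenImmersion (specOverMap ℓ).left :=
    inferInstanceAs (IsOpenImmersion (Spec.map (CommRingCat.ofHom
      (algebraMap S (Localization.Away f)))))
  have hℓy : IsOpenImmersion (specOverMap ℓ ≫ y).left :=
    inferInstanceAs (IsOpenImmersion ((specOverMap ℓ).left ≫ y.left))
  refine ⟨Localization.Away f, inferInstance, inferInstance, specOverMap ℓ ≫ y, hℓy, J, Φ, ?_, hΦ, ?_⟩
  · have hq' : q ∈ Set.range (PrimeSpectrum.comap (algebraMap S (Localization.Away f))) := by
      rw [PrimeSpectrum.localization_away_comap_range _ f]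
      exact hf
    obtain ⟨q', hq'⟩ := hq'
    refine ⟨q', ?_⟩
    change y.left (PrimeSpectrum.comap (algebraMap S (Localization.Away f)) q') = b
    rw [hq', hq]
  · rw [plane_comp]
    exact hN

lemma isZariskiLocallyTrivial_radMap (h2 : (2 : k) ≠ 0) :
    IsZariskiLocallyTrivial e.radMap (quad k (n - m) (n - m)) := by
  intro b
  obtain ⟨B, _, _, y, _, J, Φ, hb, hΦ, hy⟩ := e.exists_chart b
  obtain ⟨φ, hφ⟩ := e.exists_trivialization h2 y
    (X := (1 : Matrix (Fin n) (Fin n) B).submatrix id J)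
    (by rw [mul_submatrix_one, hΦ]) hy
  exact ⟨y.left.opensRange, hb, φ, hφ⟩

end GrassmannianData

lemma exists_isRadicalMap (h2 : (2 : k) ≠ 0) {r : ℕ} (hr : r ≤ n) (e : GrassmannianData (n - r) n G) :
    ∃ π : quad k n r ⟶ G, IsRadicalMap e π ∧ IsZariskiLocallyTrivial π (quad k r r) := by
  -- The constructions above are stated for rank `n - m`; with `m = n - r` this is `r`, as `r ≤ n`.
  have h := Nat.sub_sub_self hr
  have h3 : ∃ π : quad k n (n - (n - r)) ⟶ G, IsRadicalMap e π ∧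
      IsZariskiLocallyTrivial π (quad k (n - (n - r)) (n - (n - r))) :=
    ⟨e.radMap, e.isRadicalMap_radMap, e.isZariskiLocallyTrivial_radMap h2⟩
  rwa [h] at h3

end RadicalMap

/-! ### Charts of the Grassmannian and their overlaps -/

section Charts

open Matrix

variable {k : Type u} [Field k] {n r : ℕ}

/-- A submodule of `A ^ n` is in the chart `J` of the Grassmannian if it is the kernel of a matrix
whose columns in `J` form the identity matrix. -/
def IsChart (J : Fin r → Fin n) {A : Type u} [CommRing A] (N : Submodule A (Fin n → A)) : Prop :=
  ∃ Φ : Matrix (Fin r) (Fin n) A, Φ.submatrix id J = 1 ∧ N = LinearMap.ker Φ.mulVecLin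

variable {A B : Type u} [CommRing A] [Algebra k A] [CommRing B] [Algebra k B]

omit [Algebra k A] in
lemma mul_section {J : Fin r → Fin n} {Φ : Matrix (Fin r) (Fin n) A} (h : Φ.submatrix id J = 1) :
    Φ * (1 : Matrix (Fin n) (Fin n) A).submatrix id J = 1 := by
  rw [mul_submatrix_one, h]

omit [Algebra k A] in
lemma eq_of_ker_eq {J : Fin r → Fin n} {Φ Ψ : Matrix (Fin r) (Fin n) A}
    (hΦ : Φ.submatrix id J = 1) (hΨ : Ψ.submatrix id J = 1)
    (h : LinearMap.ker Φ.mulVecLin = LinearMap.ker Ψ.mulVecLin) : Φ = Ψ := by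
  have := eq_of_ker_le (mul_section hΦ) Ψ h.le
  rw [mul_section hΨ, Matrix.one_mul] at this
  exact this.symm

omit [Algebra k A] in
lemma IsChart.isGrass {J : Fin r → Fin n} {N : Submodule A (Fin n → A)} (h : IsChart J N) :
    IsGrass N r := by
  obtain ⟨Φ, hΦ, rfl⟩ := h
  exact isGrass_ker_of_section (mul_section hΦ)

omit [Algebra k A] [Algebra k B] in
lemma baseChangeSub_chart {J : Fin r → Fin n} {Φ : Matrix (Fin r) (Fin n) A}
    (h : Φ.submatrix id J = 1) (f : A →+* B) :
    baseChangeSub f (LinearMap.ker Φ.mulVecLin) = LinearMap.ker (Φ.map f).mulVecLin :=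
  baseChangeSub_ker f (X := (1 : Matrix (Fin n) (Fin n) A).submatrix id J)
    (by rw [mul_section h, Matrix.one_mul])

omit [Algebra k A] [Algebra k B] in
lemma map_submatrix_eq_one {J : Fin r → Fin n} {Φ : Matrix (Fin r) (Fin n) A}
    (h : Φ.submatrix id J = 1) (f : A →+* B) : (Φ.map f).submatrix id J = 1 := by
  change (Φ.submatrix id J).map f = 1
  rw [h, Matrix.map_one _ (map_zero f) (map_one f)]

omit [Algebra k A] in
/-- A submodule in the chart `J` is in the chart `K` if the columns in `K` of its matrix form an
invertible matrix. -/
lemma isChart_ker_iff {J K : Fin r → Fin n} {Φ : Matrix (Fin r) (Fin n) A}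
    (h : Φ.submatrix id J = 1) :
    IsChart K (LinearMap.ker Φ.mulVecLin) ↔ IsUnit (Φ.submatrix id K).det := by
  constructor
  · rintro ⟨Ψ, hΨ, hker⟩
    have h1 := eq_of_ker_le (mul_section hΨ) Φ hker.ge
    rw [mul_submatrix_one] at h1
    have h2 : Φ.submatrix id K * Ψ.submatrix id J = 1 := by
      rw [← h]
      conv_rhs => rw [h1]
      rfl
    exact isUnit_det_of_right_inverse h2
  · intro hu
    refine ⟨(Φ.submatrix id K)⁻¹ * Φ, ?_, ?_⟩
    · exact nonsing_inv_mul _ hu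
    · refine le_antisymm (fun v hv => ?_) (fun v hv => ?_)
      · change (_ * Φ) *ᵥ v = 0
        rw [← mulVec_mulVec, show Φ *ᵥ v = 0 from hv, mulVec_zero]
      · replace hv : ((Φ.submatrix id K)⁻¹ * Φ) *ᵥ v = 0 := hv
        change Φ *ᵥ v = 0
        rw [← Matrix.one_mul Φ, ← mul_nonsing_inv _ hu, Matrix.mul_assoc, ← mulVec_mulVec, hv,
          mulVec_zero]

/-- A scheme over `k` that represents a class of submodules of `A ^ n`. -/
structure Represents (P : ∀ (A : Type u) [CommRing A], Submodule A (Fin n → A) → Prop)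
    (X : Over (Spec (.of k))) where
  plane {A : Type u} [CommRing A] [Algebra k A] : (specOver k A ⟶ X) → Submodule A (Fin n → A)
  plane_comp {A B : Type u} [CommRing A] [Algebra k A] [CommRing B] [Algebra k B] (f : A →ₐ[k] B)
    (x : specOver k A ⟶ X) : plane (specOverMap f ≫ x) = baseChangeSub f.toRingHom (plane x)
  plane_injective {A : Type u} [CommRing A] [Algebra k A] :
    Function.Injective (plane : (specOver k A ⟶ X) → _)
  prop {A : Type u} [CommRing A] [Algebra k A] (x : specOver k A ⟶ X) : P A (plane x)
  exists_plane {A : Type u} [CommRing A] [Algebra k A] {N : Submodule A (Fin n → A)} (h : P A N) :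
    ∃ x, plane x = N

namespace Represents

variable {P Q : ∀ (A : Type u) [CommRing A], Submodule A (Fin n → A) → Prop}
  {X Y : Over (Spec (.of k))}

/-- A subobject of a scheme that represents a class of submodules represents a subclass. -/
def ofMono (h : Represents P X) (i : Y ⟶ X) [Mono i.left]
    (hi : ∀ (A : Type u) [CommRing A] [Algebra k A] (x : specOver k A ⟶ X),
      Q A (h.plane x) ↔ ∃ y : specOver k A ⟶ Y, y ≫ i = x)
    (hQP : ∀ (A : Type u) [CommRing A] (N : Submodule A (Fin n → A)), Q A N → P A N) :
    Represents Q Y where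
  plane y := h.plane (y ≫ i)
  plane_comp f y := by rw [Category.assoc, h.plane_comp]
  plane_injective := by
    intro A _ _ y y' hy
    have := h.plane_injective hy
    ext1
    rw [← cancel_mono i.left]
    exact congrArg (fun f => Over.Hom.left f) this
  prop y := (hi _ _).mpr ⟨y, rfl⟩
  exists_plane {A _ _ N} hN := by
    obtain ⟨x, rfl⟩ := h.exists_plane (hQP _ _ hN)
    obtain ⟨y, rfl⟩ := (hi _ _).mp hN
    exact ⟨y, rfl⟩

/-- The morphism given by an inclusion of classes of submodules. -/
def map (hX : Represents P X) (hY : Represents Q Y)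
    (hPQ : ∀ (A : Type u) [CommRing A] (N : Submodule A (Fin n → A)), P A N → Q A N) : X ⟶ Y :=
  PointsMap.hom
    { app := fun A _ _ x => (hY.exists_plane (hPQ _ _ (hX.prop x))).choose
      naturality := fun f x => hY.plane_injective (by
        rw [hY.plane_comp, (hY.exists_plane (hPQ _ _ (hX.prop x))).choose_spec,
          (hY.exists_plane (hPQ _ _ (hX.prop _))).choose_spec, hX.plane_comp]) }

@[simp] lemma plane_comp_map (hX : Represents P X) (hY : Represents Q Y)
    (hPQ : ∀ (A : Type u) [CommRing A] (N : Submodule A (Fin n → A)), P A N → Q A N)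
    (x : specOver k A ⟶ X) : hY.plane (x ≫ hX.map hY hPQ) = hX.plane x := by
  rw [map, PointsMap.comp_hom]
  exact (hY.exists_plane (hPQ _ _ (hX.prop x))).choose_spec

lemma hom_ext (hY : Represents Q Y) {f g : X ⟶ Y}
    (h : ∀ (A : Type u) [CommRing A] [Algebra k A] (x : specOver k A ⟶ X),
      hY.plane (x ≫ f) = hY.plane (x ≫ g)) : f = g :=
  hom_ext_of_points fun A _ _ x => hY.plane_injective (h A x)

end Represents

section ChartRing

/-- The coordinate ring of the chart `J` of the Grassmannian. -/
abbrev ChartRing (k : Type u) [Field k] (J : Fin r → Fin n) : Type u :=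
  MvPolynomial (Fin r × Fin n) k ⧸ Ideal.span
    {p | ∃ i j, p = MvPolynomial.X (i, J j) -
      MvPolynomial.C ((1 : Matrix (Fin r) (Fin r) k) i j)}

/-- The universal matrix on the chart `J` of the Grassmannian. -/
def chartMat (k : Type u) [Field k] (J : Fin r → Fin n) :
    Matrix (Fin r) (Fin n) (ChartRing k J) :=
  .of fun i j => Ideal.Quotient.mkₐ k _ (MvPolynomial.X (i, j))

variable (J K L : Fin r → Fin n)

lemma chartMat_submatrix : (chartMat k J).submatrix id J = 1 := by
  ext i j
  have : Ideal.Quotient.mk (Ideal.span {p : MvPolynomial (Fin r × Fin n) k | ∃ i j,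
      p = MvPolynomial.X (i, J j) - MvPolynomial.C ((1 : Matrix (Fin r) (Fin r) k) i j)})
      (MvPolynomial.X (i, J j)) = Ideal.Quotient.mk _
        (MvPolynomial.C ((1 : Matrix (Fin r) (Fin r) k) i j)) := by
    rw [Ideal.Quotient.eq]
    exact Ideal.subset_span ⟨i, j, rfl⟩
  refine this.trans ?_
  by_cases hij : i = j
  · subst hij; simp
  · simp [hij]

lemma exists_chartMat_map {Φ : Matrix (Fin r) (Fin n) A} (hΦ : Φ.submatrix id J = 1) :
    ∃ g : ChartRing k J →ₐ[k] A, (chartMat k J).map g = Φ := by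
  refine ⟨Ideal.Quotient.liftₐ _ (MvPolynomial.aeval fun p => Φ p.1 p.2) ?_, ?_⟩
  · intro a ha
    change a ∈ RingHom.ker (MvPolynomial.aeval (R := k) fun p : Fin r × Fin n => Φ p.1 p.2)
    refine (Ideal.span_le.mpr ?_) ha
    rintro _ ⟨i, j, rfl⟩
    have h1 : Φ i (J j) = (1 : Matrix (Fin r) (Fin r) A) i j := congr($hΦ i j)
    change MvPolynomial.aeval _ _ = _
    rw [map_sub, MvPolynomial.aeval_X, h1, MvPolynomial.aeval_C]
    by_cases hij : i = j
    · subst hij; simp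
    · simp [hij]
  · ext i j
    exact MvPolynomial.aeval_X _ (i, j)

variable {J} in
lemma chartRing_hom_ext {f g : ChartRing k J →ₐ[k] A}
    (h : (chartMat k J).map f = (chartMat k J).map g) : f = g := by
  apply Ideal.Quotient.algHom_ext
  apply MvPolynomial.algHom_ext
  rintro ⟨i, j⟩
  exact congr($h i j)

lemma chartMat_map_submatrix (g : ChartRing k J →ₐ[k] A) :
    ((chartMat k J).map g).submatrix id J = 1 :=
  map_submatrix_eq_one (chartMat_submatrix J) g.toRingHom

lemma baseChangeSub_chartMat (g : ChartRing k J →ₐ[k] A) (f : A →ₐ[k] B) :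
    baseChangeSub f.toRingHom (LinearMap.ker ((chartMat k J).map g).mulVecLin) =
      LinearMap.ker ((chartMat k J).map (f.comp g)).mulVecLin :=
  baseChangeSub_chart (chartMat_map_submatrix J g) f.toRingHom

lemma choose_specOverMap {A B : Type u} [CommRing A] [Algebra k A] [CommRing B] [Algebra k B]
    (g : A →ₐ[k] B) : (exists_specOverMap (specOverMap g)).choose = g :=
  specOverMap_injective (exists_specOverMap (specOverMap g)).choose_spec.symm

/-- The chart `J` represents the class of submodules in the chart. -/
def chartRepresents (k : Type u) [Field k] (J : Fin r → Fin n) :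
    Represents (fun _ _ N => IsChart J N) (specOver k (ChartRing k J)) where
  plane x := LinearMap.ker ((chartMat k J).map (exists_specOverMap x).choose).mulVecLin
  plane_comp f x := by
    have h : (exists_specOverMap (specOverMap f ≫ x)).choose =
        f.comp (exists_specOverMap x).choose := by
      apply specOverMap_injective
      rw [← (exists_specOverMap (specOverMap f ≫ x)).choose_spec, specOverMap_comp,
        ← (exists_specOverMap x).choose_spec]
    rw [h, baseChangeSub_chartMat]
  plane_injective := by
    intro A _ _ x y h
    rw [(exists_specOverMap x).choose_spec, (exists_specOverMap y).choose_spec]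
    exact congrArg _ (chartRing_hom_ext (eq_of_ker_eq
      (chartMat_map_submatrix J _) (chartMat_map_submatrix J _) h))
  prop x := ⟨_, chartMat_map_submatrix J _, rfl⟩
  exists_plane := by
    rintro A _ _ N ⟨Φ, hΦ, rfl⟩
    obtain ⟨g, rfl⟩ := exists_chartMat_map (k := k) J hΦ
    exact ⟨specOverMap g, by rw [choose_specOverMap]⟩

lemma chartRepresents_plane (g : ChartRing k J →ₐ[k] A) :
    (chartRepresents k J).plane (specOverMap g) =
      LinearMap.ker ((chartMat k J).map g).mulVecLin := by
  dsimp only [chartRepresents]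
  rw [choose_specOverMap]

/-- The intersection of two charts, as an open subscheme of the first one. -/
abbrev overlap (k : Type u) [Field k] (J K : Fin r → Fin n) : Over (Spec (.of k)) :=
  specOver k (Localization.Away ((chartMat k J).submatrix id K).det)

def overlapι (k : Type u) [Field k] (J K : Fin r → Fin n) :
    overlap k J K ⟶ specOver k (ChartRing k J) :=
  specOverMap (IsScalarTower.toAlgHom k (ChartRing k J) _)

instance : IsOpenImmersion (overlapι k J K).left :=
  inferInstanceAs (IsOpenImmersion (Spec.map (CommRingCat.ofHom
    (algebraMap (ChartRing k J) (Localization.Away ((chartMat k J).submatrix id K).det)))))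

/-- Lying in the chart `K` is the invertibility of the minor on the columns `K`, by
`isChart_ker_iff`, so the overlap is a principal open subset of the chart `J`. -/
lemma isChart_iff_exists (x : specOver k A ⟶ specOver k (ChartRing k J)) :
    IsChart K ((chartRepresents k J).plane x) ↔ ∃ y, y ≫ overlapι k J K = x := by
  obtain ⟨g, rfl⟩ := exists_specOverMap x
  rw [chartRepresents_plane, isChart_ker_iff (chartMat_map_submatrix J g)]
  have h1 : (((chartMat k J).map g).submatrix id K).det =
      g ((chartMat k J).submatrix id K).det := (AlgHom.map_det g _).symm
  rw [h1]
  constructor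
  · intro hu
    let g' : Localization.Away ((chartMat k J).submatrix id K).det →ₐ[k] A :=
      IsLocalization.liftAlgHom (M := Submonoid.powers ((chartMat k J).submatrix id K).det)
        (f := g) (by
          rintro ⟨_, m, rfl⟩
          rw [map_pow]
          exact hu.pow m)
    refine ⟨specOverMap g', ?_⟩
    rw [overlapι, ← specOverMap_comp]
    congr 1
    ext a
    simp [g']
  · rintro ⟨y, hy⟩
    obtain ⟨g', rfl⟩ := exists_specOverMap y
    rw [overlapι, ← specOverMap_comp] at hy
    rw [← specOverMap_injective hy]
    exact (IsLocalization.Away.algebraMap_isUnit _).map g'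

def overlapRepresents (k : Type u) [Field k] (J K : Fin r → Fin n) :
    Represents (fun _ _ N => IsChart J N ∧ IsChart K N) (overlap k J K) :=
  (chartRepresents k J).ofMono (overlapι k J K)
    (fun _ _ _ x => by rw [← isChart_iff_exists, and_iff_right ((chartRepresents k J).prop x)])
    (fun _ _ _ h => h.1)

lemma overlapRepresents_plane (x : specOver k A ⟶ overlap k J K) :
    (overlapRepresents k J K).plane x = (chartRepresents k J).plane (x ≫ overlapι k J K) := rfl

/-- The intersection of three charts. -/
abbrev tripleOverlap (k : Type u) [Field k] (J K L : Fin r → Fin n) : Over (Spec (.of k)) :=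
  Over.mk (pullback.fst (overlapι k J K).left (overlapι k J L).left ≫ (overlap k J K).hom)

def tripleFst (k : Type u) [Field k] (J K L : Fin r → Fin n) :
    tripleOverlap k J K L ⟶ overlap k J K := Over.homMk (pullback.fst _ _)

def tripleSnd (k : Type u) [Field k] (J K L : Fin r → Fin n) :
    tripleOverlap k J K L ⟶ overlap k J L := Over.homMk (pullback.snd _ _) (by
  change _ = pullback.fst _ _ ≫ _
  rw [← Over.w (overlapι k J K), ← Over.w (overlapι k J L), pullback.condition_assoc])

lemma triple_condition :
    tripleFst k J K L ≫ overlapι k J K = tripleSnd k J K L ≫ overlapι k J L := by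
  ext1
  exact pullback.condition

def tripleRepresents (k : Type u) [Field k] (J K L : Fin r → Fin n) :
    Represents (fun _ _ N => IsChart J N ∧ IsChart K N ∧ IsChart L N) (tripleOverlap k J K L) :=
  haveI : Mono (tripleFst k J K L ≫ overlapι k J K).left :=
    inferInstanceAs (Mono (pullback.fst (overlapι k J K).left (overlapι k J L).left ≫
      (overlapι k J K).left))
  (chartRepresents k J).ofMono (tripleFst k J K L ≫ overlapι k J K)
    (fun _ _ _ x => by
      rw [and_iff_right ((chartRepresents k J).prop x), isChart_iff_exists, isChart_iff_exists]
      constructor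
      · rintro ⟨⟨y, hy⟩, ⟨z, hz⟩⟩
        refine ⟨Over.homMk (pullback.lift y.left z.left
          (congrArg (fun f => Over.Hom.left f) (hy.trans hz.symm))) ?_, ?_⟩
        · change pullback.lift _ _ _ ≫ pullback.fst _ _ ≫ _ = _
          rw [pullback.lift_fst_assoc]
          exact Over.w y
        · refine Eq.trans ?_ hy
          rw [← Category.assoc]
          congr 1
          ext1
          exact pullback.lift_fst _ _ _
      · rintro ⟨y, rfl⟩
        exact ⟨⟨y ≫ tripleFst k J K L, by simp⟩, ⟨y ≫ tripleSnd k J K L, by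
          rw [Category.assoc, triple_condition]⟩⟩)
    (fun _ _ _ h => h.1)

lemma plane_tripleFst (x : specOver k A ⟶ tripleOverlap k J K L) :
    (overlapRepresents k J K).plane (x ≫ tripleFst k J K L) = (tripleRepresents k J K L).plane x := by
  rw [overlapRepresents_plane, Category.assoc]
  rfl

lemma plane_tripleSnd (x : specOver k A ⟶ tripleOverlap k J K L) :
    (overlapRepresents k J L).plane (x ≫ tripleSnd k J K L) = (tripleRepresents k J K L).plane x := by
  rw [overlapRepresents_plane, Category.assoc, ← triple_condition]
  rfl

/-- Both overlaps represent the submodules that lie in the two charts, so the transition map is the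
one that leaves the submodule unchanged. The gluing identities then hold because both sides carry
the same submodule; no formula for the matrices is needed. -/
def transition (k : Type u) [Field k] (J K : Fin r → Fin n) : overlap k J K ⟶ overlap k K J :=
  (overlapRepresents k J K).map (overlapRepresents k K J) fun _ _ _ h => h.symm

def tripleTransition (k : Type u) [Field k] (J K L : Fin r → Fin n) :
    tripleOverlap k J K L ⟶ tripleOverlap k K L J :=
  (tripleRepresents k J K L).map (tripleRepresents k K L J) fun _ _ _ h => ⟨h.2.1, h.2.2, h.1⟩

lemma isIso_overlapι : IsIso (overlapι k J J) := by
  let s := (chartRepresents k J).map (overlapRepresents k J J) fun _ _ _ h => ⟨h, h⟩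
  refine ⟨s, ?_, ?_⟩
  · apply (overlapRepresents k J J).hom_ext
    intro A _ _ x
    rw [← Category.assoc, Represents.plane_comp_map, Category.comp_id, overlapRepresents_plane]
  · apply (chartRepresents k J).hom_ext
    intro A _ _ x
    rw [← Category.assoc, ← overlapRepresents_plane, Represents.plane_comp_map, Category.comp_id]

lemma transition_self : transition k J J = 𝟙 _ := by
  apply (overlapRepresents k J J).hom_ext
  intro A _ _ x
  rw [transition, Represents.plane_comp_map, Category.comp_id]

lemma tripleTransition_fac : tripleTransition k J K L ≫ tripleSnd k K L J =
    tripleFst k J K L ≫ transition k J K := by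
  apply (overlapRepresents k K J).hom_ext
  intro A _ _ x
  rw [← Category.assoc, plane_tripleSnd, tripleTransition, Represents.plane_comp_map, ← Category.assoc,
    transition, Represents.plane_comp_map, plane_tripleFst]

lemma tripleTransition_cocycle : tripleTransition k J K L ≫ tripleTransition k K L J ≫
    tripleTransition k L J K = 𝟙 _ := by
  apply (tripleRepresents k J K L).hom_ext
  intro A _ _ x
  simp only [← Category.assoc, tripleTransition, Represents.plane_comp_map, Category.comp_id]

end ChartRing

/-! ### Gluing the charts -/

section Glue

variable (k) (n r) in
/-- The gluing data for the Grassmannian. -/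
def grassGlueData : Scheme.GlueData.{u} where
  -- All functions are allowed as indices. A function that is not injective would require equal
  -- columns of an identity matrix, and its chart is empty.
  J := ULift.{u} (Fin r → Fin n)
  U J := (specOver k (ChartRing k J.down)).left
  V p := (overlap k p.1.down p.2.down).left
  f J K := (overlapι k J.down K.down).left
  f_id J := by
    have := isIso_overlapι (k := k) J.down
    exact inferInstanceAs (IsIso ((Over.forget _).map (overlapι k J.down J.down)))
  t J K := (transition k J.down K.down).left
  t_id J := congrArg (fun f => Over.Hom.left f) (transition_self (k := k) J.down)
  t' J K L := (tripleTransition k J.down K.down L.down).left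
  t_fac J K L := congrArg (fun f => Over.Hom.left f)
    (tripleTransition_fac (k := k) J.down K.down L.down)
  cocycle J K L := congrArg (fun f => Over.Hom.left f)
    (tripleTransition_cocycle (k := k) J.down K.down L.down)
  f_open J K := inferInstanceAs (IsOpenImmersion (overlapι k J.down K.down).left)

variable (k) (n r) in
/-- The Grassmannian that parametrizes the submodules of `A ^ n` with locally free quotient of
rank `r`. -/
def grass : Over (Spec (.of k)) :=
  Over.mk (Y := (grassGlueData k n r).glued) (Multicoequalizer.desc _ _
    (fun J => (specOver k (ChartRing k J.down)).hom) (by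
      rintro ⟨J, K⟩
      change (overlapι k J.down K.down).left ≫ _ =
        ((transition k J.down K.down).left ≫ (overlapι k K.down J.down).left) ≫ _
      exact (Over.w (overlapι k J.down K.down)).trans
        (Over.w (transition k J.down K.down ≫ overlapι k K.down J.down)).symm))

/-- The inclusion of a chart in the Grassmannian. -/
def grassι (k : Type u) [Field k] (J : Fin r → Fin n) : specOver k (ChartRing k J) ⟶ grass k n r :=
  Over.homMk ((grassGlueData k n r).ι ⟨J⟩) (Multicoequalizer.π_desc _ _ _ _ _)

instance (J : Fin r → Fin n) : IsOpenImmersion (grassι k J).left :=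
  (grassGlueData k n r).ι_isOpenImmersion ⟨J⟩

lemma exists_mem_chart (p : (grass k n r).left) : ∃ J, p ∈ Set.range (grassι k J).left := by
  obtain ⟨J, y, hy⟩ := (grassGlueData k n r).ι_jointly_surjective p
  exact ⟨J.down, y, hy⟩

/-- Two chart points become equal in the glued scheme when they come from one point of the overlap,
and transition maps preserve submodules. Hence the submodule of a point does not depend on the
chart. -/
lemma comp_grassι_eq_iff {J K : Fin r → Fin n} (a : specOver k A ⟶ specOver k (ChartRing k J))
    (b : specOver k A ⟶ specOver k (ChartRing k K)) :
    a ≫ grassι k J = b ≫ grassι k K ↔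
      (chartRepresents k J).plane a = (chartRepresents k K).plane b := by
  have hglue : transition k J K ≫ overlapι k K J ≫ grassι k K = overlapι k J K ≫ grassι k J := by
    ext1
    exact (grassGlueData k n r).glue_condition ⟨J⟩ ⟨K⟩
  have ht : ∀ v : specOver k A ⟶ overlap k J K,
      (chartRepresents k K).plane (v ≫ transition k J K ≫ overlapι k K J) =
        (chartRepresents k J).plane (v ≫ overlapι k J K) := by
    intro v
    rw [← overlapRepresents_plane, ← Category.assoc, ← overlapRepresents_plane, transition,
      Represents.plane_comp_map]
  constructor
  · intro h
    obtain ⟨l, hl1, hl2⟩ := PullbackCone.IsLimit.lift'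
      ((grassGlueData k n r).vPullbackConeIsLimit ⟨J⟩ ⟨K⟩) a.left b.left
      (congrArg (fun f => Over.Hom.left f) h)
    replace hl1 : l ≫ (overlapι k J K).left = a.left := hl1
    replace hl2 : l ≫ (transition k J K).left ≫ (overlapι k K J).left = b.left := hl2
    let v : specOver k A ⟶ overlap k J K := Over.homMk l (by
      rw [← Over.w a, ← hl1]
      exact (congrArg (l ≫ ·) (Over.w (overlapι k J K)).symm).trans (Category.assoc ..).symm)
    have hv1 : v ≫ overlapι k J K = a := by ext1; exact hl1
    have hv2 : v ≫ transition k J K ≫ overlapι k K J = b := by ext1; exact hl2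
    rw [← hv1, ← hv2, ht]
  · intro h
    have h1 : IsChart K ((chartRepresents k J).plane a) := by
      rw [h]; exact (chartRepresents k K).prop b
    obtain ⟨v, rfl⟩ := (isChart_iff_exists J K a).mp h1
    rw [Category.assoc, ← hglue]
    have h2 : v ≫ transition k J K ≫ overlapι k K J = b :=
      (chartRepresents k K).plane_injective (by rw [ht, h])
    rw [← h2]
    simp only [Category.assoc]

end Glue

end Charts

/-! ### Zariski descent for submodules with locally free quotient -/

section LocalSubmodules

open Matrix

variable {n r : ℕ} {A B C : Type u} [CommRing A] [CommRing B] [CommRing C]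

lemma baseChangeSub_comp (f : A →+* B) (g : B →+* C) (N : Submodule A (Fin n → A)) :
    baseChangeSub g (baseChangeSub f N) = baseChangeSub (g.comp f) N := by
  apply le_antisymm
  · rw [baseChangeSub, Submodule.span_le]
    rintro _ ⟨v, hv, rfl⟩
    change g ∘ v ∈ _
    refine Submodule.span_induction (p := fun v _ => g ∘ v ∈ baseChangeSub (g.comp f) N)
      ?_ ?_ ?_ ?_ hv
    · rintro _ ⟨w, hw, rfl⟩
      exact Submodule.subset_span ⟨w, hw, rfl⟩
    · convert! Submodule.zero_mem (baseChangeSub (g.comp f) N)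
      ext; simp
    · intro x y _ _ hx hy
      convert! Submodule.add_mem _ hx hy
      ext; simp
    · intro b x _ hx
      convert! Submodule.smul_mem _ (g b) hx
      ext; simp
  · rw [baseChangeSub, Submodule.span_le]
    rintro _ ⟨v, hv, rfl⟩
    exact Submodule.subset_span ⟨f ∘ v, Submodule.subset_span ⟨v, hv, rfl⟩, rfl⟩

/-- The annihilator of `x` contains a power of each `s`, so it lies in no maximal ideal. -/
lemma eq_zero_of_away {x : A}
    (h : ∀ q : PrimeSpectrum A, ∃ s ∉ q.asIdeal, algebraMap A (Localization.Away s) x = 0) :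
    x = 0 := by
  have h1 : Ideal.span {y | y * x = 0} = ⊤ := by
    by_contra hne
    obtain ⟨m, hm, hle⟩ := Ideal.exists_le_maximal _ hne
    obtain ⟨s, hs, h0⟩ := h ⟨m, hm.isPrime⟩
    obtain ⟨⟨_, c, rfl⟩, hc⟩ := (IsLocalization.map_eq_zero_iff (Submonoid.powers s) _ _).mp h0
    have := hm.isPrime
    exact hs (this.mem_of_pow_mem c (hle (Ideal.subset_span hc)))
  have h2 : (1 : A) ∈ LinearMap.ker (LinearMap.toSpanSingleton A A x) := by
    have h3 : Ideal.span {y | y * x = 0} ≤ LinearMap.ker (LinearMap.toSpanSingleton A A x) :=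
      Ideal.span_le.mpr fun y hy => hy
    exact h3 (h1 ▸ Submodule.mem_top)
  simpa using h2

/-- Writing `N'` as the kernel of an idempotent `E` turns membership into the equation `E v = 0`,
which can be tested locally. -/
lemma IsGrass.le_of_away {N N' : Submodule A (Fin n → A)} (hN' : IsGrass N' r)
    (h : ∀ q : PrimeSpectrum A, ∃ s ∉ q.asIdeal,
      QuadMotive.baseChangeSub (algebraMap A (Localization.Away s)) N =
        QuadMotive.baseChangeSub (algebraMap A (Localization.Away s)) N') : N ≤ N' := by
  obtain ⟨E, hE, rfl, -⟩ := hN'.exists_idempotent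
  intro v hv
  change E *ᵥ v = 0
  ext i
  refine eq_zero_of_away fun q => ?_
  obtain ⟨s, hs, hs'⟩ := h q
  refine ⟨s, hs, ?_⟩
  have h1 : algebraMap A (Localization.Away s) ∘ v ∈
      QuadMotive.baseChangeSub (algebraMap A (Localization.Away s)) N :=
    Submodule.subset_span ⟨v, hv, rfl⟩
  rw [hs', baseChangeSub_ker _ (mul_self_mul_self hE)] at h1
  replace h1 : E.map (algebraMap A (Localization.Away s)) *ᵥ _ = 0 := h1
  rw [map_mulVec] at h1
  exact congrFun h1 i

lemma IsGrass.eq_of_away {N N' : Submodule A (Fin n → A)} (hN : IsGrass N r) (hN' : IsGrass N' r)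
    (h : ∀ q : PrimeSpectrum A, ∃ s ∉ q.asIdeal,
      QuadMotive.baseChangeSub (algebraMap A (Localization.Away s)) N =
        QuadMotive.baseChangeSub (algebraMap A (Localization.Away s)) N') : N = N' :=
  le_antisymm (hN'.le_of_away h) (hN.le_of_away fun q => by
    obtain ⟨s, hs, hs'⟩ := h q
    exact ⟨s, hs, hs'.symm⟩)

lemma rankAt_of_isGrass {E : Matrix (Fin n) (Fin n) A} (hE : E * E = E)
    (h : IsGrass (LinearMap.ker E.mulVecLin) r) (q : PrimeSpectrum A) : rankAt E q = r := by
  rw [← (rankAtStalk_range_idempotent E hE q).2,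
    ← Module.rankAtStalk_eq_of_equiv E.mulVecLin.quotKerEquivRange, h.rankAtStalk_eq]

lemma mul_eq_of_ker_le {E F : Matrix (Fin n) (Fin n) A} (hE : E * E = E)
    (h : LinearMap.ker E.mulVecLin ≤ LinearMap.ker F.mulVecLin) : F * E = F := by
  have h1 : F * (1 - E) = 0 := by
    apply Matrix.ext_of_mulVec_single
    intro i
    have : (1 - E) *ᵥ Pi.single i 1 ∈ LinearMap.ker E.mulVecLin := by
      change E *ᵥ _ = 0
      rw [mulVec_mulVec, Matrix.mul_sub, hE, Matrix.mul_one, sub_self, zero_mulVec]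
    rw [← mulVec_mulVec, show F *ᵥ _ = 0 from h this, zero_mulVec]
  rw [Matrix.mul_sub, Matrix.mul_one, sub_eq_zero] at h1
  exact h1.symm

/-- Idempotent matrices on an open cover whose kernels agree on overlaps can be replaced by one
idempotent matrix with the same kernels. -/
lemma exists_glued_idempotent {ι : Type*} [Finite ι] {s : ι → A}
    (hs : ∀ q : PrimeSpectrum A, ∃ i, s i ∉ q.asIdeal)
    (E : ∀ i, Matrix (Fin n) (Fin n) (Localization.Away (s i)))
    (hE : ∀ i j (C : Type u) [CommRing C] (f : Localization.Away (s i) →+* C)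
      (g : Localization.Away (s j) →+* C),
      f.comp (algebraMap A _) = g.comp (algebraMap A _) →
        (E i).map f * (E j).map g = (E i).map f) :
    ∃ F : Matrix (Fin n) (Fin n) A, F * F = F ∧ ∀ i,
      LinearMap.ker (F.map (algebraMap A (Localization.Away (s i)))).mulVecLin =
        LinearMap.ker (E i).mulVecLin := by
  have := Fintype.ofFinite ι
  -- Denominators are cleared: `F i` is a matrix over `A` that becomes `s i ^ m • E i` in the
  -- localization.
  have h1 : ∀ i, ∃ (m : ℕ) (F : Matrix (Fin n) (Fin n) A),
      F.map (algebraMap A (Localization.Away (s i))) =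
        algebraMap A (Localization.Away (s i)) (s i ^ m) • E i := by
    intro i
    obtain ⟨⟨_, m, rfl⟩, hb⟩ := IsLocalization.exist_integer_multiples_of_finite
      (Submonoid.powers (s i)) (fun p : Fin n × Fin n => E i p.1 p.2)
    choose F hF using hb
    refine ⟨m, .of fun a b => F (a, b), ?_⟩
    ext a b
    refine (hF (a, b)).trans ?_
    rw [Algebra.smul_def]
    rfl
  choose m F hF using h1
  -- The relation `E i * E j = E i` on overlaps expresses that the kernels agree. Over `A` it holds
  -- up to a power of `s i * s j`; finitely many relations have a common exponent `N`, absorbed in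
  -- `F'` below.
  have h2 : ∀ p : (ι × ι) × (Fin n × Fin n), ∃ c : ℕ, (s p.1.1 * s p.1.2) ^ c *
      (F p.1.1 * F p.1.2 - s p.1.2 ^ m p.1.2 • F p.1.1) p.2.1 p.2.2 = 0 := by
    rintro ⟨⟨i, j⟩, ⟨a, b⟩⟩
    let C := Localization.Away (s i * s j)
    have hu : IsUnit (algebraMap A C (s i) * algebraMap A C (s j)) := by
      rw [← map_mul]; exact IsLocalization.Away.algebraMap_isUnit _
    let f : Localization.Away (s i) →+* C := IsLocalization.Away.lift (s i)
      (isUnit_of_mul_isUnit_left hu)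
    let g : Localization.Away (s j) →+* C := IsLocalization.Away.lift (s j)
      (isUnit_of_mul_isUnit_right hu)
    have hf : f.comp (algebraMap A _) = algebraMap A C := IsLocalization.Away.lift_comp _ _
    have hg : g.comp (algebraMap A _) = algebraMap A C := IsLocalization.Away.lift_comp _ _
    have e1 : (F i).map (algebraMap A C) = algebraMap A C (s i ^ m i) • (E i).map f := by
      ext x y
      have := congrArg f (congr($(hF i) x y))
      rw [← hf]
      refine this.trans ?_
      simp
    have e2 : (F j).map (algebraMap A C) = algebraMap A C (s j ^ m j) • (E j).map g := by
      ext x y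
      have := congrArg g (congr($(hF j) x y))
      rw [← hg]
      refine this.trans ?_
      simp
    have e3 : (F i * F j - s j ^ m j • F i).map (algebraMap A C) = 0 := by
      have e4 : (s j ^ m j • F i).map (algebraMap A C) =
          algebraMap A C (s j ^ m j) • (F i).map (algebraMap A C) := by ext; simp
      rw [Matrix.map_sub _ (map_sub _), Matrix.map_mul, e4, e1, e2, Matrix.smul_mul,
        Matrix.mul_smul, hE i j C f g (hf.trans hg.symm), smul_comm, sub_self]
    obtain ⟨⟨_, c, rfl⟩, hc⟩ := (IsLocalization.map_eq_zero_iff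
      (Submonoid.powers (s i * s j)) C _).mp (congr($e3 a b))
    exact ⟨c, hc⟩
  choose c hc using h2
  obtain ⟨N, hN⟩ := Finite.exists_le c
  let F' : ι → Matrix (Fin n) (Fin n) A := fun i => s i ^ N • F i
  have hF' : ∀ i j, F' i * F' j = s j ^ (N + m j) • F' i := by
    intro i j
    have e1 : (s i * s j) ^ N • (F i * F j - s j ^ m j • F i) = 0 := by
      ext a b
      obtain ⟨d, hd⟩ := Nat.exists_eq_add_of_le (hN ((i, j), (a, b)))
      have := hc ((i, j), (a, b))
      change (s i * s j) ^ N * _ = 0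
      rw [hd, pow_add, mul_right_comm, this, zero_mul]
    rw [smul_sub, sub_eq_zero] at e1
    change (s i ^ N • F i) * (s j ^ N • F j) = s j ^ (N + m j) • s i ^ N • F i
    rw [Matrix.smul_mul, Matrix.mul_smul, smul_smul, ← mul_pow, e1, smul_smul, smul_smul]
    congr 1
    ring
  have hspan : Ideal.span (Set.range fun i => s i ^ (N + m i)) = ⊤ := by
    by_contra hne
    obtain ⟨M, hM, hle⟩ := Ideal.exists_le_maximal _ hne
    obtain ⟨i, hi⟩ := hs ⟨M, hM.isPrime⟩
    have := hM.isPrime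
    exact hi (this.mem_of_pow_mem _ (hle (Ideal.subset_span ⟨i, rfl⟩)))
  obtain ⟨b, hb⟩ := Ideal.mem_span_range_iff_exists_fun.mp
    (show (1 : A) ∈ Ideal.span (Set.range fun i => s i ^ (N + m i)) from hspan ▸ Submodule.mem_top)
  -- Locally `G` is the combination of the `E i` with coefficients `b i * s i ^ (N + m i)`, whose
  -- sum is 1. Projectors with a given kernel form an affine space, so `G` is again a projector with
  -- that kernel.
  let G := ∑ i, b i • F' i
  have hG1 : ∀ i, G * F' i = s i ^ (N + m i) • G := by
    intro i
    simp only [G, Finset.sum_mul, Finset.smul_sum, Matrix.smul_mul, hF']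
    exact Finset.sum_congr rfl fun j _ => smul_comm _ _ _
  have hG2 : ∀ i, F' i * G = F' i := by
    intro i
    simp only [G, Finset.mul_sum, Matrix.mul_smul, hF', smul_smul]
    rw [← Finset.sum_smul, hb, one_smul]
  refine ⟨G, ?_, fun i => ?_⟩
  · calc G * G = ∑ i, b i • (F' i * G) := by
          conv_lhs => enter [1]; simp only [G]
          simp only [Finset.sum_mul, Matrix.smul_mul]
      _ = G := by simp only [hG2]; rfl
  · set u := algebraMap A (Localization.Away (s i)) (s i ^ (N + m i))
    have hu : IsUnit u := by
      simp only [u, map_pow]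
      exact (IsLocalization.Away.algebraMap_isUnit _).pow _
    have e1 : (F' i).map (algebraMap A (Localization.Away (s i))) = u • E i := by
      have e2 : (F' i).map (algebraMap A (Localization.Away (s i))) =
          algebraMap A (Localization.Away (s i)) (s i ^ N) • (F i).map (algebraMap A (Localization.Away (s i))) := by
        ext; simp [F']
      rw [e2, hF, smul_smul, ← map_mul, ← pow_add]
    have e3 : (G.map (algebraMap A (Localization.Away (s i)))) * (u • E i) =
        u • G.map (algebraMap A (Localization.Away (s i))) := by
      rw [← e1, ← Matrix.map_mul, hG1]
      ext; simp [u]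
    have e4 : (u • E i) * (G.map (algebraMap A (Localization.Away (s i)))) = u • E i := by
      rw [← e1, ← Matrix.map_mul, hG2]
    rw [Matrix.mul_smul] at e3
    rw [Matrix.smul_mul] at e4
    have e5 := hu.smul_left_cancel.mp e3
    have e6 := hu.smul_left_cancel.mp e4
    refine le_antisymm (fun v hv => ?_) (fun v hv => ?_)
    · change E i *ᵥ v = 0
      rw [← e6, ← mulVec_mulVec, show G.map (algebraMap A (Localization.Away (s i))) *ᵥ v = 0 from hv, mulVec_zero]
    · change G.map (algebraMap A (Localization.Away (s i))) *ᵥ v = 0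
      rw [← e5, ← mulVec_mulVec, show E i *ᵥ v = 0 from hv, mulVec_zero]

end LocalSubmodules

/-! ### Points of the glued Grassmannian -/

section GrassPoints

open Matrix

variable {k : Type u} [Field k] {n r : ℕ} {A B : Type u} [CommRing A] [Algebra k A] [CommRing B]
  [Algebra k B]

lemma baseChangeSub_algHom_comp {C : Type u} [CommRing C] [Algebra k C] (f : A →ₐ[k] B)
    (g : B →ₐ[k] C) (N : Submodule A (Fin n → A)) :
    baseChangeSub g.toRingHom (baseChangeSub f.toRingHom N) =
      baseChangeSub (g.comp f).toRingHom N :=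
  baseChangeSub_comp _ _ _

/-- The localization homomorphism, as a homomorphism of `k`-algebras. -/
abbrev awayHom (k : Type u) [Field k] {A : Type u} [CommRing A] [Algebra k A] (s : A) :
    A →ₐ[k] Localization.Away s :=
  IsScalarTower.toAlgHom k A _

lemma awayHom_toRingHom (s : A) :
    (awayHom k s).toRingHom = algebraMap A (Localization.Away s) := rfl

lemma exists_awayHom_lift (f : A →ₐ[k] B) {s : A} (hu : IsUnit (f s)) :
    ∃ g : Localization.Away s →ₐ[k] B, g.comp (awayHom k s) = f := by
  refine ⟨IsLocalization.liftAlgHom (M := Submonoid.powers s) (f := f) (by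
    rintro ⟨_, m, rfl⟩
    rw [map_pow]
    exact hu.pow m), ?_⟩
  ext a
  simp

lemma exists_away_away (f : A →ₐ[k] B) (s : A) :
    ∃ g : Localization.Away s →ₐ[k] Localization.Away (f s),
      g.comp (awayHom k s) = (awayHom k (f s)).comp f :=
  exists_awayHom_lift _ (IsLocalization.Away.algebraMap_isUnit (f s))

lemma hom_ext_of_away {Y : Over (Spec (.of k))} {f g : specOver k A ⟶ Y}
    (h : ∀ q : PrimeSpectrum A, ∃ s ∉ q.asIdeal,
      specOverMap (awayHom k s) ≫ f = specOverMap (awayHom k s) ≫ g) : f = g := by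
  choose s hs hfg using h
  have hspan : Ideal.span (Set.range s) = ⊤ := by
    by_contra hne
    obtain ⟨M, hM, hle⟩ := Ideal.exists_le_maximal _ hne
    exact hs ⟨M, hM.isPrime⟩ (hle (Ideal.subset_span ⟨_, rfl⟩))
  ext1
  refine Scheme.Cover.hom_ext (Scheme.affineOpenCoverOfSpanRangeEqTop (R := .of A) s hspan).openCover
    _ _ fun q => ?_
  exact congrArg (fun f => Over.Hom.left f) (hfg q)

/-- Locally on `Spec A`, a point of the Grassmannian is in a chart. -/
lemma exists_away_chart (g : specOver k A ⟶ grass k n r) (q : PrimeSpectrum A) :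
    ∃ s ∉ q.asIdeal, ∃ (J : Fin r → Fin n)
      (a : specOver k (Localization.Away s) ⟶ specOver k (ChartRing k J)),
      specOverMap (awayHom k s) ≫ g = a ≫ grassι k J := by
  obtain ⟨J, hJ⟩ := exists_mem_chart (g.left q)
  let U : TopologicalSpace.Opens (PrimeSpectrum A) := g.left ⁻¹ᵁ (grassι k J).left.opensRange
  obtain ⟨_, ⟨_, ⟨s, rfl⟩, rfl⟩, hqs, hsub⟩ :=
    PrimeSpectrum.isBasis_basic_opens.exists_subset_of_mem_open (show q ∈ (U : Set _) from hJ) U.isOpen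
  have hr : Set.range (specOverMap (awayHom k s) ≫ g).left ⊆ Set.range (grassι k J).left := by
    rintro _ ⟨p, rfl⟩
    apply hsub
    have h1 : PrimeSpectrum.comap (algebraMap A (Localization.Away s)) p ∈
        Set.range (PrimeSpectrum.comap (algebraMap A (Localization.Away s))) := ⟨p, rfl⟩
    rw [PrimeSpectrum.localization_away_comap_range _ s] at h1
    exact h1
  refine ⟨s, hqs, J, Over.homMk (IsOpenImmersion.lift (grassι k J).left
    (specOverMap (awayHom k s) ≫ g).left hr) ?_, ?_⟩
  · rw [← Over.w (grassι k J), IsOpenImmersion.lift_fac_assoc, Over.w]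
  · ext1
    exact (IsOpenImmersion.lift_fac _ _ _).symm

/-- The relation between a point of the Grassmannian and a submodule. -/
structure IsPlane (g : specOver k A ⟶ grass k n r) (N : Submodule A (Fin n → A)) : Prop where
  isGrass : IsGrass N r
  away (q : PrimeSpectrum A) : ∃ s ∉ q.asIdeal, ∃ (J : Fin r → Fin n)
    (a : specOver k (Localization.Away s) ⟶ specOver k (ChartRing k J)),
      specOverMap (awayHom k s) ≫ g = a ≫ grassι k J ∧
      baseChangeSub (awayHom k s).toRingHom N = (chartRepresents k J).plane a

lemma IsPlane.comp {g : specOver k A ⟶ grass k n r} {N : Submodule A (Fin n → A)}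
    (h : IsPlane g N) (f : A →ₐ[k] B) :
    IsPlane (specOverMap f ≫ g) (baseChangeSub f.toRingHom N) := by
  refine ⟨h.isGrass.baseChangeSub _, fun q => ?_⟩
  obtain ⟨s, hs, J, a, h1, h2⟩ := h.away (PrimeSpectrum.comap f.toRingHom q)
  obtain ⟨f', hf'⟩ := exists_away_away f s
  refine ⟨f s, hs, J, specOverMap f' ≫ a, ?_, ?_⟩
  · rw [Category.assoc, ← h1, ← Category.assoc, ← Category.assoc, ← specOverMap_comp,
      ← specOverMap_comp, hf']
  · rw [Represents.plane_comp, ← h2, baseChangeSub_algHom_comp, baseChangeSub_algHom_comp, hf']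

/-- `IsPlane` supplies some covering by charts. The agreement then holds in every chart through
which a base change of `g` factors, which gives the uniqueness of the submodule. -/
lemma IsPlane.baseChangeSub_eq {g : specOver k A ⟶ grass k n r} {N : Submodule A (Fin n → A)}
    (h : IsPlane g N) (f : A →ₐ[k] B) {J : Fin r → Fin n}
    {a : specOver k B ⟶ specOver k (ChartRing k J)} (ha : specOverMap f ≫ g = a ≫ grassι k J) :
    baseChangeSub f.toRingHom N = (chartRepresents k J).plane a := by
  refine (h.comp f).isGrass.eq_of_away ((chartRepresents k J).prop a).isGrass fun q => ?_
  obtain ⟨s, hs, K, b, h1, h2⟩ := (h.comp f).away q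
  refine ⟨s, hs, ?_⟩
  rw [← awayHom_toRingHom (k := k), h2, ← Represents.plane_comp, ← comp_grassι_eq_iff, ← h1, ha,
    Category.assoc]

lemma IsPlane.unique {g : specOver k A ⟶ grass k n r} {N N' : Submodule A (Fin n → A)}
    (h : IsPlane g N) (h' : IsPlane g N') : N = N' := by
  refine h.isGrass.eq_of_away h'.isGrass fun q => ?_
  obtain ⟨s, hs, J, a, h1, h2⟩ := h.away q
  refine ⟨s, hs, ?_⟩
  rw [← awayHom_toRingHom (k := k), h2, h'.baseChangeSub_eq _ h1]

lemma IsPlane.hom_unique {g g' : specOver k A ⟶ grass k n r} {N : Submodule A (Fin n → A)}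
    (h : IsPlane g N) (h' : IsPlane g' N) : g = g' := by
  refine hom_ext_of_away fun q => ?_
  obtain ⟨s, hs, J, a, h1, h2⟩ := h.away q
  obtain ⟨s', hs', J', a', h1', h2'⟩ := h'.away q
  have hu : IsUnit (awayHom k (s * s') s * awayHom k (s * s') s') := by
    rw [← map_mul]; exact IsLocalization.Away.algebraMap_isUnit _
  obtain ⟨f, hf⟩ := exists_awayHom_lift (awayHom k (s * s')) (isUnit_of_mul_isUnit_left hu)
  obtain ⟨f', hf'⟩ := exists_awayHom_lift (awayHom k (s * s')) (isUnit_of_mul_isUnit_right hu)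
  refine ⟨s * s', q.2.mul_notMem hs hs', ?_⟩
  conv_lhs => rw [← hf, specOverMap_comp, Category.assoc, h1, ← Category.assoc]
  conv_rhs => rw [← hf', specOverMap_comp, Category.assoc, h1', ← Category.assoc]
  rw [comp_grassι_eq_iff, Represents.plane_comp, Represents.plane_comp, ← h2, ← h2',
    baseChangeSub_algHom_comp, baseChangeSub_algHom_comp, hf, hf']

/-- Finitely many localizations of `A` carry the point into charts. The submodules read off there
agree on overlaps because they come from the same `g`, and the idempotents that define them glue. -/
lemma exists_isPlane (g : specOver k A ⟶ grass k n r) : ∃ N, IsPlane g N := by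
  choose s hs J a ha using exists_away_chart g
  have hspan : Ideal.span (Set.range s) = ⊤ := by
    by_contra hne
    obtain ⟨M, hM, hle⟩ := Ideal.exists_le_maximal _ hne
    exact hs ⟨M, hM.isPrime⟩ (hle (Ideal.subset_span ⟨_, rfl⟩))
  obtain ⟨T, hT, hTspan⟩ := (Ideal.span_eq_top_iff_finite _).mp hspan
  choose p hp using fun t : T => hT t.2
  have hcov : ∀ q : PrimeSpectrum A, ∃ t : T, s (p t) ∉ q.asIdeal := by
    intro q
    by_contra! hq
    apply q.2.ne_top
    rw [← top_le_iff, ← hTspan, Ideal.span_le]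
    intro t ht
    have := hq ⟨t, ht⟩
    rwa [hp] at this
  choose E hE hker hrank using fun t : T =>
    ((chartRepresents k (J (p t))).prop (a (p t))).isGrass.exists_idempotent
  obtain ⟨F, hF, hFE⟩ := exists_glued_idempotent (s := fun t => s (p t)) hcov E (by
    intro i j C _ f g hfg
    -- `C` is a bare ring. It receives its `k`-structure through `f`, and `hfg` makes `g` linear for
    -- it.
    algebraize [f.comp (algebraMap k _)]
    let f' : Localization.Away (s (p i)) →ₐ[k] C := ⟨f, fun _ => rfl⟩
    have hg' : ∀ x : k, g (algebraMap k _ x) = algebraMap k C x := fun x => by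
      have h1 := congr($hfg (algebraMap k A x))
      simp only [RingHom.comp_apply, ← IsScalarTower.algebraMap_apply] at h1
      exact h1.symm
    let g' : Localization.Away (s (p j)) →ₐ[k] C := ⟨g, hg'⟩
    have hfg' : f'.comp (awayHom k (s (p i))) = g'.comp (awayHom k (s (p j))) :=
      AlgHom.coe_ringHom_injective hfg
    have h1 : specOverMap f' ≫ a (p i) ≫ grassι k (J (p i)) =
        specOverMap g' ≫ a (p j) ≫ grassι k (J (p j)) := by
      rw [← ha, ← ha, ← Category.assoc, ← Category.assoc, ← specOverMap_comp, ← specOverMap_comp,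
        hfg']
    rw [← Category.assoc, ← Category.assoc, comp_grassι_eq_iff, Represents.plane_comp,
      Represents.plane_comp, ← hker, ← hker, baseChangeSub_ker _ (mul_self_mul_self (hE i)),
      baseChangeSub_ker _ (mul_self_mul_self (hE j))] at h1
    have h2 : (E j).map g * (E j).map g = (E j).map g := by rw [← Matrix.map_mul, hE]
    exact mul_eq_of_ker_le h2 h1.ge)
  refine ⟨LinearMap.ker F.mulVecLin, isGrass_ker_of_idempotent hF fun q => ?_, fun q => ?_⟩
  · obtain ⟨t, ht⟩ := hcov q
    have h1 : q ∈ Set.range (PrimeSpectrum.comap (algebraMap A (Localization.Away (s (p t))))) := by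
      rw [PrimeSpectrum.localization_away_comap_range _ (s (p t))]
      exact ht
    obtain ⟨q', rfl⟩ := h1
    rw [← rankAt_map]
    refine rankAt_of_isGrass (by rw [← Matrix.map_mul, hF]) ?_ q'
    rw [hFE, hker]
    exact ((chartRepresents k (J (p t))).prop (a (p t))).isGrass
  · obtain ⟨t, ht⟩ := hcov q
    refine ⟨s (p t), ht, J (p t), a (p t), ha _, ?_⟩
    rw [awayHom_toRingHom, baseChangeSub_ker _ (mul_self_mul_self hF), hFE, hker]

/-- Charts of `N` on a cover of `Spec A` give local morphisms. On overlaps they agree on points,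
since both sides carry the base change of the same `N`, and therefore they glue. -/
lemma exists_hom_isPlane {N : Submodule A (Fin n → A)} (hN : IsGrass N r) :
    ∃ g : specOver k A ⟶ grass k n r, IsPlane g N := by
  choose s hs J Φ hΦ hker using hN.exists_chart
  have hspan : Ideal.span (Set.range s) = ⊤ := by
    by_contra hne
    obtain ⟨M, hM, hle⟩ := Ideal.exists_le_maximal _ hne
    exact hs ⟨M, hM.isPrime⟩ (hle (Ideal.subset_span ⟨_, rfl⟩))
  choose a ha using fun q => (chartRepresents k (J q)).exists_plane ⟨Φ q, hΦ q, rfl⟩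
  have hNa : ∀ q, baseChangeSub (awayHom k (s q)).toRingHom N = (chartRepresents k (J q)).plane (a q) :=
    fun q => (hker q).trans (ha q).symm
  let 𝒰 := (Scheme.affineOpenCoverOfSpanRangeEqTop (R := .of A) s hspan).openCover
  have hcompat : ∀ q q' : PrimeSpectrum A,
      pullback.fst (specOverMap (awayHom k (s q))).left (specOverMap (awayHom k (s q'))).left ≫
        (a q ≫ grassι k (J q)).left =
      pullback.snd (specOverMap (awayHom k (s q))).left (specOverMap (awayHom k (s q'))).left ≫
        (a q' ≫ grassι k (J q')).left := by
    intro q q'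
    let P : Over (Spec (.of k)) := Over.mk (pullback.fst (specOverMap (awayHom k (s q))).left
      (specOverMap (awayHom k (s q'))).left ≫ (specOver k (Localization.Away (s q))).hom)
    let p₁ : P ⟶ specOver k (Localization.Away (s q)) := Over.homMk (pullback.fst _ _)
    let p₂ : P ⟶ specOver k (Localization.Away (s q')) := Over.homMk (pullback.snd _ _) (by
      change _ = pullback.fst _ _ ≫ _
      rw [← Over.w (specOverMap (awayHom k (s q))), ← Over.w (specOverMap (awayHom k (s q'))),
        pullback.condition_assoc])
    have hp : p₁ ≫ specOverMap (awayHom k (s q)) = p₂ ≫ specOverMap (awayHom k (s q')) := by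
      ext1
      exact pullback.condition
    refine congrArg (fun f => Over.Hom.left f)
      (?_ : p₁ ≫ a q ≫ grassι k (J q) = p₂ ≫ a q' ≫ grassι k (J q'))
    refine hom_ext_of_points fun C _ _ x => ?_
    obtain ⟨f₁, hf₁⟩ := exists_specOverMap (x ≫ p₁)
    obtain ⟨f₂, hf₂⟩ := exists_specOverMap (x ≫ p₂)
    have hf : f₁.comp (awayHom k (s q)) = f₂.comp (awayHom k (s q')) := by
      apply specOverMap_injective
      rw [specOverMap_comp, specOverMap_comp, ← hf₁, ← hf₂, Category.assoc, hp, Category.assoc]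
    rw [← Category.assoc, ← Category.assoc x, hf₁, hf₂, ← Category.assoc, ← Category.assoc,
      comp_grassι_eq_iff, Represents.plane_comp, Represents.plane_comp, ← hNa, ← hNa,
      baseChangeSub_algHom_comp, baseChangeSub_algHom_comp, hf]
  let g₀ : (specOver k A).left ⟶ (grass k n r).left :=
    𝒰.glueMorphisms (fun q => (a q ≫ grassι k (J q)).left) hcompat
  have hg₀ : ∀ q, (specOverMap (awayHom k (s q))).left ≫ g₀ = (a q ≫ grassι k (J q)).left :=
    fun q => 𝒰.ι_glueMorphisms (fun q => (a q ≫ grassι k (J q)).left) hcompat q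
  have hg₁ : g₀ ≫ (grass k n r).hom = (specOver k A).hom := by
    refine Scheme.Cover.hom_ext 𝒰 _ _ fun q => ?_
    have h1 := congrArg (· ≫ (grass k n r).hom) (hg₀ q)
    simp only [Category.assoc] at h1
    exact h1.trans ((Over.w (a q ≫ grassι k (J q))).trans
      (Over.w (specOverMap (awayHom k (s q)))).symm)
  refine ⟨Over.homMk g₀ hg₁, hN, fun q => ⟨s q, hs q, J q, a q, ?_, hNa q⟩⟩
  ext1
  exact hg₀ q

end GrassPoints

/-! ### Existence of the Grassmannian -/

section GrassData

variable (k : Type u) [Field k] (m n : ℕ)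

/-- The scheme `grass k n (n - m)` is the Grassmannian of `m`-planes in `k ^ n`. -/
lemma nonempty_grassmannianData : Nonempty (GrassmannianData m n (grass k n (n - m))) := by
  have h1 : ∀ (A : Type u) [CommRing A] [Algebra k A] (g : specOver k A ⟶ grass k n (n - m)),
      ∃ N : Module.Grassmannian A (A ⊗[k] (Fin n → k)) (n - m), IsPlane g (planeOf N) := by
    intro A _ _ g
    obtain ⟨N, hN⟩ := exists_isPlane g
    obtain ⟨N', rfl⟩ := exists_planeOf (k := k) hN.isGrass
    exact ⟨N', hN⟩
  have h2 : ∀ (A : Type u) [CommRing A] [Algebra k A]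
      (N : Module.Grassmannian A (A ⊗[k] (Fin n → k)) (n - m)),
      ∃ g : specOver k A ⟶ grass k n (n - m), IsPlane g (planeOf N) :=
    fun A _ _ N => exists_hom_isPlane (isGrass_planeOf N)
  exact ⟨{
    pointEquiv := fun A _ _ =>
      { toFun := fun g => (h1 A g).choose
        invFun := fun N => (h2 A N).choose
        left_inv := fun g => (h2 A _).choose_spec.hom_unique (h1 A g).choose_spec
        right_inv := fun N => planeOf_injective ((h1 A _).choose_spec.unique (h2 A N).choose_spec) }
    pointEquiv_comp := fun f x => planeOf_injective (by
      rw [planeOf_map]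
      exact (h1 _ _).choose_spec.unique ((h1 _ x).choose_spec.comp f)) }⟩

end GrassData

/-! ### Classes of affine varieties -/

section Classes

variable {k : Type u} [Field k]

lemma K0Var.mk_eq_of_iso {X Y : Var k} (e : X.obj ≅ Y.obj) : K0Var.mk X = K0Var.mk Y := by
  have e' : X ≅ Y := (IsVariety k).fullyFaithfulι.preimageIso e
  rw [K0Var.mk, K0Var.mk, congr_toSkeleton_of_iso e']

lemma K0Var.mk_tensor (X Y : Var k) : K0Var.mk (X ⊗ Y) = K0Var.mk X * K0Var.mk Y := by
  refine Eq.trans (congrArg (Ideal.Quotient.mk (Ideal.span (scissorRelations k))) ?_) (map_mul _ _ _)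
  exact (congrArg FreeAbelianGroup.of (Skeleton.toSkeleton_tensorObj X Y)).trans
    (FreeAbelianGroup.of_mul _ _)

lemma K0Var.mk_unit : K0Var.mk (𝟙_ (Var k)) = 1 := rfl

variable (k) in
/-- The class of the spectrum of an algebra of finite type. -/
def algClass (R : Type u) [CommRing R] [Algebra k R] [Algebra.FiniteType k R] : K0Var k :=
  K0Var.mk ⟨specOver k R, isVariety_specOver R⟩

variable {R S : Type u} [CommRing R] [Algebra k R] [Algebra.FiniteType k R] [CommRing S]
  [Algebra k S] [Algebra.FiniteType k S]

lemma algClass_congr (e : R ≃ₐ[k] S) : algClass k R = algClass k S := by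
  refine K0Var.mk_eq_of_iso ⟨specOverMap e.symm.toAlgHom, specOverMap e.toAlgHom, ?_, ?_⟩
  · rw [← specOverMap_comp, ← specOverMap_id]
    congr 1; ext; simp
  · rw [← specOverMap_comp, ← specOverMap_id]
    congr 1; ext; simp

lemma algClass_self : algClass k k = 1 := by
  rw [← K0Var.mk_unit]
  refine K0Var.mk_eq_of_iso (Over.isoMk (Iso.refl _) ?_)
  change 𝟙 _ ≫ 𝟙 (Spec (.of k)) = Spec.map (𝟙 _)
  rw [Spec.map_id]
  exact Category.comp_id _

instance finiteType_tensor : Algebra.FiniteType k (R ⊗[k] S) :=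
  .trans (S := R) inferInstance inferInstance

lemma algClass_tensor : algClass k (R ⊗[k] S) = algClass k R * algClass k S := by
  refine Eq.trans ?_ (K0Var.mk_tensor _ _)
  let iR : R →ₐ[k] R ⊗[k] S := Algebra.TensorProduct.includeLeft
  let iS : S →ₐ[k] R ⊗[k] S := Algebra.TensorProduct.includeRight
  refine K0Var.mk_eq_of_iso (X := ⟨specOver k (R ⊗[k] S), _⟩)
    (Nonempty.some (?_ : Nonempty (specOver k (R ⊗[k] S) ≅ specOver k R ⊗ specOver k S)))
  obtain ⟨φ, -⟩ := exists_iso_of_rel (X := specOver k (R ⊗[k] S)) (Y := specOver k R ⊗ specOver k S)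
    (fun A _ _ x y => y ≫ CartesianMonoidalCategory.fst _ _ = x ≫ specOverMap iR ∧
      y ≫ CartesianMonoidalCategory.snd _ _ = x ≫ specOverMap iS)
    (fun f x y h => by simp only [Category.assoc, h, and_self])
    (fun A _ _ x => ⟨CartesianMonoidalCategory.lift (x ≫ specOverMap iR) (x ≫ specOverMap iS),
      by simp, fun y hy => CartesianMonoidalCategory.hom_ext _ _ (by simp [hy.1]) (by simp [hy.2])⟩)
    (fun A _ _ y => by
      obtain ⟨f, hf⟩ := exists_specOverMap (y ≫ CartesianMonoidalCategory.fst _ _)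
      obtain ⟨g, hg⟩ := exists_specOverMap (y ≫ CartesianMonoidalCategory.snd _ _)
      refine ⟨specOverMap (Algebra.TensorProduct.lift f g fun _ _ => Commute.all _ _), ?_, ?_⟩
      · beta_reduce
        rw [hf, hg, ← specOverMap_comp, ← specOverMap_comp]
        constructor
        · congr 1; ext; simp [iR]
        · congr 1; ext; simp [iS]
      · rintro x ⟨h1, h2⟩
        obtain ⟨h, rfl⟩ := exists_specOverMap x
        rw [hf, ← specOverMap_comp] at h1
        rw [hg, ← specOverMap_comp] at h2
        rw [specOverMap_injective h1, specOverMap_injective h2]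
        congr 1
        apply Algebra.TensorProduct.ext <;> ext <;> simp [iR, iS])
  exact ⟨φ⟩

/-- The one instance of the defining relations from which all classes below are computed: a
principal open subset and its closed complement. -/
lemma algClass_scissor (a : R) :
    algClass k R = algClass k (Localization.Away a) + algClass k (R ⧸ Ideal.span {a}) := by
  have h : FreeAbelianGroup.of (toSkeleton (⟨specOver k R, isVariety_specOver R⟩ : Var k)) -
      (FreeAbelianGroup.of (toSkeleton
        (⟨specOver k (Localization.Away a), isVariety_specOver _⟩ : Var k)) +
      FreeAbelianGroup.of (toSkeleton
        (⟨specOver k (R ⧸ Ideal.span {a}), isVariety_specOver _⟩ : Var k))) ∈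
      scissorRelations k := by
    refine ⟨_, _, _, ⟨specOverMap (Ideal.Quotient.mkₐ k (Ideal.span {a}))⟩,
      ⟨specOverMap (awayHom k a)⟩, ?_, ?_, ?_, rfl⟩
    · exact IsClosedImmersion.spec_of_surjective (CommRingCat.ofHom
        (Ideal.Quotient.mkₐ k (Ideal.span {a})).toRingHom) Ideal.Quotient.mk_surjective
    · exact inferInstanceAs (IsOpenImmersion (Spec.map (CommRingCat.ofHom
        (algebraMap R (Localization.Away a)))))
    · change Set.range (PrimeSpectrum.comap (algebraMap R (Localization.Away a))) =
        (Set.range (PrimeSpectrum.comap (Ideal.Quotient.mk (Ideal.span {a}))))ᶜ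
      rw [PrimeSpectrum.localization_away_comap_range _ a,
        range_comap_of_surjective _ _ Ideal.Quotient.mk_surjective, Ideal.mk_ker,
        PrimeSpectrum.zeroLocus_span, PrimeSpectrum.basicOpen_eq_zeroLocus_compl]
  have h1 := Ideal.Quotient.eq_zero_iff_mem.mpr (Ideal.subset_span (α := _) h)
  rw [map_sub, map_add, sub_eq_zero] at h1
  exact h1

/-- Cutting the empty scheme along `0` gives two empty pieces, so its class satisfies `c = c + c`.
-/
lemma algClass_of_subsingleton [Subsingleton R] : algClass k R = 0 := by
  have h := algClass_scissor (k := k) (0 : R)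
  have : Subsingleton (Localization.Away (0 : R)) :=
    IsLocalization.subsingleton (M := Submonoid.powers (0 : R)) ⟨1, Subsingleton.elim _ _⟩
  have : Subsingleton (R ⧸ Ideal.span {(0 : R)}) :=
    (Ideal.Quotient.mk_surjective (I := Ideal.span {(0 : R)})).subsingleton
  rw [algClass_congr (AlgEquiv.ofBijective (Ideal.Quotient.mkₐ k (Ideal.span {(0 : R)}))
      ⟨fun _ _ _ => Subsingleton.elim _ _, Ideal.Quotient.mk_surjective⟩),
    algClass_congr (AlgEquiv.ofBijective (awayHom k (0 : R))
      ⟨fun _ _ _ => Subsingleton.elim _ _, fun x => ⟨0, Subsingleton.elim _ _⟩⟩).symm] at h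
  have h2 := algClass_congr (AlgEquiv.ofBijective (Ideal.Quotient.mkₐ k (Ideal.span {(0 : R)}))
      ⟨fun _ _ _ => Subsingleton.elim _ _, Ideal.Quotient.mk_surjective⟩)
  rw [← h2] at h
  simpa using h

end Classes

/-! ### Classes of functors represented by affine varieties -/

section Functors

variable {k : Type u} [Field k]

/-- A functor from the category of `k`-algebras to the category of sets. -/
structure AlgFunctor (k : Type u) [Field k] where
  obj (A : Type u) [CommRing A] [Algebra k A] : Type u
  map {A B : Type u} [CommRing A] [Algebra k A] [CommRing B] [Algebra k B] :
    (A →ₐ[k] B) → obj A → obj B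
  map_id {A : Type u} [CommRing A] [Algebra k A] (x : obj A) : map (AlgHom.id k A) x = x
  map_comp {A B C : Type u} [CommRing A] [Algebra k A] [CommRing B] [Algebra k B] [CommRing C]
    [Algebra k C] (f : A →ₐ[k] B) (g : B →ₐ[k] C) (x : obj A) :
    map (g.comp f) x = map g (map f x)

namespace AlgFunctor

variable (F G : AlgFunctor k)

/-- A subfunctor. -/
abbrev sub (P : ∀ (A : Type u) [CommRing A] [Algebra k A], F.obj A → Prop)
    (hP : ∀ {A B : Type u} [CommRing A] [Algebra k A] [CommRing B] [Algebra k B] (f : A →ₐ[k] B)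
      (x : F.obj A), P A x → P B (F.map f x)) : AlgFunctor k where
  obj A _ _ := {x : F.obj A // P A x}
  map f x := ⟨F.map f x.1, hP f x.1 x.2⟩
  map_id _ := Subtype.ext (F.map_id _)
  map_comp _ _ _ := Subtype.ext (F.map_comp _ _ _)

/-- The product of two functors. -/
abbrev prod : AlgFunctor k where
  obj A _ _ := F.obj A × G.obj A
  map f x := (F.map f x.1, G.map f x.2)
  map_id _ := Prod.ext (F.map_id _) (G.map_id _)
  map_comp _ _ _ := Prod.ext (F.map_comp _ _ _) (G.map_comp _ _ _)

/-- Affine space. -/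
abbrev aff (k : Type u) [Field k] (ι : Type) : AlgFunctor k where
  obj A _ _ := ι → A
  map f x := fun i => f (x i)
  map_id _ := rfl
  map_comp _ _ _ := rfl

/-- An element `x` of `F(R)` is universal if it identifies `F` with `Hom(R, -)`. -/
def IsUniversal {R : Type u} [CommRing R] [Algebra k R] (x : F.obj R) : Prop :=
  ∀ (A : Type u) [CommRing A] [Algebra k A],
    Function.Bijective fun f : R →ₐ[k] A => F.map f x

/-- A functor is represented by an affine variety with the class `c`. -/
def HasClass (c : K0Var k) : Prop :=
  ∃ (R : Type u) (_ : CommRing R) (_ : Algebra k R) (_ : Algebra.FiniteType k R) (x : F.obj R),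
    F.IsUniversal x ∧ algClass k R = c

variable {F G}

lemma IsUniversal.nonempty_algEquiv {R S : Type u} [CommRing R] [Algebra k R] [CommRing S]
    [Algebra k S] {x : F.obj R} {y : F.obj S} (hx : F.IsUniversal x) (hy : F.IsUniversal y) :
    Nonempty (R ≃ₐ[k] S) := by
  obtain ⟨f, hf⟩ := (hx S).2 y
  obtain ⟨g, hg⟩ := (hy R).2 x
  replace hf : F.map f x = y := hf
  replace hg : F.map g y = x := hg
  refine ⟨AlgEquiv.ofAlgHom f g ((hy S).1 ?_) ((hx R).1 ?_)⟩
  · change F.map _ y = F.map _ y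
    rw [F.map_comp, hg, hf, F.map_id]
  · change F.map _ x = F.map _ x
    rw [F.map_comp, hf, hg, F.map_id]

/-- Representing algebras are unique up to isomorphism. The class may thus be computed from any
description of the functor. -/
lemma HasClass.unique {c d : K0Var k} (hc : F.HasClass c) (hd : F.HasClass d) : c = d := by
  obtain ⟨R, _, _, _, x, hx, rfl⟩ := hc
  obtain ⟨S, _, _, _, y, hy, rfl⟩ := hd
  obtain ⟨e⟩ := hx.nonempty_algEquiv hy
  exact algClass_congr e

lemma HasClass.congr {c : K0Var k} (hF : F.HasClass c)
    (e : ∀ (A : Type u) [CommRing A] [Algebra k A], F.obj A ≃ G.obj A)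
    (he : ∀ {A B : Type u} [CommRing A] [Algebra k A] [CommRing B] [Algebra k B] (f : A →ₐ[k] B)
      (x : F.obj A), e B (F.map f x) = G.map f (e A x)) : G.HasClass c := by
  obtain ⟨R, _, _, _, x, hx, rfl⟩ := hF
  refine ⟨R, inferInstance, inferInstance, inferInstance, e R x, fun A _ _ => ?_, rfl⟩
  simp only [← he]
  exact (e A).bijective.comp (hx A)

lemma HasClass.prod {c d : K0Var k} (hF : F.HasClass c) (hG : G.HasClass d) :
    (F.prod G).HasClass (c * d) := by
  obtain ⟨R, _, _, _, x, hx, rfl⟩ := hF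
  obtain ⟨S, _, _, _, y, hy, rfl⟩ := hG
  refine ⟨R ⊗[k] S, inferInstance, inferInstance, inferInstance,
    (F.map Algebra.TensorProduct.includeLeft x, G.map Algebra.TensorProduct.includeRight y), ?_,
    algClass_tensor⟩
  intro A _ _
  constructor
  · intro f g hfg
    have h1 := congrArg Prod.fst hfg
    have h2 := congrArg Prod.snd hfg
    change F.map f (F.map _ x) = F.map g (F.map _ x) at h1
    change G.map f (G.map _ y) = G.map g (G.map _ y) at h2
    rw [← F.map_comp, ← F.map_comp] at h1
    rw [← G.map_comp, ← G.map_comp] at h2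
    exact Algebra.TensorProduct.ext ((hx A).1 h1) ((hy A).1 h2)
  · rintro ⟨a, b⟩
    obtain ⟨f, rfl⟩ := (hx A).2 a
    obtain ⟨g, rfl⟩ := (hy A).2 b
    refine ⟨Algebra.TensorProduct.lift f g fun _ _ => Commute.all _ _, ?_⟩
    change (F.map _ (F.map _ x), G.map _ (G.map _ y)) = _
    have h1 : (Algebra.TensorProduct.lift f g fun _ _ => Commute.all _ _).comp
        Algebra.TensorProduct.includeLeft = f := by ext; simp
    have h2 : (Algebra.TensorProduct.lift f g fun _ _ => Commute.all _ _).comp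
        Algebra.TensorProduct.includeRight = g := by ext; simp
    rw [← F.map_comp, ← G.map_comp, h1, h2]

section Loci

variable (a : ∀ (A : Type u) [CommRing A] [Algebra k A], F.obj A → A)
  (ha : ∀ {A B : Type u} [CommRing A] [Algebra k A] [CommRing B] [Algebra k B] (f : A →ₐ[k] B)
    (x : F.obj A), a B (F.map f x) = f (a A x))

variable (F) in
/-- The locus where a function is invertible. -/
abbrev unitLocus : AlgFunctor k :=
  F.sub (fun A _ _ x => IsUnit (a A x)) fun f x h => by rw [ha]; exact h.map f

variable (F) in
/-- The locus where all functions of a family vanish. -/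
abbrev zeroLocus {ι : Type} (a : ι → ∀ (A : Type u) [CommRing A] [Algebra k A], F.obj A → A)
    (ha : ∀ i {A B : Type u} [CommRing A] [Algebra k A] [CommRing B] [Algebra k B] (f : A →ₐ[k] B)
      (x : F.obj A), a i B (F.map f x) = f (a i A x)) : AlgFunctor k :=
  F.sub (fun A _ _ x => ∀ i, a i A x = 0) fun f x h i => by rw [ha, h, map_zero]

variable {R : Type u} [CommRing R] [Algebra k R] {x : F.obj R}

lemma IsUniversal.unitLocus (hx : F.IsUniversal x) :
    (F.unitLocus a ha).IsUniversal (R := Localization.Away (a R x))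
      ⟨F.map (awayHom k (a R x)) x, by
        beta_reduce; rw [ha]; exact IsLocalization.Away.algebraMap_isUnit (a R x)⟩ := by
  intro A _ _
  constructor
  · intro f g hfg
    have h1 : F.map f (F.map _ x) = F.map g (F.map _ x) := congrArg Subtype.val hfg
    rw [← F.map_comp, ← F.map_comp] at h1
    have h2 := (hx A).1 h1
    apply AlgHom.coe_ringHom_injective
    apply IsLocalization.ringHom_ext (Submonoid.powers (a R x))
    exact congrArg (fun f : R →ₐ[k] A => f.toRingHom) h2
  · rintro ⟨y, hy⟩
    obtain ⟨f, rfl⟩ := (hx A).2 y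
    obtain ⟨g, rfl⟩ := exists_awayHom_lift f (s := a R x) (by rwa [← ha])
    exact ⟨g, Subtype.ext (F.map_comp _ _ _).symm⟩

lemma IsUniversal.zeroLocus {ι : Type}
    {a : ι → ∀ (A : Type u) [CommRing A] [Algebra k A], F.obj A → A}
    (ha : ∀ i {A B : Type u} [CommRing A] [Algebra k A] [CommRing B] [Algebra k B] (f : A →ₐ[k] B)
      (x : F.obj A), a i B (F.map f x) = f (a i A x)) (hx : F.IsUniversal x) :
    (F.zeroLocus a ha).IsUniversal (R := R ⧸ Ideal.span (Set.range fun i => a i R x))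
      ⟨F.map (Ideal.Quotient.mkₐ k _) x, fun i => by
        rw [ha]; exact Ideal.Quotient.eq_zero_iff_mem.mpr (Ideal.subset_span ⟨i, rfl⟩)⟩ := by
  intro A _ _
  constructor
  · intro f g hfg
    have h1 : F.map f (F.map _ x) = F.map g (F.map _ x) := congrArg Subtype.val hfg
    rw [← F.map_comp, ← F.map_comp] at h1
    exact Ideal.Quotient.algHom_ext _ ((hx A).1 h1)
  · rintro ⟨y, hy⟩
    obtain ⟨f, rfl⟩ := (hx A).2 y
    have h2 : ∀ r ∈ Ideal.span (Set.range fun i => a i R x), f r = 0 := by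
      intro r hr
      have : Ideal.span (Set.range fun i => a i R x) ≤ RingHom.ker f := by
        rw [Ideal.span_le]
        rintro _ ⟨i, rfl⟩
        exact (ha i f x).symm.trans (hy i)
      exact this hr
    refine ⟨Ideal.Quotient.liftₐ _ f h2, Subtype.ext ((F.map_comp _ _ _).symm.trans ?_)⟩
    rw [Ideal.Quotient.liftₐ_comp]

lemma HasClass.exists_unitLocus {c : K0Var k} (h : F.HasClass c) :
    ∃ d, (F.unitLocus a ha).HasClass d := by
  obtain ⟨R, _, _, _, x, hx, rfl⟩ := h
  exact ⟨algClass k (Localization.Away (a R x)), _, _, _, inferInstance, _, hx.unitLocus a ha, rfl⟩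

lemma HasClass.exists_zeroLocus {ι : Type}
    {a : ι → ∀ (A : Type u) [CommRing A] [Algebra k A], F.obj A → A}
    (ha : ∀ i {A B : Type u} [CommRing A] [Algebra k A] [CommRing B] [Algebra k B] (f : A →ₐ[k] B)
      (x : F.obj A), a i B (F.map f x) = f (a i A x)) {c : K0Var k} (h : F.HasClass c) :
    ∃ d, (F.zeroLocus a ha).HasClass d := by
  obtain ⟨R, _, _, _, x, hx, rfl⟩ := h
  exact ⟨algClass k (R ⧸ Ideal.span (Set.range fun i => a i R x)), _, _, _, inferInstance, _,
    hx.zeroLocus ha, rfl⟩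

/-- The scissor relation. -/
lemma HasClass.eq_add {c d e : K0Var k} (hc : F.HasClass c) (hd : (F.unitLocus a ha).HasClass d)
    (he : (F.zeroLocus (fun _ : Unit => a) fun _ => ha).HasClass e) : c = d + e := by
  obtain ⟨R, _, _, _, x, hx, rfl⟩ := hc
  have hs : (Set.range fun _ : Unit => a R x) = {a R x} := by ext; simp
  have h1 : d = algClass k (Localization.Away (a R x)) :=
    hd.unique ⟨_, _, _, inferInstance, _, hx.unitLocus a ha, rfl⟩
  have h2 : e = algClass k (R ⧸ Ideal.span (Set.range fun _ : Unit => a R x)) :=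
    he.unique ⟨_, _, _, inferInstance, _, hx.zeroLocus (fun _ => ha), rfl⟩
  have h3 : algClass k (R ⧸ Ideal.span (Set.range fun _ : Unit => a R x)) =
      algClass k (R ⧸ Ideal.span {a R x}) :=
    algClass_congr (Ideal.quotientEquivAlgOfEq k (by rw [hs]))
  rw [h1, h2, h3, ← algClass_scissor]

end Loci

lemma HasClass.of_isEmpty {c : K0Var k} (h : F.HasClass c)
    (hF : ∀ (A : Type u) [CommRing A] [Algebra k A], F.obj A → Subsingleton A) : c = 0 := by
  obtain ⟨R, _, _, _, x, hx, rfl⟩ := h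
  have := hF R x
  exact algClass_of_subsingleton

lemma hasClass_aff_unit : (aff k Unit).HasClass (lefschetz k) := by
  refine ⟨k[X], inferInstance, inferInstance, inferInstance, fun _ => Polynomial.X, fun A _ _ => ?_,
    rfl⟩
  constructor
  · intro f g h
    exact Polynomial.algHom_ext (congrFun h ())
  · intro y
    exact ⟨Polynomial.aeval (y ()), funext fun _ => Polynomial.aeval_X _⟩

lemma hasClass_aff_fin (n : ℕ) : (aff k (Fin n)).HasClass (lefschetz k ^ n) := by
  induction n with
  | zero =>
    refine ⟨k, inferInstance, inferInstance, inferInstance, fun i => i.elim0, fun A _ _ => ?_, ?_⟩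
    · exact ⟨fun f g _ => Subsingleton.elim _ _, fun y => ⟨Algebra.ofId k A, funext fun i => i.elim0⟩⟩
    · rw [algClass_self, pow_zero]
  | succ n ih =>
    rw [pow_succ']
    refine (hasClass_aff_unit.prod ih).congr
      (fun A _ _ => ((Equiv.funUnique Unit A).prodCongr (Equiv.refl _)).trans
        (Fin.consEquiv fun _ => A)) ?_
    intro A B _ _ _ _ f x
    funext i
    refine Fin.cases ?_ (fun i => ?_) i <;> rfl

lemma hasClass_aff (ι : Type) [Fintype ι] :
    (aff k ι).HasClass (lefschetz k ^ Fintype.card ι) :=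
  (hasClass_aff_fin (Fintype.card ι)).congr
    (fun A _ _ => (Fintype.equivFin ι).symm.arrowCongr (Equiv.refl A)) fun _ _ => rfl

variable (k) in
/-- The multiplicative group. -/
abbrev gm : AlgFunctor k := (aff k Unit).unitLocus (fun _ _ _ (x : Unit → _) => x ()) fun _ _ => rfl

lemma hasClass_gm : (gm k).HasClass (lefschetz k - 1) := by
  have h0 : ((aff k Unit).zeroLocus (fun (_ : Unit) _ _ _ (x : Unit → _) => x ())
      fun _ _ _ _ _ _ _ _ _ => rfl).HasClass 1 := by
    have h1 := hasClass_aff_fin (k := k) 0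
    rw [pow_zero] at h1
    refine h1.congr (fun A _ _ => ⟨fun _ => ⟨fun _ => 0, fun _ => rfl⟩, fun _ i => i.elim0,
      fun _ => funext fun i => i.elim0, fun y => Subtype.ext (funext fun _ => (y.2 ()).symm)⟩) ?_
    intro A B _ _ _ _ f x
    exact Subtype.ext (funext fun _ => (map_zero f).symm)
  obtain ⟨d, hd⟩ := hasClass_aff_unit.exists_unitLocus (k := k) (fun _ _ _ (x : Unit → _) => x ())
    fun _ _ => rfl
  have := hasClass_aff_unit.eq_add _ _ hd h0
  rw [this, add_sub_cancel_right]
  exact hd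

end AlgFunctor

end Functors

/-! ### Functors of matrices -/

namespace AlgFunctor

open Matrix

variable {k : Type u} [Field k]

/-- The existence of the class of a subfunctor given by equations and the invertibility of a
function. -/
lemma HasClass.exists_sub {F : AlgFunctor k} {c : K0Var k} (h : F.HasClass c) {ι : Type}
    {a : ι → ∀ (A : Type u) [CommRing A] [Algebra k A], F.obj A → A}
    (ha : ∀ i {A B : Type u} [CommRing A] [Algebra k A] [CommRing B] [Algebra k B] (f : A →ₐ[k] B)
      (x : F.obj A), a i B (F.map f x) = f (a i A x))
    {g : ∀ (A : Type u) [CommRing A] [Algebra k A], F.obj A → A}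
    (hg : ∀ {A B : Type u} [CommRing A] [Algebra k A] [CommRing B] [Algebra k B] (f : A →ₐ[k] B)
      (x : F.obj A), g B (F.map f x) = f (g A x))
    {P : ∀ (A : Type u) [CommRing A] [Algebra k A], F.obj A → Prop}
    (hP : ∀ {A B : Type u} [CommRing A] [Algebra k A] [CommRing B] [Algebra k B] (f : A →ₐ[k] B)
      (x : F.obj A), P A x → P B (F.map f x))
    (hPa : ∀ (A : Type u) [CommRing A] [Algebra k A] (x : F.obj A),
      P A x ↔ (∀ i, a i A x = 0) ∧ IsUnit (g A x)) : ∃ d, (F.sub P hP).HasClass d := by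
  obtain ⟨d, hd⟩ := h.exists_zeroLocus ha
  obtain ⟨e, he⟩ := hd.exists_unitLocus (fun A _ _ (x : (F.zeroLocus a ha).obj A) => g A x.1)
    (fun f x => hg f x.1)
  exact ⟨e, he.congr (fun A _ _ => ⟨fun x => ⟨x.1.1, (hPa A _).mpr ⟨x.1.2, x.2⟩⟩,
    fun y => ⟨⟨y.1, ((hPa A _).mp y.2).1⟩, ((hPa A _).mp y.2).2⟩, fun _ => rfl, fun _ => rfl⟩)
    fun _ _ => rfl⟩

variable (k) in
/-- The functor of matrices. -/
abbrev mat (ι κ : Type) : AlgFunctor k where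
  obj A _ _ := Matrix ι κ A
  map f M := M.map f
  map_id _ := rfl
  map_comp _ _ _ := rfl

lemma exists_hasClass_mat (ι κ : Type) [Fintype ι] [Fintype κ] : ∃ c, (mat k ι κ).HasClass c :=
  ⟨_, (hasClass_aff (ι × κ)).congr (fun A _ _ => Equiv.curry ι κ A) fun _ _ => rfl⟩

variable {ι κ β : Type} [Fintype ι] [DecidableEq ι] [Fintype κ] [DecidableEq κ] [Fintype β]
  [DecidableEq β]

lemma map_det_isUnit {A B : Type u} [CommRing A] [Algebra k A] [CommRing B] [Algebra k B]
    (f : A →ₐ[k] B) {M : Matrix ι ι A} (h : IsUnit M.det) : IsUnit (M.map f).det := by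
  have : (M.map f).det = f M.det := (AlgHom.map_det f M).symm
  rw [this]
  exact h.map f

lemma map_nonsing_inv {A B : Type u} [CommRing A] [Algebra k A] [CommRing B] [Algebra k B]
    (f : A →ₐ[k] B) {M : Matrix ι ι A} (h : IsUnit M.det) : M⁻¹.map f = (M.map f)⁻¹ := by
  refine (inv_eq_right_inv ?_).symm
  rw [← Matrix.map_mul, mul_nonsing_inv _ h, Matrix.map_one _ (map_zero f) (map_one f)]

variable (k ι) in
/-- The functor of symmetric invertible matrices. -/
abbrev symMat : AlgFunctor k :=
  (mat k ι ι).sub (fun _ _ _ M => M.IsSymm ∧ IsUnit M.det)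
    fun f _ h => ⟨h.1.map f, map_det_isUnit f h.2⟩

lemma HasClass.reindex {c : K0Var k} (h : (symMat k ι).HasClass c) (e : ι ≃ κ) :
    (symMat k κ).HasClass c := by
  refine h.congr (fun A _ _ => ⟨fun M => ⟨M.1.submatrix e.symm e.symm, M.2.1.submatrix _, ?_⟩,
    fun M => ⟨M.1.submatrix e e, M.2.1.submatrix _, ?_⟩, fun M => ?_, fun M => ?_⟩) fun _ _ => rfl
  · rw [det_submatrix_equiv_self]
    exact M.2.2
  · rw [det_submatrix_equiv_self]
    exact M.2.2
  · apply Subtype.ext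
    ext; simp
  · apply Subtype.ext
    ext; simp

lemma exists_hasClass_symMat : ∃ c, (symMat k ι).HasClass c := by
  obtain ⟨c, hc⟩ := exists_hasClass_mat (k := k) ι ι
  refine hc.exists_sub (ι := ι × ι) (a := fun p _ _ _ M => M p.1 p.2 - M p.2 p.1)
    (fun _ _ _ _ _ _ _ f M => (map_sub f _ _).symm) (g := fun _ _ _ M => det M)
    (fun f M => (AlgHom.map_det f M).symm) (fun f _ h => ⟨h.1.map f, map_det_isUnit f h.2⟩) fun A _ _ M => and_congr ?_ Iff.rfl
  exact ⟨fun h p => sub_eq_zero.mpr (h.apply _ _), fun h => IsSymm.ext fun i j =>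
    sub_eq_zero.mp (h (j, i))⟩

/-! ### Schur complements -/

section Schur

variable (Q : ∀ (A : Type u) [CommRing A] [Algebra k A], Matrix β β A × Matrix β κ A → Prop)
  (hQ : ∀ {A B : Type u} [CommRing A] [Algebra k A] [CommRing B] [Algebra k B] (f : A →ₐ[k] B)
    (x : Matrix β β A × Matrix β κ A), Q A x → Q B (x.1.map f, x.2.map f))

/-- The functor of symmetric invertible matrices with a condition on the first rows. -/
abbrev symMatWith : AlgFunctor k :=
  (mat k (β ⊕ κ) (β ⊕ κ)).sub
    (fun A _ _ M => (M.IsSymm ∧ IsUnit M.det) ∧ Q A (M.toBlocks₁₁, M.toBlocks₁₂))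
    fun f _ h => ⟨⟨h.1.1.map f, map_det_isUnit f h.1.2⟩, hQ f _ h.2⟩

omit [Fintype κ] [DecidableEq κ] in
lemma isSymm_schur {A : Type u} [CommRing A] {B : Matrix β β A} (hB : B.IsSymm)
    (C : Matrix β κ A) : (Cᵀ * B⁻¹ * C).IsSymm := by
  rw [IsSymm, transpose_mul, transpose_mul, transpose_transpose, transpose_nonsing_inv, hB,
    Matrix.mul_assoc]

lemma isUnit_det_fromBlocks {A : Type u} [CommRing A] {B : Matrix β β A} (hB : IsUnit B.det)
    (C : Matrix β κ A) (D : Matrix κ κ A) :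
    IsUnit (fromBlocks B C Cᵀ D).det ↔ IsUnit (D - Cᵀ * B⁻¹ * C).det := by
  have : Invertible B := invertibleOfIsUnitDet B hB
  rw [det_fromBlocks₁₁, invOf_eq_nonsing_inv, IsUnit.mul_iff, and_iff_right hB]

variable {Q}

/-- The functor of symmetric invertible matrices with an invertible block, in terms of the Schur
complement. -/
lemma HasClass.schur {c d : K0Var k}
    (hQsymm : ∀ (A : Type u) [CommRing A] [Algebra k A] (x : Matrix β β A × Matrix β κ A), Q A x →
      x.1.IsSymm ∧ IsUnit x.1.det)
    (hc : (((mat k β β).prod (mat k β κ)).sub Q hQ).HasClass c)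
    (hd : (symMat k κ).HasClass d) : (symMatWith Q hQ).HasClass (c * d) := by
  -- The first block row `(B, C)` and the Schur complement `S` are free parameters of a symmetric
  -- matrix with invertible block `B`. Its determinant is `det B * det S`.
  refine (hc.prod hd).congr (fun A _ _ => ⟨fun x => ⟨fromBlocks x.1.1.1 x.1.1.2 x.1.1.2ᵀ
    (x.2.1 + x.1.1.2ᵀ * x.1.1.1⁻¹ * x.1.1.2), ?_⟩,
    fun M => ⟨⟨(M.1.toBlocks₁₁, M.1.toBlocks₁₂), M.2.2⟩,
      ⟨M.1.toBlocks₂₂ - M.1.toBlocks₁₂ᵀ * M.1.toBlocks₁₁⁻¹ * M.1.toBlocks₁₂, ?_⟩⟩,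
      fun x => ?_, fun M => ?_⟩) fun {A B} _ _ _ _ f x => ?_
  · obtain ⟨⟨⟨B, C⟩, hq⟩, ⟨S, hS⟩⟩ := x
    obtain ⟨hB, hu⟩ := hQsymm A _ hq
    refine ⟨⟨?_, ?_⟩, hq⟩
    · exact IsSymm.fromBlocks hB rfl (hS.1.add (isSymm_schur hB C))
    · rw [isUnit_det_fromBlocks hu, add_sub_cancel_right]
      exact hS.2
  · obtain ⟨M, hM, hq⟩ := M
    obtain ⟨hB, hu⟩ := hQsymm A _ hq
    have h1 : M.toBlocks₂₁ = M.toBlocks₁₂ᵀ := by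
      ext i j; exact hM.1.apply _ _
    have h2 : M.toBlocks₂₂.IsSymm := by
      ext i j; exact hM.1.apply _ _
    refine ⟨h2.sub (isSymm_schur hB _), ?_⟩
    rw [← isUnit_det_fromBlocks hu, ← h1, fromBlocks_toBlocks]
    exact hM.2
  · apply Prod.ext
    · rfl
    · exact Subtype.ext (add_sub_cancel_right _ _)
  · obtain ⟨M, hM, hq⟩ := M
    have h1 : M.toBlocks₂₁ = M.toBlocks₁₂ᵀ := by
      ext i j; exact hM.1.apply _ _
    apply Subtype.ext
    change fromBlocks M.toBlocks₁₁ M.toBlocks₁₂ M.toBlocks₁₂ᵀ (_ - _ + _) = M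
    rw [sub_add_cancel, ← h1, fromBlocks_toBlocks]
  · obtain ⟨⟨⟨B, C⟩, hq⟩, ⟨S, hS⟩⟩ := x
    obtain ⟨hB, hu⟩ := hQsymm A _ hq
    apply Subtype.ext
    change fromBlocks (B.map f) (C.map f) (C.map f)ᵀ
      (S.map f + (C.map f)ᵀ * (B.map f)⁻¹ * C.map f) = (fromBlocks B C Cᵀ (S + Cᵀ * B⁻¹ * C)).map f
    rw [fromBlocks_map, ← map_nonsing_inv f hu, Matrix.map_add _ (map_add f), Matrix.map_mul,
      Matrix.map_mul, transpose_map]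

end Schur

/-! ### The recursion for invertible symmetric matrices -/

section Recursion

/-- The class of the locus of symmetric invertible matrices whose first entry is invertible. -/
lemma hasClass_unitLocus_symMat {d : K0Var k} (hd : (symMat k κ).HasClass d) :
    ((symMat k (Unit ⊕ κ)).unitLocus (fun _ _ _ M => M.1 (.inl ()) (.inl ())) fun _ _ => rfl).HasClass
      ((lefschetz k - 1) * lefschetz k ^ Fintype.card κ * d) := by
  let Q : ∀ (A : Type u) [CommRing A] [Algebra k A],
    Matrix Unit Unit A × Matrix Unit κ A → Prop := fun A _ _ x => IsUnit (x.1 () ())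
  have hQ : ∀ {A B : Type u} [CommRing A] [Algebra k A] [CommRing B] [Algebra k B] (f : A →ₐ[k] B)
    (x : Matrix Unit Unit A × Matrix Unit κ A), Q A x → Q B (x.1.map f, x.2.map f) :=
    fun f x h => h.map f
  -- `𝕃 - 1` counts the unit corner, and `𝕃 ^ card κ` the rest of the first row.
  have h1 : (((mat k Unit Unit).prod (mat k Unit κ)).sub Q hQ).HasClass
      ((lefschetz k - 1) * lefschetz k ^ Fintype.card κ) :=
    (hasClass_gm.prod (hasClass_aff κ)).congr
      (fun A _ _ => ⟨fun x => ⟨(fun _ => x.1.1, fun _ => x.2), x.1.2⟩,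
        fun y => (⟨y.1.1 (), y.2⟩, y.1.2 ()), fun _ => rfl, fun _ => rfl⟩) fun _ _ => rfl
  have h2 := HasClass.schur hQ (fun A _ _ x hx => ⟨by ext i j; rfl, by
    rw [det_unique]; exact hx⟩) h1 hd
  exact h2.congr (fun A _ _ => ⟨fun M => ⟨⟨M.1, M.2.1⟩, M.2.2⟩, fun M => ⟨M.1.1, M.1.2, M.2⟩,
    fun _ => rfl, fun _ => rfl⟩) fun _ _ => rfl

lemma symMatSupp_map (s : Finset κ) {A B : Type u} [CommRing A] [Algebra k A] [CommRing B]
    [Algebra k B] (f : A →ₐ[k] B) (M : Matrix (Unit ⊕ κ) (Unit ⊕ κ) A)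
    (h : (M.IsSymm ∧ IsUnit M.det) ∧
      ∀ q : Unit ⊕ κ, (∀ i ∈ s, q ≠ .inr i) → M (.inl ()) q = 0) :
    ((M.map f).IsSymm ∧ IsUnit (M.map f).det) ∧
      ∀ q : Unit ⊕ κ, (∀ i ∈ s, q ≠ .inr i) → M.map f (.inl ()) q = 0 :=
  ⟨⟨h.1.1.map f, map_det_isUnit f h.1.2⟩, fun q hq => by rw [map_apply, h.2 q hq, map_zero]⟩

variable (k) in
/-- The functor of symmetric invertible matrices whose first row is supported in `s`. -/
abbrev symMatSupp (s : Finset κ) : AlgFunctor k :=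
  (mat k (Unit ⊕ κ) (Unit ⊕ κ)).sub (fun _ _ _ M => (M.IsSymm ∧ IsUnit M.det) ∧
      ∀ q : Unit ⊕ κ, (∀ i ∈ s, q ≠ .inr i) → M (.inl ()) q = 0)
    (symMatSupp_map s)

lemma exists_hasClass_symMatSupp (s : Finset κ) : ∃ c, (symMatSupp k s).HasClass c := by
  obtain ⟨c, hc⟩ := exists_hasClass_mat (k := k) (Unit ⊕ κ) (Unit ⊕ κ)
  refine hc.exists_sub (ι := ((Unit ⊕ κ) × (Unit ⊕ κ)) ⊕ {q : Unit ⊕ κ // ∀ i ∈ s, q ≠ .inr i})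
    (a := fun p _ _ _ M => p.elim (fun p => M p.1 p.2 - M p.2 p.1) fun q => M (.inl ()) q.1)
    (fun p _ _ _ _ _ _ f M => ?_) (g := fun _ _ _ M => det M)
    (fun f M => (AlgHom.map_det f M).symm) (symMatSupp_map s) fun A _ _ M => ?_
  · rcases p with p | q
    · exact (map_sub f _ _).symm
    · rfl
  · constructor
    · rintro ⟨⟨h1, h2⟩, h3⟩
      refine ⟨?_, h2⟩
      rintro (p | q)
      · exact sub_eq_zero.mpr (h1.apply _ _)
      · exact h3 q.1 q.2
    · rintro ⟨h1, h2⟩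
      exact ⟨⟨IsSymm.ext fun i j => sub_eq_zero.mp (h1 (.inl (j, i))), h2⟩,
        fun q hq => h1 (.inr ⟨q, hq⟩)⟩

/-- The rearrangement of the index set that puts `j` next to the first index. -/
def indexEquiv (j : κ) : (Unit ⊕ Unit) ⊕ {i // i ≠ j} ≃ Unit ⊕ κ where
  toFun := Sum.elim (Sum.elim (fun _ => .inl ()) fun _ => .inr j) fun i => .inr i.1
  invFun := Sum.elim (fun _ => .inl (.inl ())) fun i =>
    if h : i = j then .inl (.inr ()) else .inr ⟨i, h⟩
  left_inv := by rintro ((_ | _) | ⟨i, hi⟩) <;> simp [*]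
  right_inv := by
    rintro (_ | i)
    · rfl
    · by_cases h : i = j <;> simp [h]

lemma det_unit_sum_unit {A : Type u} [CommRing A] (B : Matrix (Unit ⊕ Unit) (Unit ⊕ Unit) A) :
    B.det = B (.inl ()) (.inl ()) * B (.inr ()) (.inr ()) -
      B (.inl ()) (.inr ()) * B (.inr ()) (.inl ()) := by
  let e : Fin 2 ≃ Unit ⊕ Unit :=
    ⟨![.inl (), .inr ()], Sum.elim (fun _ => 0) fun _ => 1,
      fun i => by fin_cases i <;> rfl, by rintro (_ | _) <;> rfl⟩
  rw [← det_submatrix_equiv_self e, det_fin_two]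
  rfl

/-- The corner is zero, so the block on the first index and `j` has rows `(0, u)` and `(u, v)` and
determinant `-u²`. The factors count `u`, then `v`, the other entries of the first row (supported in
`s`), the other entries of row `j`, and the Schur complement. -/
lemma hasClass_unitLocus_symMatSupp {d : K0Var k} {s : Finset κ} {j : κ} (hj : j ∉ s)
    (hd : (symMat k {i // i ≠ j}).HasClass d) :
    ((symMatSupp k (insert j s)).unitLocus (fun _ _ _ M => M.1 (.inl ()) (.inr j))
      fun _ _ => rfl).HasClass
      ((lefschetz k - 1) * (lefschetz k * (lefschetz k ^ s.card *
        lefschetz k ^ (Fintype.card κ - 1))) * d) := by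
  let Q : ∀ (A : Type u) [CommRing A] [Algebra k A],
    Matrix (Unit ⊕ Unit) (Unit ⊕ Unit) A × Matrix (Unit ⊕ Unit) {i // i ≠ j} A → Prop :=
    fun A _ _ x => (x.1.IsSymm ∧ x.1 (.inl ()) (.inl ()) = 0 ∧ IsUnit (x.1 (.inl ()) (.inr ()))) ∧
      ∀ i, i.1 ∉ s → x.2 (.inl ()) i = 0
  have hQ : ∀ {A B : Type u} [CommRing A] [Algebra k A] [CommRing B] [Algebra k B] (f : A →ₐ[k] B)
    (x : Matrix (Unit ⊕ Unit) (Unit ⊕ Unit) A × Matrix (Unit ⊕ Unit) {i // i ≠ j} A), Q A x →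
      Q B (x.1.map f, x.2.map f) := by
    rintro A B _ _ _ _ f x ⟨⟨h1, h2, h3⟩, h4⟩
    refine ⟨⟨h1.map f, ?_, h3.map f⟩, fun i hi => ?_⟩
    · change f (x.1 _ _) = 0
      rw [h2, map_zero]
    · change f (x.2 _ _) = 0
      rw [h4 i hi, map_zero]
  have h1 : (((mat k (Unit ⊕ Unit) (Unit ⊕ Unit)).prod (mat k (Unit ⊕ Unit) {i // i ≠ j})).sub
      Q hQ).HasClass ((lefschetz k - 1) * (lefschetz k * (lefschetz k ^ Fintype.card s *
        lefschetz k ^ Fintype.card {i // i ≠ j}))) := by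
    refine (hasClass_gm.prod (hasClass_aff_unit.prod ((hasClass_aff s).prod
      (hasClass_aff {i // i ≠ j})))).congr
      (fun A _ _ => ⟨fun x => ⟨(fromBlocks 0 (fun _ => x.1.1) (fun _ => x.1.1) (fun _ => x.2.1),
        .of (Sum.elim (fun _ i => if h : i.1 ∈ s then x.2.2.1 ⟨i.1, h⟩ else 0) fun _ => x.2.2.2)), ?_⟩,
        fun y => (⟨fun _ => y.1.1 (.inl ()) (.inr ()), y.2.1.2.2⟩, fun _ => y.1.1 (.inr ()) (.inr ()),
          fun i => y.1.2 (.inl ()) ⟨i.1, fun h => hj (h ▸ i.2)⟩, y.1.2 (.inr ())),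
        fun x => ?_, fun y => ?_⟩) ?_
    · refine ⟨⟨?_, rfl, x.1.2⟩, fun i hi => ?_⟩
      · exact IsSymm.fromBlocks (by ext; rfl) (by ext; rfl) (by ext; rfl)
      · simp [hi]
    · obtain ⟨⟨u, hu⟩, v, r, t⟩ := x
      refine Prod.ext rfl (Prod.ext rfl (Prod.ext ?_ rfl))
      funext i
      simp
    · obtain ⟨⟨B, C⟩, ⟨hB1, hB2, hB3⟩, hC⟩ := y
      apply Subtype.ext
      refine Prod.ext ?_ ?_
      · ext (i | i) (j | j)
        · exact hB2.symm
        · rfl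
        · exact hB1.apply _ _
        · rfl
      · ext (i | i) l
        · by_cases hl : l.1 ∈ s
          · simp [hl]
          · simpa [hl] using (hC l hl).symm
        · rfl
    · rintro A B _ _ _ _ f ⟨⟨u, hu⟩, v, r, t⟩
      apply Subtype.ext
      refine Prod.ext ?_ ?_
      · ext (i | i) (j | j)
        · exact (map_zero f).symm
        · rfl
        · rfl
        · rfl
      · ext (i | i) l
        · by_cases hl : l.1 ∈ s
          · change (if h : _ then f _ else 0) = f (if h : _ then _ else 0)
            simp [hl]
          · change (if h : _ then f _ else 0) = f (if h : _ then _ else 0)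
            simp [hl]
        · rfl
  have hcard : Fintype.card {i // i ≠ j} = Fintype.card κ - 1 := by
    rw [Fintype.card_subtype_compl, Fintype.card_subtype_eq]
  rw [Fintype.card_coe, hcard] at h1
  have h2 := HasClass.schur hQ (fun A _ _ x hx => ⟨hx.1.1, by
    obtain ⟨⟨h3, h4, h5⟩, -⟩ := hx
    have h6 : x.1 (.inr ()) (.inl ()) = x.1 (.inl ()) (.inr ()) := h3.apply _ _
    have h7 : x.1.det = -(x.1 (.inl ()) (.inr ()) * x.1 (.inl ()) (.inr ())) := by
      rw [det_unit_sum_unit, h4, h6, zero_mul, zero_sub]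
    rw [h7]
    exact (h5.mul h5).neg⟩) h1 hd
  refine h2.congr (fun A _ _ => ⟨fun M => ⟨⟨M.1.submatrix (indexEquiv j).symm (indexEquiv j).symm,
    ⟨M.2.1.1.submatrix _, ?_⟩, ?_⟩, ?_⟩,
    fun M => ⟨M.1.1.submatrix (indexEquiv j) (indexEquiv j), ⟨M.1.2.1.1.submatrix _, ?_⟩, ?_⟩,
    fun M => ?_, fun M => ?_⟩) fun _ _ => rfl
  · rw [det_submatrix_equiv_self]
    exact M.2.1.2
  · rintro (q | i) hq
    · exact M.2.2.1.2.1
    · have hij : i ≠ j := fun h => hq j (Finset.mem_insert_self j s) (h ▸ rfl)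
      have h3 : (indexEquiv j).symm (.inr i) = .inr ⟨i, hij⟩ := by simp [indexEquiv, hij]
      rw [submatrix_apply, h3]
      exact M.2.2.2 ⟨i, hij⟩ fun hi => hq i (Finset.mem_insert_of_mem hi) rfl
  · have h3 : (indexEquiv j).symm (.inr j) = .inl (.inr ()) := by simp [indexEquiv]
    change IsUnit (M.1 ((indexEquiv j).symm (.inl ())) ((indexEquiv j).symm (.inr j)))
    rw [h3]
    exact M.2.2.1.2.2
  · rw [det_submatrix_equiv_self]
    exact M.1.2.1.2
  · refine ⟨⟨?_, M.1.2.2 _ fun _ _ => Sum.inl_ne_inr, M.2⟩, fun i hi => M.1.2.2 _ fun l hl h => ?_⟩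
    · ext a b
      exact M.1.2.1.1.apply _ _
    · obtain rfl : i.1 = l := Sum.inr_injective h
      rcases Finset.mem_insert.mp hl with h4 | h4
      · exact i.2 h4
      · exact hi h4
  · apply Subtype.ext
    ext; simp
  · apply Subtype.ext
    apply Subtype.ext
    ext; simp

/-- Induction on `s`. When `j` is added, the entry at `j` is either a unit, as in the previous
lemma, or zero, which is the case of `s`. The unit strata add up by `(𝕃 - 1) 𝕃 ^ s.card = 𝕃 ^
(s.card + 1) - 𝕃 ^ s.card`. For empty `s` the first row vanishes and no invertible matrix is left.
-/
lemma hasClass_symMatSupp {d : K0Var k} (hd : ∀ j : κ, (symMat k {i // i ≠ j}).HasClass d)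
    (s : Finset κ) : (symMatSupp k s).HasClass
      (lefschetz k ^ Fintype.card κ * (lefschetz k ^ s.card - 1) * d) := by
  -- The scissor relation compares classes known to exist, so existence comes first and the
  -- induction then determines the value.
  obtain ⟨c, hc⟩ := exists_hasClass_symMatSupp (k := k) s
  have : c = lefschetz k ^ Fintype.card κ * (lefschetz k ^ s.card - 1) * d := by
    induction s using Finset.induction_on generalizing c with
    | empty =>
      rw [Finset.card_empty, pow_zero, sub_self, mul_zero, zero_mul]
      refine hc.of_isEmpty fun A _ _ M => ?_
      obtain ⟨M, ⟨-, h1⟩, h2⟩ := M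
      rw [det_eq_zero_of_row_eq_zero (.inl ()) fun q => h2 q (by simp)] at h1
      exact isUnit_zero_iff.mp h1 |> subsingleton_of_zero_eq_one
    | insert j s hj ih =>
      obtain ⟨c', hc'⟩ := exists_hasClass_symMatSupp (k := k) s
      have h1 := hc.eq_add (fun A _ _ (M : (symMatSupp k (insert j s)).obj A) =>
        M.1 (.inl ()) (.inr j)) (fun _ _ => rfl) (hasClass_unitLocus_symMatSupp hj (hd j)) (e := c') (by
          refine hc'.congr (fun A _ _ => ⟨fun M => ⟨⟨M.1, M.2.1, fun q hq => M.2.2 q fun i hi =>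
            hq i (Finset.mem_insert_of_mem hi)⟩, fun _ => M.2.2 _ fun i hi h =>
              hj ((Sum.inr_injective h : j = i) ▸ hi)⟩,
            fun M => ⟨M.1.1, M.1.2.1, fun q hq => ?_⟩, fun _ => rfl, fun _ => rfl⟩) fun _ _ => rfl
          by_cases h : q = .inr j
          · rw [h]; exact M.2 ()
          · exact M.1.2.2 q fun i hi => by
              rcases Finset.mem_insert.mp hi with rfl | hi
              · exact h
              · exact hq i hi)
      have hpos : 0 < Fintype.card κ := Fintype.card_pos_iff.mpr ⟨j⟩
      obtain ⟨m, hm⟩ := Nat.exists_eq_add_of_lt hpos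
      rw [h1, ih c' hc', Finset.card_insert_of_notMem hj, hm]
      simp only [zero_add, Nat.add_sub_cancel]
      ring
  rwa [← this]

/-- The recursion for the classes of the spaces of symmetric invertible matrices. -/
lemma class_symMat_recursion {c d d' : K0Var k} (hc : (symMat k (Unit ⊕ κ)).HasClass c)
    (hd : (symMat k κ).HasClass d) (hd' : ∀ j : κ, (symMat k {i // i ≠ j}).HasClass d') :
    c = (lefschetz k - 1) * lefschetz k ^ Fintype.card κ * d +
      lefschetz k ^ Fintype.card κ * (lefschetz k ^ Fintype.card κ - 1) * d' := by
  refine hc.eq_add _ _ (hasClass_unitLocus_symMat hd)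
    -- A vanishing corner means that the first row is supported in all of `κ`.
    ((hasClass_symMatSupp hd' Finset.univ).congr (fun A _ _ =>
      ⟨fun M => ⟨⟨M.1, M.2.1⟩, fun _ => M.2.2 _ (by simp)⟩,
       fun M => ⟨M.1.1, M.1.2, fun q hq => ?_⟩, fun _ => rfl, fun _ => rfl⟩) fun _ _ => rfl)
  rcases q with q | i
  · exact M.2 ()
  · exact absurd rfl (hq i (Finset.mem_univ i))

end Recursion

end AlgFunctor

/-! ### The classes of nondegenerate forms -/

section QuadClass

open AlgFunctor Matrix

variable {k : Type u} [Field k]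

/-- `Quad_{n,n}` is defined through rank loci, but by `isQuadPoint_self_iff` its points are the
forms with invertible polar matrix, so it is isomorphic to the affine scheme of invertible symmetric
matrices. -/
lemma hasClass_symMat_fin (h2 : (2 : k) ≠ 0) (n : ℕ) :
    (symMat k (Fin n)).HasClass (K0Var.mk (quadVar k n n)) := by
  obtain ⟨c, R, _, _, _, x, hx, rfl⟩ := exists_hasClass_symMat (k := k) (ι := Fin n)
  refine ⟨R, inferInstance, inferInstance, inferInstance, x, hx, ?_⟩
  obtain ⟨φ, -⟩ := exists_iso_of_rel (X := specOver k R) (Y := quad k n n)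
    (fun A _ _ t y => ∃ g : R →ₐ[k] A, t = specOverMap g ∧ polarMat (coeffs y) = x.1.map g)
    (by
      rintro A B _ _ _ _ f t y ⟨g, rfl, hg⟩
      refine ⟨f.comp g, (specOverMap_comp _ _).symm, ?_⟩
      rw [coeffs_comp, polarMat_map, hg]
      rfl)
    (fun A _ _ t => by
      obtain ⟨g, rfl⟩ := exists_specOverMap t
      obtain ⟨c, hc⟩ := exists_polarMat_eq (isUnit_two A h2) (M := x.1.map g) (x.2.1.map g)
      obtain ⟨y, rfl⟩ := exists_point ((isQuadPoint_self_iff h2 (c := c)).mpr (by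
        rw [hc]; exact map_det_isUnit g x.2.2))
      refine ⟨y, ⟨g, rfl, hc⟩, ?_⟩
      rintro y' ⟨g', hg', h⟩
      rw [← specOverMap_injective hg'] at h
      exact coeffs_injective (polarMat_injective (isUnit_two A h2) (h.trans hc.symm)))
    (fun A _ _ y => by
      obtain ⟨g, hg⟩ := (hx A).2 ⟨polarMat (coeffs y), polarMat_isSymm _,
        (isQuadPoint_self_iff h2).mp (isQuadPoint_coeffs y)⟩
      have hg' : x.1.map g = polarMat (coeffs y) := congrArg Subtype.val hg
      refine ⟨specOverMap g, ⟨g, rfl, hg'.symm⟩, ?_⟩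
      rintro t ⟨g', rfl, h⟩
      exact congrArg specOverMap ((hx A).1 (Subtype.ext (h.symm.trans hg'.symm))))
  exact K0Var.mk_eq_of_iso φ

lemma mk_quadVar_zero (h2 : (2 : k) ≠ 0) : K0Var.mk (quadVar k 0 0) = 1 := by
  have h1 := hasClass_aff_fin (k := k) 0
  rw [pow_zero] at h1
  refine (hasClass_symMat_fin h2 0).unique (h1.congr (fun A _ _ =>
    ⟨fun _ => ⟨1, transpose_one, by simp⟩, fun _ i => i.elim0, fun _ => funext fun i => i.elim0,
      fun _ => Subtype.ext (Matrix.ext fun i => i.elim0)⟩) ?_)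
  intro A B _ _ _ _ f y
  exact Subtype.ext (Matrix.ext fun i => i.elim0)

/-- For `n = 0` the truncated `n - 1` is harmless, because its coefficient contains the factor `𝕃 ^
0 - 1 = 0`. -/
lemma mk_quadVar_succ (h2 : (2 : k) ≠ 0) (n : ℕ) : K0Var.mk (quadVar k (n + 1) (n + 1)) =
    (lefschetz k - 1) * lefschetz k ^ n * K0Var.mk (quadVar k n n) +
      lefschetz k ^ n * (lefschetz k ^ n - 1) * K0Var.mk (quadVar k (n - 1) (n - 1)) := by
  have h3 := class_symMat_recursion (κ := Fin n)
    ((hasClass_symMat_fin h2 (n + 1)).reindex (Fintype.equivOfCardEq (by simp [add_comm])))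
    (hasClass_symMat_fin h2 n) (fun j => (hasClass_symMat_fin h2 (n - 1)).reindex
      (Fintype.equivOfCardEq (by
        rw [Fintype.card_subtype_compl, Fintype.card_subtype_eq]; simp)))
  rwa [Fintype.card_fin] at h3

end QuadClass

/-! ### Gaussian binomial coefficients and the summation -/

section GaussianBinomials

variable {R S : Type*} [CommRing R] [CommRing S]

/-- The Gaussian binomial coefficient, defined at any element `q` of a commutative ring by the
`q`-Pascal rule. -/
def qBinom (q : R) : ℕ → ℕ → R
  | _, 0 => 1
  | 0, _ + 1 => 0
  | n + 1, r + 1 => qBinom q n r + q ^ (r + 1) * qBinom q n (r + 1)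

theorem qBinom_zero_right (q : R) (n : ℕ) : qBinom q n 0 = 1 := by
  cases n <;> rfl

theorem qBinom_succ_succ (q : R) (n r : ℕ) :
    qBinom q (n + 1) (r + 1) = qBinom q n r + q ^ (r + 1) * qBinom q n (r + 1) := rfl

theorem qBinom_eq_zero_of_lt (q : R) {n r : ℕ} (h : n < r) : qBinom q n r = 0 := by
  induction n generalizing r with
  | zero => obtain ⟨r, rfl⟩ := Nat.exists_eq_succ_of_ne_zero h.ne'; rfl
  | succ n ih =>
    obtain ⟨r, rfl⟩ := Nat.exists_eq_succ_of_ne_zero (Nat.ne_zero_of_lt h)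
    rw [Nat.succ_eq_add_one, qBinom_succ_succ, ih (by omega), ih (by omega), mul_zero, add_zero]

theorem qBinom_self (q : R) (n : ℕ) : qBinom q n n = 1 := by
  induction n with
  | zero => rfl
  | succ n ih =>
    rw [qBinom_succ_succ, ih, qBinom_eq_zero_of_lt q n.lt_succ_self, mul_zero, add_zero]

theorem map_qBinom (f : R →+* S) (q : R) (n r : ℕ) :
    f (qBinom q n r) = qBinom (f q) n r := by
  induction n generalizing r with
  | zero => cases r <;> simp [qBinom]
  | succ n ih => cases r <;> simp [qBinom, ih]

/-- The ratio of consecutive coefficients, `(q ^ (n - r) - 1) / (q ^ (r + 1) - 1)`, multiplied out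
so that it holds for every `q` in every commutative ring and without `r ≤ n`. -/
theorem qBinom_succ_mul (q : R) (n r : ℕ) :
    qBinom q n (r + 1) * (q ^ r * (q ^ (r + 1) - 1)) = qBinom q n r * (q ^ n - q ^ r) := by
  induction n generalizing r with
  | zero => cases r <;> simp [qBinom]
  | succ n ih =>
    cases r with
    | zero =>
      have h := ih 0
      rw [qBinom_zero_right] at h ⊢
      rw [qBinom_succ_succ, qBinom_zero_right]
      linear_combination q * h
    | succ r =>
      rw [qBinom_succ_succ, qBinom_succ_succ q n r]
      linear_combination q ^ (r + 2) * ih (r + 1) + q * ih r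

theorem gaussInt_add (m n : ℕ) :
    gaussInt (m + n) = gaussInt m + Polynomial.X ^ m * gaussInt n := by
  simp only [gaussInt, Finset.sum_range_add, Finset.mul_sum, pow_add]

theorem gaussFactorial_succ (n : ℕ) :
    gaussFactorial (n + 1) = gaussFactorial n * gaussInt (n + 1) :=
  Finset.prod_range_succ _ _

theorem monic_gaussFactorial (n : ℕ) : (gaussFactorial n).Monic :=
  Polynomial.monic_prod_of_monic _ _ fun i _ => Polynomial.monic_geom_sum_X i.succ_ne_zero

/-- The splitting `[r + s] = [r] + q ^ r [s]` matches the `q`-Pascal rule. As the factorials are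
monic, the identity shows that the division in `gaussBinom` is exact and has quotient `qBinom`. -/
theorem qBinom_mul_gaussFactorial (r s : ℕ) :
    qBinom Polynomial.X (r + s) r * (gaussFactorial r * gaussFactorial s) =
      gaussFactorial (r + s) := by
  have h0 : gaussFactorial 0 = 1 := rfl
  induction h : r + s generalizing r s with
  | zero =>
    obtain ⟨rfl, rfl⟩ := Nat.add_eq_zero_iff.1 h
    simp [h0, qBinom]
  | succ n ih =>
    rcases r with _ | r
    · obtain rfl : s = n + 1 := by omega
      rw [qBinom_zero_right, h0, one_mul, one_mul]
    rcases s with _ | s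
    · obtain rfl : r = n := by omega
      rw [qBinom_self, h0, one_mul, mul_one]
    have h1 := ih r (s + 1) (by omega)
    have h2 := ih (r + 1) s (by omega)
    have h3 : gaussInt (n + 1) = _ := (congrArg gaussInt h).symm.trans (gaussInt_add (r + 1) (s + 1))
    rw [qBinom_succ_succ, gaussFactorial_succ n, h3]
    rw [gaussFactorial_succ] at h1 h2
    rw [gaussFactorial_succ, gaussFactorial_succ]
    linear_combination gaussInt (r + 1) * h1 + Polynomial.X ^ (r + 1) * gaussInt (s + 1) * h2

theorem gaussBinom_sub_eq_qBinom {n r : ℕ} (h : r ≤ n) :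
    gaussBinom n (n - r) = qBinom Polynomial.X n r := by
  obtain ⟨s, rfl⟩ := Nat.exists_eq_add_of_le h
  rw [gaussBinom, Nat.add_sub_cancel_left, Nat.add_sub_cancel, ← qBinom_mul_gaussFactorial,
    mul_comm (gaussFactorial s), mul_comm (qBinom _ _ _),
    Polynomial.mul_divByMonic_cancel_left _
      ((monic_gaussFactorial r).mul (monic_gaussFactorial s))]

theorem aeval_gaussBinom_sub (q : R) {n r : ℕ} (h : r ≤ n) :
    Polynomial.aeval q (gaussBinom n (n - r)) = qBinom q n r := by
  rw [gaussBinom_sub_eq_qBinom h]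
  simpa using map_qBinom (Polynomial.aeval q : ℤ[X] →ₐ[ℤ] R).toRingHom Polynomial.X n r

/-- The recursion satisfied by the numbers of nondegenerate quadratic forms determines the sum of
these numbers weighted by Gaussian binomial coefficients. -/
theorem sum_qBinom_mul (q : R) (d : ℕ → R) (h0 : d 0 = 1)
    (hd : ∀ n, d (n + 1) = (q - 1) * q ^ n * d n + q ^ n * (q ^ n - 1) * d (n - 1)) (n : ℕ) :
    ∑ r ∈ Finset.range (n + 1), qBinom q n r * d r = q ^ (n + 1).choose 2 := by
  induction n with
  | zero => simp [h0, qBinom]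
  | succ n ih =>
    -- The term `r = 0` vanishes, so `d (0 - 1)` plays no role. After a shift of the index,
    -- `qBinom_succ_mul` rewrites the sum in terms of `d r`.
    have h1 : ∑ r ∈ Finset.range (n + 1), qBinom q n r * (q ^ r * (q ^ r - 1)) * d (r - 1) =
        ∑ r ∈ Finset.range (n + 1), q * (qBinom q n r * (q ^ n - q ^ r)) * d r := by
      rw [Finset.sum_range_succ', Finset.sum_range_succ (n := n)]
      simp only [pow_zero, sub_self, mul_zero, zero_mul, add_zero, Nat.add_sub_cancel]
      refine Finset.sum_congr rfl fun r _ => ?_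
      linear_combination q * d r * qBinom_succ_mul q n r
    have h2 : ∑ r ∈ Finset.range (n + 1), q ^ (r + 1) * qBinom q n (r + 1) * d (r + 1) + 1 =
        ∑ r ∈ Finset.range (n + 1), q ^ r * qBinom q n r * d r := by
      rw [Finset.sum_range_succ, Finset.sum_range_succ',
        qBinom_eq_zero_of_lt q n.lt_succ_self, qBinom_zero_right, h0]
      ring
    have h3 : (n + 1 + 1).choose 2 = n + 1 + (n + 1).choose 2 := by
      rw [Nat.choose_succ_succ' (n + 1) 1, Nat.choose_one_right]
    rw [h3, pow_add, ← ih, Finset.sum_range_succ', qBinom_zero_right, h0, one_mul]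
    simp only [qBinom_succ_succ, add_mul, Finset.sum_add_distrib]
    rw [add_assoc, h2]
    have h4 : ∀ r, qBinom q n r * d (r + 1) = qBinom q n r * ((q - 1) * q ^ r) * d r +
        qBinom q n r * (q ^ r * (q ^ r - 1)) * d (r - 1) := fun r => by rw [hd]; ring
    simp only [h4, Finset.sum_add_distrib]
    rw [h1, ← Finset.sum_add_distrib, ← Finset.sum_add_distrib, Finset.mul_sum]
    -- The coefficient of `qBinom q n r * d r` is `(q - 1) q ^ r + q (q ^ n - q ^ r) + q ^ r = q ^
    -- (n + 1)`, independent of `r`.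
    refine Finset.sum_congr rfl fun r _ => ?_
    ring

end GaussianBinomials

end QuadMotive

end

/-! ### The main theorem -/

theorem corollary3p2 (k : Type u) [Field k] (hk : ringChar k ≠ 2) :
    (∀ n r : ℕ, r ≤ n →
      (∃ G : Over (Spec (.of k)), Nonempty (QuadMotive.GrassmannianData (n - r) n G)) ∧
      ∀ (G : Over (Spec (.of k))) (e : QuadMotive.GrassmannianData (n - r) n G),
        ∃ π : QuadMotive.quad k n r ⟶ G,
          QuadMotive.IsRadicalMap e π ∧
          QuadMotive.IsZariskiLocallyTrivial π (QuadMotive.quad k r r)) ∧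
    ∀ n : ℕ,
      QuadMotive.lefschetz k ^ (n + 1).choose 2 =
        ∑ r ∈ Finset.range (n + 1),
          Polynomial.aeval (QuadMotive.lefschetz k) (QuadMotive.gaussBinom n (n - r)) *
            QuadMotive.K0Var.mk (QuadMotive.quadVar k r r) := by
  have h2 : (2 : k) ≠ 0 := Ring.two_ne_zero hk
  refine ⟨fun n r hr => ⟨?_, fun G e => QuadMotive.exists_isRadicalMap h2 hr e⟩, fun n => ?_⟩
  · exact ⟨_, QuadMotive.nonempty_grassmannianData k (n - r) n⟩
  · rw [← QuadMotive.sum_qBinom_mul (QuadMotive.lefschetz k)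
      (fun r => QuadMotive.K0Var.mk (QuadMotive.quadVar k r r)) (QuadMotive.mk_quadVar_zero h2)
      (QuadMotive.mk_quadVar_succ h2) n]
    refine Finset.sum_congr rfl fun r hr => ?_
    rw [QuadMotive.aeval_gaussBinom_sub _ (Finset.mem_range_succ_iff.1 hr)]
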